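/- Let $G=SU(2)$ and let $\langle\xi,\eta\rangle=c\,\mathrm{tr}(\xi\eta)$, $c\in\mathbb R\setminus\{0\}$, be an $\mathrm{Ad}$-invariant symmetric bilinear form on $\mathfrak{su}(2)$ (an inner product for $c<0$, the Killing form for $c=4$); products of $\mathfrak{su}(2)$-valued one-forms are taken with $\langle\alpha,\beta\rangle(v,w)=\langle\alpha(v),\beta(w)\rangle-\langle\alpha(w),\beta(v)\rangle$. Let $\theta=g^{-1}dg$, $\bar\theta=dg\,g^{-1}$ and $\chi=\frac1{12}\langle\theta,[\theta,\theta]\rangle$, and put the sums of these forms on powers of $G$. A quasi-Hamiltonian $G^n$-space is a smooth $G^n$-manifold $M$ with an invariant two-form $\omega$ and an equivariant smooth map $\mu:M\to G^n$ such that $d\omega=-\mu^*\chi$, $\iota(v_\xi)\omega=\frac12\langle\mu^*(\theta+\bar\theta),\xi\rangle$ and $\ker\omega_x=\{v_\xi(x):\mathrm{Ad}_{\mu(x)}\xi=-\xi\}$, where $v_\xi(x)=\frac d{dt}|_{t=0}\,e^{t\xi}\cdot x$; isomorphisms are the equivariant diffeomorphisms compatible with the two-forms and the moment maps. For a sphere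 $\Sigma$ with $n\ge1$ boundary circles $B_1,\dots,B_n$ let $$\mathcal N^G(\Sigma)=\{(a_2,\dots,a_n,b_1,\dots,b_n)\in G^{2n-1}: b_1(a_2b_2a_2^{-1})\cdots(a_nb_na_n^{-1})=1\},$$ a manifold diffeomorphic to $G^{2(n-1)}$ by forgetting $b_1$, with the $G^n$-action $\sigma\cdot(a,b)=(\sigma_1a_i\sigma_i^{-1},\sigma_jb_j\sigma_j^{-1})$, the moment map $\mu=(b_1^{-1},\dots,b_n^{-1})$ and the two-form $$\omega_{\mathcal N^G(\Sigma)}=\sum_{i=2}^n\Bigl(\tfrac12\langle\mathrm{Ad}_{b_i}a_i^*\theta,a_i^*\theta\rangle+\tfrac12\langle a_i^*\theta,b_i^*(\theta+\bar\theta)\rangle\Bigr)+\tfrac12\sum_{i=3}^n\langle(\mu_2\cdots\mu_{i-1})^*\theta,\mu_i^*\bar\theta\rangle,\qquad \mu_i=a_ib_ia_i^{-1}.$$ Let a simple closed curve $C$ cut $\Sigma$ into $\Sigma^+$, with boundary circles $B_1,\dots,B_{m+1},C$, and $\Sigma^-$, with boundary circles $C,B_{m+2},\dots,B_n$ ($0\le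 m\le n-1$). On $\mathcal N^G(\Sigma^+\amalg\Sigma^-)=\mathcal N^G(\Sigma^+)\times\mathcal N^G(\Sigma^-)$ take the fusion two-form $\omega^++\omega^-+\frac12\langle((b^+_{m+2})^{-1})^*\theta,((b^-_1)^{-1})^*\bar\theta\rangle$, the diagonal subgroup $G_C\cong G$ of the two factors belonging to $C$, its moment map $\nu^G_C=(b_1^-b_{m+2}^+)^{-1}$, and the action of $G^n$ through the remaining boundary circles. Define $\pi_C:(\nu_C^G)^{-1}(1)\to\mathcal N^G(\Sigma)$ by $$\pi_C\bigl((a^+,b^+),(a^-,b^-)\bigr)=(a_2^+,\dots,a_{m+1}^+,a_{m+2}^+a_2^-,\dots,a_{m+2}^+a_{n-m}^-;\,b_1^+,\dots,b_{m+1}^+,b_2^-,\dots,b_{n-m}^-).$$ Then $\mathcal N^G(\Sigma)$ is a quasi-Hamiltonian $G^n$-space; $(\nu_C^G)^{-1}(1)$ is an embedded submanifold, with inclusion $\iota$, and $\iota^*\omega_{\mathcal N^G(\Sigma^+\amalg\Sigma^-)}=\pi_C^*\omega_{\mathcal N^G(\Sigma)}$; the quotient $(\nu_C^G)^{-1}(1)/G_C$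 is a smooth manifold for which the projection is a submersion, and it is a quasi-Hamiltonian $G^n$-space with the two-form induced by $\iota^*\omega_{\mathcal N^G(\Sigma^+\amalg\Sigma^-)}$ and the moment map $(b_1^+,\dots,b_{m+1}^+,b_2^-,\dots,b_{n-m}^-)^{-1}$ (componentwise inverse); and $\pi_C$ induces an isomorphism of quasi-Hamiltonian $G^n$-spaces $$(\nu_C^G)^{-1}(1)/G_C\;\cong\;\mathcal N^G(\Sigma).$$ -/

import Mathlib

open scoped Manifold ContDiff

/- The Banach algebra structure on matrices, so that maps into `Matrix (Fin 2) (Fin 2) ℂ` can be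
differentiated. Only the underlying topology matters; it is the standard one, and the two general
instances for matrices, which define the same topology, are switched off to avoid a clash. -/
attribute [local instance] Matrix.linftyOpNormedRing Matrix.linftyOpNormedAlgebra
attribute [-instance] instTopologicalSpaceMatrix Matrix.instUniformSpace

noncomputable section

namespace Gluing

/-! ### The Lie group `SU(2)` -/

/-- The real vector space of complex `2 × 2` matrices, containing `SU(2)` and `𝔰𝔲(2)`. -/
abbrev Mat : Type := Matrix (Fin 2) (Fin 2) ℂ

/-- The group `G = SU(2)`. -/
abbrev SU2 : Type := Matrix.specialUnitaryGroup (Fin 2) ℂ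

theorem SU2.coe_inv (g : SU2) : ((g⁻¹ : SU2) : Mat) = star (g : Mat) := rfl

instance : ContinuousInv SU2 :=
  ⟨continuous_induced_rng.2 (Continuous.matrix_conjTranspose continuous_subtype_val)⟩

instance : IsTopologicalGroup SU2 where

/-- The second row of an element of `SU(2)` is determined by the first one. -/
theorem SU2.second_row (g : SU2) :
    (g : Mat) 1 0 = -star ((g : Mat) 0 1) ∧ (g : Mat) 1 1 = star ((g : Mat) 0 0) := by
  have h1 : (g : Mat) * star (g : Mat) = 1 := g.2.1.2
  have h2 : (g : Mat).det = 1 := g.2.2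
  have h3 : star (g : Mat) = (g : Mat).adjugate := by
    calc star (g : Mat) = ((g : Mat).adjugate * (g : Mat)) * star (g : Mat) := by
          rw [Matrix.adjugate_mul, h2, one_smul, one_mul]
      _ = (g : Mat).adjugate := by rw [mul_assoc, h1, mul_one]
  rw [Matrix.adjugate_fin_two] at h3
  have e1 := congrFun (congrFun h3 0) 0
  have e2 := congrFun (congrFun h3 1) 0
  simp [Matrix.star_apply] at e1 e2
  refine ⟨?_, ?_⟩
  · simp [e2]
  · simp [e1]

/-- The point `(Re α, Im α, Re β, Im β)` of `ℝ⁴` attached to a matrix with first row `(α, β)`. -/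
def row (A : Mat) : EuclideanSpace ℝ (Fin 4) :=
  !₂[(A 0 0).re, (A 0 0).im, (A 0 1).re, (A 0 1).im]

/-- The matrix `(α, β; -β̄, ᾱ)` attached to the point `(Re α, Im α, Re β, Im β)` of `ℝ⁴`. -/
def unrow (x : EuclideanSpace ℝ (Fin 4)) : Mat :=
  !![⟨x 0, x 1⟩, ⟨x 2, x 3⟩; ⟨-x 2, x 3⟩, ⟨x 0, -x 1⟩]

theorem continuous_row : Continuous row := by
  unfold row
  fun_prop

theorem continuous_unrow : Continuous unrow := by
  have h : ∀ f g : EuclideanSpace ℝ (Fin 4) → ℝ, Continuous f → Continuous g →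
      Continuous (fun x => (⟨f x, g x⟩ : ℂ)) := fun f g hf hg =>
    Complex.equivRealProdCLM.symm.continuous.comp (hf.prodMk hg)
  refine continuous_matrix fun i j => ?_
  fin_cases i <;> fin_cases j <;> simp only [unrow] <;> apply h <;> fun_prop

/-- The standard identification of `SU(2)` with the unit sphere `S³ ⊂ ℝ⁴`. -/
def toSphere : SU2 ≃ₜ Metric.sphere (0 : EuclideanSpace ℝ (Fin 4)) 1 where
  toFun g := ⟨row g, by
    have h2 : (g : Mat).det = 1 := g.2.2
    obtain ⟨e1, e2⟩ := g.second_row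
    rw [Matrix.det_fin_two, e1, e2] at h2
    have h3 := congrArg Complex.re h2
    simp at h3
    simp [EuclideanSpace.norm_eq, Fin.sum_univ_four, row]
    nlinarith⟩
  invFun x := ⟨unrow x, by
    have hx : ‖(x : EuclideanSpace ℝ (Fin 4))‖ = 1 := mem_sphere_zero_iff_norm.1 x.2
    rw [EuclideanSpace.norm_eq, Real.sqrt_eq_one, Fin.sum_univ_four] at hx
    simp only [Real.norm_eq_abs, sq_abs] at hx
    rw [Matrix.mem_specialUnitaryGroup_iff, Matrix.mem_unitaryGroup_iff]
    constructor
    · ext i j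
      fin_cases i <;> fin_cases j <;> apply Complex.ext <;>
        simp [unrow, Matrix.mul_apply, Fin.sum_univ_two, Matrix.star_apply] <;> nlinarith
    · apply Complex.ext <;> simp [unrow, Matrix.det_fin_two] <;> nlinarith⟩
  left_inv g := by
    obtain ⟨e1, e2⟩ := g.second_row
    apply Subtype.ext
    ext i j
    fin_cases i <;> fin_cases j <;> apply Complex.ext <;> simp [unrow, row, e1, e2]
  right_inv x := by
    apply Subtype.ext
    ext i
    fin_cases i <;> simp [unrow, row]
  continuous_toFun := continuous_induced_rng.2 (continuous_row.comp continuous_subtype_val)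
  continuous_invFun := continuous_induced_rng.2 (continuous_unrow.comp continuous_subtype_val)

/-- The charted space structure on `M` transported from `P` along a homeomorphism. -/
abbrev transportCharts {H M P : Type*} [TopologicalSpace H] [TopologicalSpace M]
    [TopologicalSpace P] [ChartedSpace H P] (e : M ≃ₜ P) : ChartedSpace H M where
  atlas := (fun φ => e.toOpenPartialHomeomorph ≫ₕ φ) '' atlas H P
  chartAt x := e.toOpenPartialHomeomorph ≫ₕ chartAt H (e x)
  mem_chart_source x := by simp
  chart_mem_atlas x := Set.mem_image_of_mem _ (chart_mem_atlas H (e x))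

/-- `SU(2)` as a `3`-dimensional manifold. -/
instance : ChartedSpace (EuclideanSpace ℝ (Fin 3)) SU2 :=
  transportCharts toSphere

/-- The product group `Gⁿ`, with its product manifold structure. -/
abbrev Gpow (n : ℕ) : Type := Fin n → SU2

/-- The model with corners of the manifold `Gⁿ`. -/
abbrev Ipow (n : ℕ) : ModelWithCorners ℝ (Fin n → EuclideanSpace ℝ (Fin 3))
    (ModelPi fun _ : Fin n => EuclideanSpace ℝ (Fin 3)) :=
  ModelWithCorners.pi fun _ => 𝓡 3

/-! ### Differential forms -/

/-- The bilinear form `⟨X, Y⟩ = c · tr(XY)` on `𝔰𝔲(2)` (where `tr(XY)` is real). The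
`Ad`-invariant inner products on `𝔰𝔲(2)` are the ones with `c < 0`; the Killing form is `c = 4`. -/
def pairing (c : ℝ) (X Y : Mat) : ℝ := c * (Matrix.trace (X * Y)).re

/-- `pairing` as a continuous bilinear map. -/
def pairingCLM (c : ℝ) : Mat →L[ℝ] Mat →L[ℝ] ℝ :=
  LinearMap.toContinuousLinearMap
    { toFun := fun X => LinearMap.toContinuousLinearMap
        { toFun := fun Y => pairing c X Y
          map_add' := fun Y Z => by simp [pairing, mul_add]
          map_smul' := fun r Y => by simp [pairing]; ring }
      map_add' := fun X Y => by ext Z; simp [pairing, add_mul, mul_add]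
      map_smul' := fun r X => by ext Z; simp [pairing]; ring }

section Wedge

variable {E : Type*} [AddCommGroup E] [Module ℝ E] [TopologicalSpace E]

/-- For two `Mat`-valued one-forms `α`, `β`, the real two-form `⟨α, β⟩` obtained from the wedge
product and the pairing: `⟨α, β⟩(v, w) = ⟨α(v), β(w)⟩ - ⟨α(w), β(v)⟩`. -/
def wedge (c : ℝ) (α β : E →L[ℝ] Mat) : E [⋀^Fin 2]→L[ℝ] ℝ where
  toFun v := pairing c (α (v 0)) (β (v 1)) - pairing c (α (v 1)) (β (v 0))
  map_update_add' v i x y := by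
    fin_cases i <;> simp [pairing, add_mul, mul_add] <;> ring
  map_update_smul' v i r x := by
    fin_cases i <;> simp [pairing] <;> ring
  map_eq_zero_of_eq' v i j h hij := by
    fin_cases i <;> fin_cases j <;> simp_all
  cont := by
    have h : Continuous fun p : Mat × Mat => pairing c p.1 p.2 := by
      have h0 : Continuous fun p : Mat × Mat => Matrix.trace (p.1 * p.2) := by fun_prop
      exact continuous_const.mul (Complex.continuous_re.comp h0)
    exact (h.comp (f := fun v : Fin 2 → E => (α (v 0), β (v 1))) (by fun_prop)).sub
      (h.comp (f := fun v : Fin 2 → E => (α (v 1), β (v 0))) (by fun_prop))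

end Wedge

section Forms

variable {E : Type*} [NormedAddCommGroup E] [NormedSpace ℝ E] {H : Type*} [TopologicalSpace H]
  {M : Type*} [TopologicalSpace M] [ChartedSpace H M]
  {E' : Type*} [NormedAddCommGroup E'] [NormedSpace ℝ E'] {H' : Type*} [TopologicalSpace H']
  {M' : Type*} [TopologicalSpace M'] [ChartedSpace H' M']

/-- A (not necessarily smooth) two-form on the manifold `M`. -/
abbrev TwoForm (I : ModelWithCorners ℝ E H) (M : Type*) [TopologicalSpace M] [ChartedSpace H M] :=
  (x : M) → TangentSpace I x [⋀^Fin 2]→L[ℝ] ℝ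

/-- The pull-back `f^* Ω`. -/
def TwoForm.pullback (I : ModelWithCorners ℝ E H) (I' : ModelWithCorners ℝ E' H')
    (f : M → M') (Ω : TwoForm I' M') : TwoForm I M :=
  fun x => (Ω (f x)).compContinuousLinearMap (mfderiv I I' f x)

/-- The expression of a two-form in the preferred chart at `x₀`, i.e. its pull-back under the
inverse of that chart (for manifolds without boundary). -/
def TwoForm.inChart (I : ModelWithCorners ℝ E H) (Ω : TwoForm I M) (x₀ : M) :
    E → E [⋀^Fin 2]→L[ℝ] ℝ :=
  TwoForm.pullback 𝓘(ℝ, E) I (extChartAt I x₀).symm Ω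

/-- A two-form is smooth if its expressions in charts are. -/
def TwoForm.IsSmooth (I : ModelWithCorners ℝ E H) (Ω : TwoForm I M) : Prop :=
  ∀ x₀ : M, ContDiffOn ℝ ∞ (Ω.inChart I x₀) (extChartAt I x₀).target

/-- The exterior derivative `dΩ`, computed in charts, with the normalization
`(dΩ)(u, v, w) = u·Ω(v, w) - v·Ω(u, w) + w·Ω(u, v)` in coordinates. -/
def TwoForm.extDeriv (I : ModelWithCorners ℝ E H) (Ω : TwoForm I M) (x : M) :
    TangentSpace I x [⋀^Fin 3]→L[ℝ] ℝ :=
  (_root_.extDeriv (Ω.inChart I x) (extChartAt I x x)).compContinuousLinearMap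
    (mfderiv I 𝓘(ℝ, E) (extChartAt I x) x)

/-- The pull-back `g^* θ` of the left-invariant Maurer-Cartan form `θ = g⁻¹ dg` under `g : M → G`.
-/
def mcLeft (I : ModelWithCorners ℝ E H) (g : M → SU2) (x : M) : TangentSpace I x →L[ℝ] Mat :=
  (ContinuousLinearMap.mul ℝ Mat (((g x)⁻¹ : SU2) : Mat)).comp
    (mfderiv I 𝓘(ℝ, Mat) (fun y => (g y : Mat)) x)

/-- The pull-back `g^* θ̄` of the right-invariant Maurer-Cartan form `θ̄ = dg g⁻¹` under
`g : M → G`. -/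
def mcRight (I : ModelWithCorners ℝ E H) (g : M → SU2) (x : M) : TangentSpace I x →L[ℝ] Mat :=
  ((ContinuousLinearMap.mul ℝ Mat).flip (((g x)⁻¹ : SU2) : Mat)).comp
    (mfderiv I 𝓘(ℝ, Mat) (fun y => (g y : Mat)) x)

/-- The one-form `Ad_b α`, where `b : M → G` and `α` is a matrix valued one-form. -/
def adForm (I : ModelWithCorners ℝ E H) (b : M → SU2) (x : M) (α : TangentSpace I x →L[ℝ] Mat) :
    TangentSpace I x →L[ℝ] Mat :=
  ((ContinuousLinearMap.mul ℝ Mat (b x : Mat)).comp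
    ((ContinuousLinearMap.mul ℝ Mat).flip (((b x)⁻¹ : SU2) : Mat))).comp α

/-- The pull-back under `μ : M → Gⁿ` of the canonical three-form
`χ = (1/12) ⟨θ, [θ, θ]⟩` on `Gⁿ`, where `[θ, θ](v, w) = 2 [θ(v), θ(w)]`. -/
def cartanForm (c : ℝ) (I : ModelWithCorners ℝ E H) {n : ℕ} (μ : M → Gpow n) (x : M)
    (u v w : TangentSpace I x) : ℝ :=
  ∑ i, (1 / 12 : ℝ) *
    (let θ : TangentSpace I x → Mat := mcLeft I (fun y => μ y i) x
     pairing c (θ u) ((2 : ℝ) • ⁅θ v, θ w⁆) + pairing c (θ v) ((2 : ℝ) • ⁅θ w, θ u⁆) +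
      pairing c (θ w) ((2 : ℝ) • ⁅θ u, θ v⁆))

/-! ### Quasi-Hamiltonian spaces -/

/-- The element of `𝔰𝔲(2)ⁿ` given by an element of the Lie algebra `T_1 Gⁿ` of `Gⁿ`. -/
def lieMat {n : ℕ} (ξ : TangentSpace (Ipow n) (1 : Gpow n)) (i : Fin n) : Mat :=
  mfderiv (Ipow n) 𝓘(ℝ, Mat) (fun σ : Gpow n => (σ i : Mat)) 1 ξ

/-- The vector field `v_ξ` on `M` of the infinitesimal action of `ξ ∈ Lie Gⁿ`: its value at `x` is
the derivative of the orbit map `σ ↦ σ • x` at `1` in direction `ξ`. -/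
def infAction (I : ModelWithCorners ℝ E H) {n : ℕ} [MulAction (Gpow n) M]
    (ξ : TangentSpace (Ipow n) (1 : Gpow n)) (x : M) : TangentSpace I x :=
  (mfderiv (Ipow n) I (fun σ : Gpow n => σ • x) 1 ξ : TangentSpace I ((1 : Gpow n) • x))

/-- `(M, Ω, μ)` is a quasi-Hamiltonian `Gⁿ`-space, where `Lie Gⁿ = 𝔰𝔲(2)ⁿ` carries the sum of
the forms `pairing c` on the factors. -/
structure IsQuasiHamiltonian (c : ℝ) (I : ModelWithCorners ℝ E H) (n : ℕ) [MulAction (Gpow n) M]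
    (Ω : TwoForm I M) (μ : M → Gpow n) : Prop where
  isManifold : IsManifold I ∞ M
  smooth_action : ContMDiff ((Ipow n).prod I) I ∞ fun p : Gpow n × M => p.1 • p.2
  smooth_form : Ω.IsSmooth I
  invariant_form : ∀ σ : Gpow n, Ω.pullback I I (fun x : M => σ • x) = Ω
  smooth_moment : ContMDiff I (Ipow n) ∞ μ
  equivariant_moment : ∀ (σ : Gpow n) (x : M), μ (σ • x) = σ * μ x * σ⁻¹
  /-- `dΩ = - μ^* χ` -/
  deriv_form : ∀ (x : M) (u v w : TangentSpace I x),
    Ω.extDeriv I x ![u, v, w] = -cartanForm c I μ x u v w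
  /-- `ι(v_ξ) Ω = (1/2) ⟨μ^*(θ + θ̄), ξ⟩` -/
  moment_condition : ∀ (ξ : TangentSpace (Ipow n) (1 : Gpow n)) (x : M) (w : TangentSpace I x),
    Ω x ![infAction I ξ x, w] = (1 / 2 : ℝ) * ∑ i, pairing c
      (mcLeft I (fun y => μ y i) x w + mcRight I (fun y => μ y i) x w) (lieMat ξ i)
  /-- `ker Ω_x = {v_ξ(x) | ξ ∈ ker (Ad_{μ(x)} + 1)}` -/
  kernel_form : ∀ (x : M) (v : TangentSpace I x), (∀ w : TangentSpace I x, Ω x ![v, w] = 0) ↔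
    ∃ ξ : TangentSpace (Ipow n) (1 : Gpow n),
      (∀ i, (μ x i : Mat) * lieMat ξ i * (((μ x i)⁻¹ : SU2) : Mat) + lieMat ξ i = 0) ∧
      v = infAction I ξ x

/-- A diffeomorphism `Φ : M → M'` is an isomorphism of quasi-Hamiltonian `Gⁿ`-spaces from
`(M, Ω, μ)` to `(M', Ω', μ')` if it is equivariant and respects the two-forms and moment maps. -/
structure IsQuasiHamiltonianIso (I : ModelWithCorners ℝ E H) (I' : ModelWithCorners ℝ E' H')
    (n : ℕ) [MulAction (Gpow n) M] [MulAction (Gpow n) M']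
    (Ω : TwoForm I M) (μ : M → Gpow n) (Ω' : TwoForm I' M') (μ' : M' → Gpow n)
    (Φ : M ≃ₘ⟮I, I'⟯ M') : Prop where
  equivariant : ∀ (σ : Gpow n) (x : M), Φ (σ • x) = σ • Φ x
  form : Ω'.pullback I I' Φ = Ω
  moment : ∀ x : M, μ' (Φ x) = μ x

/-- `f : M → M'` is a smooth embedding (so `M` is an embedded submanifold of `M'` via `f`). -/
structure IsSmoothEmb (I : ModelWithCorners ℝ E H) (I' : ModelWithCorners ℝ E' H')
    (f : M → M') : Prop where
  smooth : ContMDiff I I' ∞ f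
  injective_mfderiv : ∀ x, Function.Injective (mfderiv I I' f x)
  isEmbedding : Topology.IsEmbedding f

/-- `f : M → M'` is a surjective submersion. -/
structure IsSurjSubmersion (I : ModelWithCorners ℝ E H) (I' : ModelWithCorners ℝ E' H')
    (f : M → M') : Prop where
  smooth : ContMDiff I I' ∞ f
  surjective : Function.Surjective f
  surjective_mfderiv : ∀ x, Function.Surjective (mfderiv I I' f x)

end Forms

/-! ### The extended moduli space

Throughout, the surface is a sphere with `r + 1` boundary circles. The loops `B_1, …, B_{r+1}`
are indexed by `Fin (r + 1)` (shifted by one), and the paths `A_2, …, A_{r+1}` by `Fin r`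
(shifted by two), so that `a i` goes with `b i.succ`. -/

/-- The `G`-extended moduli space of a sphere with `r + 1` boundary circles: tuples `(a, b)` with
`b_1 (a_2 b_2 a_2⁻¹) ⋯ (a_{r+1} b_{r+1} a_{r+1}⁻¹) = 1`. -/
def ExtModuli (r : ℕ) : Type :=
  {p : (Fin r → SU2) × (Fin (r + 1) → SU2) //
    p.2 0 * (List.ofFn fun i : Fin r => p.1 i * p.2 i.succ * (p.1 i)⁻¹).prod = 1}

namespace ExtModuli

variable {r : ℕ}

instance : TopologicalSpace (ExtModuli r) := instTopologicalSpaceSubtype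

/-- The holonomies `a_2, …, a_{r+1}`. -/
def a (p : ExtModuli r) : Fin r → SU2 := p.1.1

/-- The holonomies `b_1, …, b_{r+1}`. -/
def b (p : ExtModuli r) : Fin (r + 1) → SU2 := p.1.2

theorem rel (p : ExtModuli r) :
    p.b 0 * (List.ofFn fun i : Fin r => p.a i * p.b i.succ * (p.a i)⁻¹).prod = 1 := p.2

theorem continuous_prod {X : Type*} [TopologicalSpace X] {f : Fin r → X → SU2}
    (hf : ∀ i, Continuous (f i)) : Continuous fun x => (List.ofFn fun i => f i x).prod := by
  have h : (fun x => (List.ofFn fun i => f i x).prod) =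
      fun x => ((List.finRange r).map fun i => f i x).prod := by
    ext1 x
    rw [List.ofFn_eq_map]
  rw [h]
  exact continuous_list_prod _ fun i _ => hf i

/-- The identification of the extended moduli space with `G^{2r}` that forgets `b_1`. -/
def coords (r : ℕ) : ExtModuli r ≃ₜ (Gpow r × Gpow r) where
  toFun p := (p.a, fun i => p.b i.succ)
  invFun q := ⟨(q.1, Fin.cons (List.ofFn fun i : Fin r => q.1 i * q.2 i * (q.1 i)⁻¹).prod⁻¹ q.2),
    by simp⟩
  left_inv p := by
    apply Subtype.ext
    refine Prod.ext rfl ?_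
    funext j
    refine Fin.cases ?_ (fun i => ?_) j
    · exact (eq_inv_of_mul_eq_one_left p.rel).symm
    · rfl
  right_inv q := by
    refine Prod.ext rfl ?_
    funext i
    simp [b]
  continuous_toFun := by
    have h : Continuous fun p : ExtModuli r => p.1 := continuous_subtype_val
    refine (continuous_fst.comp h).prodMk (continuous_pi fun i => ?_)
    exact (continuous_apply _).comp (continuous_snd.comp h)
  continuous_invFun := by
    refine Continuous.subtype_mk (continuous_fst.prodMk (continuous_pi fun j => ?_)) _
    refine Fin.cases ?_ (fun i => ?_) j
    · simp only [Fin.cons_zero]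
      refine (continuous_prod fun i => ?_).inv
      fun_prop
    · simp only [Fin.cons_succ]
      fun_prop

/-- The model space `ℝ^{6r}` of the extended moduli space. -/
abbrev Model (r : ℕ) : Type :=
  ModelProd (ModelPi fun _ : Fin r => EuclideanSpace ℝ (Fin 3))
    (ModelPi fun _ : Fin r => EuclideanSpace ℝ (Fin 3))

/-- The model with corners of the extended moduli space. -/
abbrev model (r : ℕ) : ModelWithCorners ℝ
    ((Fin r → EuclideanSpace ℝ (Fin 3)) × (Fin r → EuclideanSpace ℝ (Fin 3))) (Model r) :=
  (Ipow r).prod (Ipow r)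

/-- The manifold structure of the extended moduli space, from the identification with `G^{2r}`. -/
instance : ChartedSpace (Model r) (ExtModuli r) := transportCharts (coords r)

/-- The action of `G^{r+1}`:
`σ · (a, b) = ((σ_1 a_i σ_i⁻¹)_{i ≥ 2}, (σ_j b_j σ_j⁻¹)_{j ≥ 1})`. -/
instance : MulAction (Gpow (r + 1)) (ExtModuli r) where
  smul σ p := ⟨(fun i => σ 0 * p.a i * (σ i.succ)⁻¹, fun j => σ j * p.b j * (σ j)⁻¹), by
    have h : (List.ofFn fun i : Fin r => (σ 0 * p.a i * (σ i.succ)⁻¹) *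
        (σ i.succ * p.b i.succ * (σ i.succ)⁻¹) * (σ 0 * p.a i * (σ i.succ)⁻¹)⁻¹).prod =
        σ 0 * (List.ofFn fun i : Fin r => p.a i * p.b i.succ * (p.a i)⁻¹).prod * (σ 0)⁻¹ := by
      rw [← MulAut.conj_apply, map_list_prod, List.map_ofFn]
      congr 2
      funext i
      simp [mul_assoc]
    rw [h]
    have := p.rel
    calc _ = σ 0 * (p.b 0 * (List.ofFn fun i : Fin r => p.a i * p.b i.succ * (p.a i)⁻¹).prod) *
          (σ 0)⁻¹ := by group
      _ = 1 := by rw [this]; simp⟩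
  one_smul p := by
    apply Subtype.ext
    refine Prod.ext (funext fun i => ?_) (funext fun j => ?_)
    · show 1 * p.a i * (1)⁻¹ = p.a i
      simp
    · show 1 * p.b j * (1)⁻¹ = p.b j
      simp
  mul_smul σ τ p := by
    apply Subtype.ext
    refine Prod.ext (funext fun i => ?_) (funext fun j => ?_)
    · show σ 0 * τ 0 * p.a i * (σ i.succ * τ i.succ)⁻¹ =
        σ 0 * (τ 0 * p.a i * (τ i.succ)⁻¹) * (σ i.succ)⁻¹
      group
    · show σ j * τ j * p.b j * (σ j * τ j)⁻¹ = σ j * (τ j * p.b j * (τ j)⁻¹) * (σ j)⁻¹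
      group

@[simp] theorem smul_a (σ : Gpow (r + 1)) (p : ExtModuli r) (i : Fin r) :
    (σ • p).a i = σ 0 * p.a i * (σ i.succ)⁻¹ := rfl

@[simp] theorem smul_b (σ : Gpow (r + 1)) (p : ExtModuli r) (j : Fin (r + 1)) :
    (σ • p).b j = σ j * p.b j * (σ j)⁻¹ := rfl

@[ext] theorem ext {p q : ExtModuli r} (ha : ∀ i, p.a i = q.a i) (hb : ∀ j, p.b j = q.b j) :
    p = q :=
  Subtype.ext (Prod.ext (funext ha) (funext hb))

/-- The moment map `(a, b) ↦ (b_1⁻¹, …, b_{r+1}⁻¹)`. -/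
def moment (p : ExtModuli r) : Gpow (r + 1) := fun j => (p.b j)⁻¹

/-- The first component `Ad_{a_i} b_i` of the moment map of the `i`-th double. -/
def doubleMoment (i : Fin r) (p : ExtModuli r) : SU2 := p.a i * p.b i.succ * (p.a i)⁻¹

/-- The product of the `doubleMoment j` over all `j < i`, in increasing order. -/
def momentLT (i : Fin r) (p : ExtModuli r) : SU2 :=
  ((List.ofFn fun j : Fin r => doubleMoment j p).take i).prod

/-- The two-form of the `i`-th double,
`(1/2) ⟨Ad_b a^*θ, a^*θ⟩ + (1/2) ⟨a^*θ, b^*(θ + θ̄)⟩` with `a = a_i`, `b = b_i`. -/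
def doubleForm (c : ℝ) (i : Fin r) : TwoForm (model r) (ExtModuli r) := fun p =>
  let A := mcLeft (model r) (fun q : ExtModuli r => q.a i) p
  let B : ExtModuli r → SU2 := fun q => q.b i.succ
  (1 / 2 : ℝ) • wedge c (adForm (model r) B p A) A +
    (1 / 2 : ℝ) • wedge c A (mcLeft (model r) B p + mcRight (model r) B p)

/-- The two-form of the extended moduli space, i.e. of the fusion product of the doubles:
`∑_i Ω_{D_i} + (1/2) ∑_i ⟨(μ_2 ⋯ μ_{i-1})^*θ, μ_i^*θ̄⟩`, where `μ_i = Ad_{a_i} b_i`. -/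
def form (c : ℝ) (r : ℕ) : TwoForm (model r) (ExtModuli r) := fun p =>
  ∑ i : Fin r, (doubleForm c i p + (1 / 2 : ℝ) •
    wedge c (mcLeft (model r) (momentLT i) p) (mcRight (model r) (doubleMoment i) p))

end ExtModuli

/-! ### Cutting along a simple closed curve

The closed curve `C` cuts the sphere `Σ` with `n = m + k + 1` boundary circles into `Σ⁺`, with the
boundary circles `B_1, …, B_{m+1}, C` of `Σ⁺`, and `Σ⁻`, with the boundary circles
`C, B_{m+2}, …, B_n`. -/

open ExtModuli

/-- The fusion product of the extended moduli spaces of `Σ⁺` and `Σ⁻`, as a manifold. -/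
abbrev CutModuli (m k : ℕ) : Type := ExtModuli (m + 1) × ExtModuli k

/-- The model with corners of `CutModuli`. -/
abbrev cutModel (m k : ℕ) := (model (m + 1)).prod (model k)

/-- The moment map `ν_C = μ_{B⁺_{m+2}} · μ_{B⁻_1}` of the action of `G_C`. -/
def nu {m k : ℕ} (p : CutModuli m k) : SU2 :=
  moment p.1 (Fin.last (m + 1)) * moment p.2 0

/-- The two-form of the fusion product,
`Ω⁺ + Ω⁻ + (1/2) ⟨(μ_{B⁺_{m+2}})^*θ, (μ_{B⁻_1})^*θ̄⟩`. -/
def cutForm (c : ℝ) (m k : ℕ) : TwoForm (cutModel m k) (CutModuli m k) := fun p =>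
  (form c (m + 1)).pullback (cutModel m k) (model (m + 1)) Prod.fst p +
    (form c k).pullback (cutModel m k) (model k) Prod.snd p +
    (1 / 2 : ℝ) • wedge c
      (mcLeft (cutModel m k) (fun q : CutModuli m k => moment q.1 (Fin.last (m + 1))) p)
      (mcRight (cutModel m k) (fun q : CutModuli m k => moment q.2 0) p)

/-- The level set `ν_C⁻¹(1)`. -/
def Level (m k : ℕ) : Type := {p : CutModuli m k // nu p = 1}

namespace Level

variable {m k : ℕ}

instance : TopologicalSpace (Level m k) := instTopologicalSpaceSubtype

/-- The inclusion `ι` of `ν_C⁻¹(1)`. -/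
def incl (z : Level m k) : CutModuli m k := z.1

/-- The element of `G^{m+2}` with `σ` in the last place (the one of `C`) and `1` elsewhere. -/
def curvePlus (m : ℕ) (σ : SU2) : Gpow (m + 1 + 1) := Pi.mulSingle (Fin.last (m + 1)) σ

/-- The element of `G^{k+1}` with `σ` in the first place (the one of `C`) and `1` elsewhere. -/
def curveMinus (k : ℕ) (σ : SU2) : Gpow (k + 1) := Pi.mulSingle 0 σ

theorem nu_eq_one_iff (p : CutModuli m k) : nu p = 1 ↔ p.2.b 0 * p.1.b (Fin.last (m + 1)) = 1 := by
  rw [nu, moment, moment, ← mul_inv_rev, inv_eq_one]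

theorem b_mul_b (z : Level m k) : z.1.2.b 0 * z.1.1.b (Fin.last (m + 1)) = 1 :=
  (nu_eq_one_iff _).1 z.2

/-- The action on `ν_C⁻¹(1)` of the diagonal `G_C ⊂ G⁺_{m+2} × G⁻_1`. -/
instance : MulAction SU2 (Level m k) where
  smul σ z := ⟨(curvePlus m σ • z.1.1, curveMinus k σ • z.1.2), by
    rw [nu_eq_one_iff]
    simp only [smul_b, curvePlus, curveMinus, Pi.mulSingle_eq_same]
    calc _ = σ * (z.1.2.b 0 * z.1.1.b (Fin.last (m + 1))) * σ⁻¹ := by group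
      _ = 1 := by rw [b_mul_b]; simp⟩
  one_smul z := by
    apply Subtype.ext
    show (curvePlus m 1 • z.1.1, curveMinus k 1 • z.1.2) = z.1
    simp [curvePlus, curveMinus]
  mul_smul σ τ z := by
    apply Subtype.ext
    show (curvePlus m (σ * τ) • z.1.1, curveMinus k (σ * τ) • z.1.2) =
      (curvePlus m σ • curvePlus m τ • z.1.1, curveMinus k σ • curveMinus k τ • z.1.2)
    simp only [curvePlus, curveMinus, Pi.mulSingle_mul, mul_smul]

/-- The components `(σ_1, …, σ_{m+1}, 1)` of `σ ∈ Gⁿ` acting on the part of `Σ⁺`. -/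
def outerPlus (m k : ℕ) (σ : Gpow (m + k + 1)) : Gpow (m + 1 + 1) :=
  Fin.cons (σ 0) (Fin.snoc (α := fun _ => SU2) (fun i : Fin m => σ (Fin.castAdd k i).succ) 1)

/-- The components `(1, σ_{m+2}, …, σ_n)` of `σ ∈ Gⁿ` acting on the part of `Σ⁻`. -/
def outerMinus (m k : ℕ) (σ : Gpow (m + k + 1)) : Gpow (k + 1) :=
  Fin.cons 1 fun j : Fin k => σ (Fin.natAdd m j).succ

/-- The action of `Gⁿ` on `ν_C⁻¹(1)`, one factor for each boundary circle of `Σ`. -/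
instance : MulAction (Gpow (m + k + 1)) (Level m k) where
  smul σ z := ⟨(outerPlus m k σ • z.1.1, outerMinus m k σ • z.1.2), by
    rw [nu_eq_one_iff]
    simp only [smul_b, outerPlus, outerMinus, Fin.cons_zero, ← Fin.succ_last, Fin.cons_succ,
      Fin.snoc_last]
    have := z.b_mul_b
    rw [← Fin.succ_last] at this
    simpa using this⟩
  one_smul z := by
    apply Subtype.ext
    have h1 : outerPlus m k 1 = 1 := by
      funext j
      refine Fin.cases rfl (fun i => ?_) j
      refine Fin.lastCases ?_ (fun i => ?_) i <;> simp [outerPlus]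
    have h2 : outerMinus m k 1 = 1 := by
      funext j
      refine Fin.cases rfl (fun i => ?_) j
      simp [outerMinus]
    show (outerPlus m k 1 • z.1.1, outerMinus m k 1 • z.1.2) = z.1
    rw [h1, h2]
    simp
  mul_smul σ τ z := by
    apply Subtype.ext
    have h1 : outerPlus m k (σ * τ) = outerPlus m k σ * outerPlus m k τ := by
      funext j
      refine Fin.cases rfl (fun i => ?_) j
      refine Fin.lastCases ?_ (fun i => ?_) i <;> simp [outerPlus]
    have h2 : outerMinus m k (σ * τ) = outerMinus m k σ * outerMinus m k τ := by
      funext j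
      refine Fin.cases ?_ (fun i => ?_) j <;> simp [outerMinus]
    show (outerPlus m k (σ * τ) • z.1.1, outerMinus m k (σ * τ) • z.1.2) =
      (outerPlus m k σ • outerPlus m k τ • z.1.1, outerMinus m k σ • outerMinus m k τ • z.1.2)
    rw [h1, h2, mul_smul, mul_smul]

instance : SMulCommClass (Gpow (m + k + 1)) SU2 (Level m k) where
  smul_comm σ τ z := by
    apply Subtype.ext
    have h1 : outerPlus m k σ * curvePlus m τ = curvePlus m τ * outerPlus m k σ := by
      funext j
      refine Fin.lastCases ?_ (fun i => ?_) j
      · simp [outerPlus, curvePlus, ← Fin.succ_last]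
      · simp [curvePlus]
    have h2 : outerMinus m k σ * curveMinus k τ = curveMinus k τ * outerMinus m k σ := by
      funext j
      refine Fin.cases ?_ (fun i => ?_) j <;> simp [outerMinus, curveMinus]
    show (outerPlus m k σ • curvePlus m τ • z.1.1, outerMinus m k σ • curveMinus k τ • z.1.2) =
      (curvePlus m τ • outerPlus m k σ • z.1.1, curveMinus k τ • outerMinus m k σ • z.1.2)
    rw [← mul_smul, ← mul_smul, h1, h2, mul_smul, mul_smul]

/-- The components of the moment map on `ν_C⁻¹(1)` for the boundary circles of `Σ`:
`(μ_{B⁺_1}, …, μ_{B⁺_{m+1}}, μ_{B⁻_2}, …, μ_{B⁻_{k+1}})`. -/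
def outerMoment (z : Level m k) : Gpow (m + k + 1) :=
  Fin.cons (moment z.1.1 0) (Fin.append (fun i : Fin m => moment z.1.1 i.castSucc.succ)
    (fun j : Fin k => moment z.1.2 j.succ))

theorem outerMoment_smul (σ : SU2) (z : Level m k) : (σ • z).outerMoment = z.outerMoment := by
  have h1 : ∀ i : Fin (m + 1), moment (σ • z).1.1 i.castSucc = moment z.1.1 i.castSucc := by
    intro i
    show ((curvePlus m σ • z.1.1).b i.castSucc)⁻¹ = (z.1.1.b i.castSucc)⁻¹
    simp [curvePlus]
  have h2 : ∀ j : Fin k, moment (σ • z).1.2 j.succ = moment z.1.2 j.succ := by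
    intro j
    show ((curveMinus k σ • z.1.2).b j.succ)⁻¹ = (z.1.2.b j.succ)⁻¹
    simp [curveMinus]
  have h3 := h1 0
  rw [Fin.castSucc_zero] at h3
  simp only [outerMoment, h2, h3, Fin.succ_castSucc, h1]

/-- The `a`-part of the glued holonomies. -/
def glueA (z : Level m k) : Fin (m + k) → SU2 :=
  Fin.append (fun i : Fin m => z.1.1.a i.castSucc)
    (fun j : Fin k => z.1.1.a (Fin.last m) * z.1.2.a j)

/-- The `b`-part of the glued holonomies. -/
def glueB (z : Level m k) : Fin (m + k + 1) → SU2 :=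
  Fin.cons (z.1.1.b 0) (Fin.append (fun i : Fin m => z.1.1.b i.castSucc.succ)
    (fun j : Fin k => z.1.2.b j.succ))

theorem glue_rel (z : Level m k) : z.glueB 0 *
    (List.ofFn fun i : Fin (m + k) => z.glueA i * z.glueB i.succ * (z.glueA i)⁻¹).prod = 1 := by
  have hp := z.1.1.rel
  have hb := z.b_mul_b
  rw [List.ofFn_succ', List.concat_eq_append, List.prod_append, List.prod_singleton,
    Fin.succ_last] at hp
  have hm : (List.ofFn fun j : Fin k => z.1.2.a j * z.1.2.b j.succ * (z.1.2.a j)⁻¹).prod =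
      (z.1.2.b 0)⁻¹ := eq_inv_of_mul_eq_one_right z.1.2.rel
  have hk : (List.ofFn fun j : Fin k => (z.1.1.a (Fin.last m) * z.1.2.a j) * z.1.2.b j.succ *
      (z.1.1.a (Fin.last m) * z.1.2.a j)⁻¹).prod =
      z.1.1.a (Fin.last m) * (z.1.2.b 0)⁻¹ * (z.1.1.a (Fin.last m))⁻¹ := by
    rw [← hm, ← MulAut.conj_apply, map_list_prod, List.map_ofFn]
    congr 2
    funext j
    simp [mul_assoc]
  have hf : (fun i : Fin (m + k) => z.glueA i * z.glueB i.succ * (z.glueA i)⁻¹) =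
      Fin.append (fun i : Fin m => z.1.1.a i.castSucc * z.1.1.b i.castSucc.succ *
        (z.1.1.a i.castSucc)⁻¹)
        (fun j : Fin k => (z.1.1.a (Fin.last m) * z.1.2.a j) * z.1.2.b j.succ *
          (z.1.1.a (Fin.last m) * z.1.2.a j)⁻¹) := by
    funext i
    refine Fin.addCases (fun i => ?_) (fun j => ?_) i
    · simp only [glueA, glueB, Fin.cons_succ, Fin.append_left]
    · simp only [glueA, glueB, Fin.cons_succ, Fin.append_right]
  rw [eq_inv_of_mul_eq_one_right hb] at hp
  rw [hf, List.ofFn_fin_append, List.prod_append, hk]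
  exact hp

/-- The gluing map `π_C`:
`((a⁺, b⁺), (a⁻, b⁻)) ↦ (a⁺_2, …, a⁺_{m+1}, a⁺_{m+2} a⁻_2, …, a⁺_{m+2} a⁻_{k+1};
b⁺_1, …, b⁺_{m+1}, b⁻_2, …, b⁻_{k+1})`. -/
def glue (z : Level m k) : ExtModuli (m + k) := ⟨(z.glueA, z.glueB), z.glue_rel⟩

end Level

/-- The quotient `ν_C⁻¹(1) / G_C`. -/
def Reduced (m k : ℕ) : Type := MulAction.orbitRel.Quotient SU2 (Level m k)

namespace Reduced

variable {m k : ℕ}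

instance : TopologicalSpace (Reduced m k) :=
  inferInstanceAs (TopologicalSpace (Quotient (MulAction.orbitRel SU2 (Level m k))))

/-- The projection `ν_C⁻¹(1) → ν_C⁻¹(1) / G_C`. -/
def mk (z : Level m k) : Reduced m k := Quotient.mk (MulAction.orbitRel SU2 (Level m k)) z

/-- The action of `Gⁿ` on `ν_C⁻¹(1) / G_C`, `σ · [z] = [σ · z]`. -/
instance : MulAction (Gpow (m + k + 1)) (Reduced m k) where
  smul σ := Quotient.map (fun z : Level m k => σ • z) (by
    rintro _ z ⟨τ, rfl⟩
    exact ⟨τ, (smul_comm σ τ z).symm⟩)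
  one_smul := by
    rintro ⟨z⟩
    exact congrArg mk (one_smul (Gpow (m + k + 1)) z)
  mul_smul σ τ := by
    rintro ⟨z⟩
    exact congrArg mk (mul_smul σ τ z)

/-- The moment map of `ν_C⁻¹(1) / G_C` as a `Gⁿ`-space. -/
def moment : Reduced m k → Gpow (m + k + 1) :=
  Quotient.lift Level.outerMoment (by
    rintro _ z ⟨τ, rfl⟩
    exact Level.outerMoment_smul τ z)

end Reduced

end Gluing

end

/-!
The proof rests on one algebraic device. The two-form of the extended moduli space is a sum of
cocycles `(1/2) ⟨g^*θ, h^*θ̄⟩`, one for every multiplication carried out in the word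
`∏ a_i b_i a_i⁻¹`. A `Jet` consists of an element of `SU(2)`, the value of a left Maurer-Cartan
form and a two-form; multiplying two jets multiplies the group elements, combines the one-forms as
for a product of maps, and adds the cocycle to the two-forms. Associativity is the cocycle identity,
so jets form a group, and `ExtModuli.form_eq` says that the two-form of the moduli space is the
two-form part of the word, evaluated in this group, on the jets of the holonomies `a_i`, `b_i`.
Since jets pull back (`pullback_form`), most of the claims become computations with words.

* Invariance: acting by `σ` multiplies the jets of the holonomies by jets of constants, which
  conjugates the word (`ExtModuli.form_invariant`).
* Moment map condition: `Jet.Acts` describes a jet contracted with an infinitesimal action on the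
  left and on the right. It is stable under products and inverses, so the contribution of a word is
  the sum of those of the `b_i` (`Jet.acts_prod_word`).
* `dω = -μ^*χ`: the Polyakov-Wiegmann identity `extDeriv_cocycleE` computes the exterior derivative
  of a cocycle; in the sum over the word the terms of the `a_i` cancel and those of the partial
  products telescope (`extDeriv_wordFormE`).
* Minimal degeneracy: contracting with the infinitesimal action shows that `Ad_μ` acts as `-1` on
  `μ^*θ(v)` for `v` in the kernel, so that subtracting an infinitesimal action leaves a vector of
  the kernel with `μ^*θ(v) = 0`. Such a vector vanishes: testing with rotations of the first `k`
  of the `a_i` shows that it does not move the partial products of the word, hence that it commutes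
  with the `b_i`, and testing with variations of `b_i` shows that it does not move `a_i`
  (`Jet.θ_eq_zero_of_word`).
* Gluing of two-forms: on the level set the word of `Σ⁻` represents the holonomy around the curve,
  so that in the group of jets it differs from the jet of this holonomy by a central element, which
  carries the two-form of `Σ⁻`. The word of `Σ` is the word of `Σ⁺` with this product in place of
  the jet of the holonomy (`Level.pullback_glue_form`). The fusion term vanishes on the level set,
  as it is `⟨-α, α⟩` there.

The level set is the product of the glued moduli space and a copy of `SU(2)`, by the gluing map and
the coordinate `a⁺_{m+2}` (`Level.homeo`), and `G_C` acts freely and transitively on the second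
factor, so that the gluing map identifies the quotient with the glued moduli space
(`Reduced.homeo`). The manifold structures are transported along these bijections. The level set is
then embedded, because its bijection with the product is the restriction of a smooth map of the
ambient manifold and the inverse is smooth as a map to it (`Level.isSmoothEmb_incl`).
-/

noncomputable section

namespace Gluing

/-! ### Transported manifold structures and products of manifolds -/

section Transport

variable {E : Type*} [NormedAddCommGroup E] [NormedSpace ℝ E] {H : Type*} [TopologicalSpace H]
  (I : ModelWithCorners ℝ E H) {n : ℕ∞ω} {M P : Type*} [TopologicalSpace M]
  [TopologicalSpace P] [ChartedSpace H P] (e : M ≃ₜ P)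

theorem isManifold_transportCharts [IsManifold I n P] :
    letI := transportCharts (H := H) e
    IsManifold I n M := by
  let := transportCharts (H := H) e
  refine { compatible := ?_ }
  rintro _ _ ⟨φ, hφ, rfl⟩ ⟨ψ, hψ, rfl⟩
  have h := (contDiffGroupoid n I).compatible hφ hψ
  convert h using 1
  refine OpenPartialHomeomorph.ext _ _ (fun x => ?_) (fun x => ?_) ?_
  · simp
  · simp
  · ext x
    simp

theorem extChartAt_target_transportCharts (x : M) :
    letI := transportCharts (H := H) e
    (extChartAt I x).target = (extChartAt I (e x)).target := by
  let := transportCharts (H := H) e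
  rw [extChartAt_target, extChartAt_target]
  have : (chartAt H x : OpenPartialHomeomorph M H) =
    e.toOpenPartialHomeomorph ≫ₕ chartAt H (e x) := rfl
  rw [this]
  simp

theorem contMDiff_transportCharts :
    letI := transportCharts (H := H) e
    ContMDiff I I n e := by
  let := transportCharts (H := H) e
  intro x
  rw [contMDiffAt_iff]
  refine ⟨e.continuous.continuousAt, ?_⟩
  refine contDiffWithinAt_id.congr_of_eventuallyEq_of_mem ?_ (Set.mem_range_self _)
  filter_upwards [extChartAt_target_mem_nhdsWithin (I := I) (e x)] with y hy
  show extChartAt I (e x) (e (e.symm ((extChartAt I (e x)).symm y))) = y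
  rw [e.apply_symm_apply, (extChartAt I (e x)).right_inv hy]

theorem contMDiff_symm_transportCharts :
    letI := transportCharts (H := H) e
    ContMDiff I I n e.symm := by
  let := transportCharts (H := H) e
  intro x
  rw [contMDiffAt_iff]
  refine ⟨e.symm.continuous.continuousAt, ?_⟩
  refine contDiffWithinAt_id.congr_of_eventuallyEq_of_mem ?_ (Set.mem_range_self _)
  filter_upwards [extChartAt_target_mem_nhdsWithin (I := I) x] with y hy
  show extChartAt I (e (e.symm x)) (e (e.symm ((extChartAt I x).symm y))) = y
  rw [e.apply_symm_apply, e.apply_symm_apply, (extChartAt I x).right_inv hy]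

/-- The homeomorphism along which a manifold structure is transported, as a diffeomorphism. -/
def transportDiffeo :
    letI := transportCharts (H := H) e
    M ≃ₘ⟮I, I⟯ P :=
  letI := transportCharts (H := H) e
  { toEquiv := e.toEquiv
    contMDiff_toFun := contMDiff_transportCharts I e
    contMDiff_invFun := contMDiff_symm_transportCharts I e }

end Transport

section Pi

variable {E : Type*} [NormedAddCommGroup E] [NormedSpace ℝ E] {H : Type*} [TopologicalSpace H]
  {I : ModelWithCorners ℝ E H} {M : Type*} [TopologicalSpace M] [ChartedSpace H M]
  {n : ℕ∞ω} {r : ℕ}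

instance : IsManifold (𝓡 3) ∞ SU2 :=
  haveI : IsManifold (𝓡 3) ∞ (Metric.sphere (0 : EuclideanSpace ℝ (Fin 4)) 1) :=
    IsManifold.of_le (n := ω) le_top
  isManifold_transportCharts (𝓡 3) toSphere

instance : IsManifold (Ipow r) ∞ (Gpow r) := by
  apply isManifold_of_contDiffOn
  rintro _ _ ⟨φ, hφ, rfl⟩ ⟨ψ, hψ, rfl⟩
  rw [contDiffOn_pi]
  intro i
  have h := (contDiffGroupoid ∞ (𝓡 3)).compatible (hφ i trivial) (hψ i trivial)
  rw [contDiffGroupoid, mem_groupoid_of_pregroupoid] at h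
  have h1 := h.1
  refine (h1.comp (t := _) (contDiff_apply ℝ _ i).contDiffOn ?_)
  rintro x ⟨hx, -⟩
  refine ⟨?_, by simp⟩
  have h2 : x ∈ (OpenPartialHomeomorph.pi φ).target := hx.1
  have h3 : (OpenPartialHomeomorph.pi φ).symm x ∈ (OpenPartialHomeomorph.pi ψ).source := hx.2
  refine ⟨h2 i trivial, h3 i trivial⟩

instance (r : ℕ) : IsManifold (ExtModuli.model r) ∞ (ExtModuli r) :=
  isManifold_transportCharts (ExtModuli.model r) (ExtModuli.coords r)

theorem contMDiff_Gpow {f : M → Gpow r} (h : ∀ i, ContMDiff I (𝓡 3) n fun x => f x i) :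
    ContMDiff I (Ipow r) n f := by
  intro x
  rw [contMDiffAt_iff]
  refine ⟨continuousAt_pi.2 fun i => (h i x).continuousAt, contDiffWithinAt_pi.2 fun i => ?_⟩
  exact (contMDiffAt_iff.1 (h i x)).2

theorem contMDiff_apply_Gpow (i : Fin r) : ContMDiff (Ipow r) (𝓡 3) n fun σ : Gpow r => σ i := by
  intro σ
  rw [contMDiffAt_iff]
  refine ⟨(continuous_apply i).continuousAt, ?_⟩
  refine ((contDiff_apply ℝ _ i).contDiffWithinAt).congr_of_eventuallyEq_of_mem ?_
    (Set.mem_range_self _)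
  filter_upwards [extChartAt_target_mem_nhdsWithin (I := Ipow r) σ] with y hy
  exact congrFun ((extChartAt (Ipow r) σ).right_inv hy) i

/-- The tangent vectors of `Gⁿ` are the families of tangent vectors of the factors, since the charts
of `Gⁿ` are products of charts. -/
theorem mfderiv_apply_Gpow (i : Fin r) (σ : Gpow r) (v : TangentSpace (Ipow r) σ) :
    mfderiv (Ipow r) (𝓡 3) (fun σ : Gpow r => σ i) σ v = v i := by
  have h : HasMFDerivAt (Ipow r) (𝓡 3) (fun σ : Gpow r => σ i) σ
     (ContinuousLinearMap.proj (R := ℝ) (φ := fun _ : Fin r => EuclideanSpace ℝ (Fin 3)) i) := by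
    refine ⟨(continuous_apply i).continuousAt, ?_⟩
    refine (ContinuousLinearMap.hasFDerivWithinAt _).congr_of_eventuallyEq ?_
      (congrFun ((extChartAt (Ipow r) σ).right_inv (mem_extChartAt_target σ)) i)
    filter_upwards [extChartAt_target_mem_nhdsWithin (I := Ipow r) σ] with y hy
    exact congrFun ((extChartAt (Ipow r) σ).right_inv hy) i
  rw [h.mfderiv]
  rfl

end Pi

/-! ### `SU(2)` as a submanifold of the matrices -/

section SU2

open ContinuousLinearMap

/-- The Lie algebra `𝔰𝔲(2)` of traceless skew-Hermitian matrices. -/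
def su2 : Submodule ℝ Mat where
  carrier := {X | star X = -X ∧ X.trace = 0}
  add_mem' := by
    rintro X Y ⟨h1, h2⟩ ⟨h3, h4⟩
    exact ⟨by rw [star_add, h1, h3, neg_add], by rw [Matrix.trace_add, h2, h4, add_zero]⟩
  zero_mem' := by simp
  smul_mem' := by
    rintro r X ⟨h1, h2⟩
    exact ⟨by simp [h1], by rw [Matrix.trace_smul, h2, smul_zero]⟩

/-- `row` as a continuous linear map. -/
def rowCLM : Mat →L[ℝ] EuclideanSpace ℝ (Fin 4) :=
  LinearMap.toContinuousLinearMap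
    { toFun := row
      map_add' := fun A B => by ext i; fin_cases i <;> simp [row]
      map_smul' := fun r A => by ext i; fin_cases i <;> simp [row] }

/-- `unrow` as a continuous linear map. -/
def unrowCLM : EuclideanSpace ℝ (Fin 4) →L[ℝ] Mat :=
  LinearMap.toContinuousLinearMap
    { toFun := unrow
      map_add' := fun x y => by
        ext i j; fin_cases i <;> fin_cases j <;> apply Complex.ext <;> simp [unrow] <;> ring
      map_smul' := fun r x => by
        ext i j; fin_cases i <;> fin_cases j <;> apply Complex.ext <;> simp [unrow] }

theorem coe_eq_unrow (g : SU2) : (g : Mat) = unrow (toSphere g : EuclideanSpace ℝ (Fin 4)) :=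
  (congrArg Subtype.val (toSphere.symm_apply_apply g)).symm

variable {E : Type*} [NormedAddCommGroup E] [NormedSpace ℝ E] {H : Type*} [TopologicalSpace H]
  {I : ModelWithCorners ℝ E H} {M : Type*} [TopologicalSpace M] [ChartedSpace H M] {n : ℕ∞ω}

instance : Fact (Module.finrank ℝ (EuclideanSpace ℝ (Fin 4)) = 3 + 1) := ⟨by simp⟩

theorem contMDiff_coe_SU2 : ContMDiff (𝓡 3) 𝓘(ℝ, Mat) n (fun g : SU2 => (g : Mat)) := by
  have h1 : ContMDiff (𝓡 3) (𝓡 3) n toSphere := contMDiff_transportCharts (𝓡 3) toSphere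
  have h2 := (contMDiff_coe_sphere (m := n) (n := 3) (E := EuclideanSpace ℝ (Fin 4))).comp h1
  have h3 := (unrowCLM.contMDiff (n := n)).comp h2
  convert h3 using 1
  funext g
  exact coe_eq_unrow g

/-- Smoothness of a map to `SU(2)` can be tested on matrices, as `SU(2)` is the unit sphere of the
quaternions. -/
theorem contMDiff_SU2_iff [IsManifold I n M] {f : M → SU2} :
    ContMDiff I (𝓡 3) n f ↔ ContMDiff I 𝓘(ℝ, Mat) n (fun x => (f x : Mat)) := by
  refine ⟨fun h => contMDiff_coe_SU2.comp h, fun h => ?_⟩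
  have h1 : ContMDiff I 𝓘(ℝ, EuclideanSpace ℝ (Fin 4)) n fun x => row (f x) :=
    (rowCLM.contMDiff (n := n)).comp h
  have h2 := h1.codRestrict_sphere (n := 3) (fun x => (toSphere (f x)).2)
  have h3 : ContMDiff (𝓡 3) (𝓡 3) n toSphere.symm := contMDiff_symm_transportCharts (𝓡 3) toSphere
  convert h3.comp h2 using 1
  funext x
  exact (toSphere.symm_apply_apply (f x)).symm

theorem contMDiff_mul_SU2 [IsManifold I n M] {f g : M → SU2} (hf : ContMDiff I (𝓡 3) n f)
    (hg : ContMDiff I (𝓡 3) n g) : ContMDiff I (𝓡 3) n fun x => f x * g x := by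
  rw [contMDiff_SU2_iff] at *
  have h : ContMDiff (𝓘(ℝ, Mat).prod 𝓘(ℝ, Mat)) 𝓘(ℝ, Mat) n fun p : Mat × Mat => p.1 * p.2 := by
    have h0 : ContDiff ℝ n fun p : Mat × Mat => p.1 * p.2 := contDiff_mul
    have h1 := h0.contMDiff
    rwa [modelWithCornersSelf_prod, ← chartedSpaceSelf_prod] at h1
  exact h.comp (hf.prodMk hg)

/-- The conjugate transpose as a continuous real-linear map. -/
def starCLM : Mat →L[ℝ] Mat :=
  LinearMap.toContinuousLinearMap
    { toFun := star
      map_add' := star_add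
      map_smul' := fun r A => by simp }

theorem contMDiff_inv_SU2 [IsManifold I n M] {f : M → SU2} (hf : ContMDiff I (𝓡 3) n f) :
    ContMDiff I (𝓡 3) n fun x => (f x)⁻¹ := by
  rw [contMDiff_SU2_iff] at *
  exact (starCLM.contMDiff (n := n)).comp hf

theorem contMDiff_prod_ofFn_SU2 [IsManifold I n M] {r : ℕ} {f : Fin r → M → SU2}
    (hf : ∀ i, ContMDiff I (𝓡 3) n (f i)) :
    ContMDiff I (𝓡 3) n fun x => (List.ofFn fun i => f i x).prod := by
  induction r with
  | zero => simpa using contMDiff_const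
  | succ r ih =>
    simp only [List.ofFn_succ, List.prod_cons]
    exact contMDiff_mul_SU2 (hf 0) (ih fun i => hf i.succ)

/-- `X ↦ g⁻¹ X` maps the tangent space of `SU(2)` at `g`, i.e. the orthogonal complement of `g` in
the quaternions, to the Lie algebra. -/
theorem inv_mul_unrow_mem_su2 (g : SU2) (w : EuclideanSpace ℝ (Fin 4))
    (h : inner ℝ (toSphere g : EuclideanSpace ℝ (Fin 4)) w = 0) :
    ((g⁻¹ : SU2) : Mat) * unrow w ∈ su2 := by
  rw [SU2.coe_inv, coe_eq_unrow]
  generalize (toSphere g : EuclideanSpace ℝ (Fin 4)) = q at h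
  simp only [PiLp.inner_apply, Fin.sum_univ_four, RCLike.inner_apply, conj_trivial] at h
  constructor
  · ext i j
    fin_cases i <;> fin_cases j <;> apply Complex.ext <;>
      simp [unrow, Matrix.mul_apply, Fin.sum_univ_two, Matrix.star_apply] <;> linarith
  · apply Complex.ext <;>
      simp [unrow, Matrix.trace, Matrix.mul_apply, Fin.sum_univ_two, Matrix.star_apply] <;> linarith

/-- `X ↦ g X` maps the Lie algebra to the orthogonal complement of `g` in the quaternions. -/
theorem mul_eq_unrow (g : SU2) {X : Mat} (hX : X ∈ su2) :
    ∃ w, (g : Mat) * X = unrow w ∧ inner ℝ (toSphere g : EuclideanSpace ℝ (Fin 4)) w = 0 := by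
  refine ⟨row (g * X), ?_⟩
  rw [coe_eq_unrow]
  generalize (toSphere g : EuclideanSpace ℝ (Fin 4)) = q
  obtain ⟨h1, h2⟩ := hX
  have e00 := congrFun (congrFun h1 0) 0
  have e01 := congrFun (congrFun h1 0) 1
  have e11 := congrFun (congrFun h1 1) 1
  simp only [Matrix.trace, Fin.sum_univ_two, Matrix.diag_apply, Complex.ext_iff] at h2
  simp [Matrix.star_apply, Complex.ext_iff] at e00 e01 e11 h2
  obtain ⟨e1, e2⟩ := e01
  obtain ⟨t1, t2⟩ := h2
  have f0 : (X 0 0).re = 0 := by linarith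
  have f1 : (X 1 1).re = 0 := by linarith
  have f2 : (X 1 0).re = -(X 0 1).re := by linarith
  have f3 : (X 1 0).im = (X 0 1).im := by linarith
  have f4 : (X 1 1).im = -(X 0 0).im := by linarith
  constructor
  · ext i j
    fin_cases i <;> fin_cases j <;> apply Complex.ext <;>
      simp [unrow, row, Matrix.mul_apply, Fin.sum_univ_two, f0, f1, f2, f3, f4] <;> ring
  · simp [unrow, row, Matrix.mul_apply, Fin.sum_univ_four, PiLp.inner_apply,
      Fin.sum_univ_two, f0, f1, f2, f3, f4]
    ring

/-- The differential of a map `f : M → SU(2)` as a matrix-valued one-form. -/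
def matDeriv (I : ModelWithCorners ℝ E H) (f : M → SU2) (x : M) : TangentSpace I x →L[ℝ] Mat :=
  mfderiv I 𝓘(ℝ, Mat) (fun y => (f y : Mat)) x

theorem mfderiv_coe_SU2 (g : SU2) (u : TangentSpace (𝓡 3) g) :
    matDeriv (𝓡 3) (fun g : SU2 => g) g u =
      unrow (mvfderiv (𝓡 3) (fun x : Metric.sphere (0 : EuclideanSpace ℝ (Fin 4)) 1 =>
        (x : EuclideanSpace ℝ (Fin 4))) (toSphere g) (mfderiv (𝓡 3) (𝓡 3) toSphere g u)) := by
  have h1 : MDifferentiableAt (𝓡 3) (𝓡 3) toSphere g :=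
    (contMDiff_transportCharts (n := ∞) (𝓡 3) toSphere).mdifferentiable (by simp) g
  have h2 : MDifferentiableAt (𝓡 3) 𝓘(ℝ, EuclideanSpace ℝ (Fin 4))
      (fun x : Metric.sphere (0 : EuclideanSpace ℝ (Fin 4)) 1 =>
        (x : EuclideanSpace ℝ (Fin 4))) (toSphere g) :=
    (contMDiff_coe_sphere (m := ∞) (n := 3)).mdifferentiable (by simp) _
  have h3 := (unrowCLM.hasMFDerivAt.comp _ h2.hasMFDerivAt).comp g h1.hasMFDerivAt
  have h4 : (fun g : SU2 => (g : Mat)) = (unrowCLM ∘ fun x : Metric.sphere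
      (0 : EuclideanSpace ℝ (Fin 4)) 1 => (x : EuclideanSpace ℝ (Fin 4))) ∘ toSphere :=
    funext coe_eq_unrow
  rw [matDeriv, h4, h3.mfderiv]
  rfl

theorem bijective_mfderiv_toSphere (g : SU2) :
    Function.Bijective (mfderiv (𝓡 3) (𝓡 3) toSphere g) :=
  ((transportDiffeo (𝓡 3) (H := EuclideanSpace ℝ (Fin 3)) toSphere).mfderivToContinuousLinearEquiv
    (n := ∞) (by simp) g).bijective

theorem row_unrow (w : EuclideanSpace ℝ (Fin 4)) : row (unrow w) = w := by
  ext i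
  fin_cases i <;> simp [unrow, row]

theorem injective_mfderiv_coe_SU2 (g : SU2) :
    Function.Injective (matDeriv (𝓡 3) (fun g : SU2 => g) g) := by
  intro u v h
  rw [mfderiv_coe_SU2, mfderiv_coe_SU2] at h
  exact (bijective_mfderiv_toSphere g).1 (injective_mvfderiv_subtypeVal_sphere _
    (Function.LeftInverse.injective row_unrow h))

theorem mcLeft_apply (f : M → SU2) (x : M) (v : TangentSpace I x) :
    mcLeft I f x v = (((f x)⁻¹ : SU2) : Mat) * matDeriv I f x v := rfl

theorem mcRight_apply (f : M → SU2) (x : M) (v : TangentSpace I x) :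
    mcRight I f x v = matDeriv I f x v * (((f x)⁻¹ : SU2) : Mat) := rfl

theorem matDeriv_comp {E' : Type*} [NormedAddCommGroup E'] [NormedSpace ℝ E'] {H' : Type*}
    [TopologicalSpace H'] {I' : ModelWithCorners ℝ E' H'} {M' : Type*} [TopologicalSpace M']
    [ChartedSpace H' M'] {g : M' → SU2} {f : M → M'} {x : M}
    (hg : MDifferentiableAt I' (𝓡 3) g (f x)) (hf : MDifferentiableAt I I' f x) :
    matDeriv I (fun y => g (f y)) x = (matDeriv I' g (f x)).comp (mfderiv I I' f x) := by
  have h1 : MDifferentiableAt (𝓡 3) 𝓘(ℝ, Mat) (fun g : SU2 => (g : Mat)) (g (f x)) :=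
    (contMDiff_coe_SU2 (n := ∞)).mdifferentiable (by simp) _
  exact ((h1.comp _ hg).hasMFDerivAt.comp x hf.hasMFDerivAt).mfderiv

theorem mcLeft_comp {E' : Type*} [NormedAddCommGroup E'] [NormedSpace ℝ E'] {H' : Type*}
    [TopologicalSpace H'] {I' : ModelWithCorners ℝ E' H'} {M' : Type*} [TopologicalSpace M']
    [ChartedSpace H' M'] {g : M' → SU2} {f : M → M'} {x : M}
    (hg : MDifferentiableAt I' (𝓡 3) g (f x)) (hf : MDifferentiableAt I I' f x) :
    mcLeft I (fun y => g (f y)) x = (mcLeft I' g (f x)).comp (mfderiv I I' f x) := by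
  ext1 v
  rw [ContinuousLinearMap.comp_apply, mcLeft_apply, mcLeft_apply, matDeriv_comp hg hf]
  rfl

/-- The left Maurer-Cartan form takes its values in the Lie algebra. -/
theorem mcLeft_mem_su2 {f : M → SU2} {x : M} (hf : MDifferentiableAt I (𝓡 3) f x)
    (v : TangentSpace I x) : mcLeft I f x v ∈ su2 := by
  have h2 : mcLeft I f x v = (((f x)⁻¹ : SU2) : Mat) *
      matDeriv (𝓡 3) (fun g : SU2 => g) (f x) (mfderiv I (𝓡 3) f x v) := by
    rw [mcLeft_apply, matDeriv_comp (g := fun g => g) mdifferentiableAt_id hf]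
    rfl
  rw [h2, mfderiv_coe_SU2]
  apply inv_mul_unrow_mem_su2
  rw [← Submodule.mem_orthogonal_singleton_iff_inner_right, ← range_mvfderiv_subtypeVal (n := 3)]
  exact LinearMap.mem_range_self _ _

/-- Every `X` in the Lie algebra is a value of `θ` at `g`. -/
theorem exists_mfderiv_coe_SU2 (g : SU2) {X : Mat} (hX : X ∈ su2) :
    ∃ u, matDeriv (𝓡 3) (fun g : SU2 => g) g u = (g : Mat) * X := by
  obtain ⟨w, hw, h⟩ := mul_eq_unrow g hX
  rw [← Submodule.mem_orthogonal_singleton_iff_inner_right,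
    ← range_mvfderiv_subtypeVal (n := 3)] at h
  obtain ⟨u', hu'⟩ := h
  obtain ⟨u, hu⟩ := (bijective_mfderiv_toSphere g).2 u'
  refine ⟨u, ?_⟩
  rw [mfderiv_coe_SU2, hw, hu]
  exact congrArg unrow hu'

end SU2

/-! ### The cocycle `⟨g^*θ, h^*θ̄⟩` and the group of jets -/

section Algebra

variable (c : ℝ)

theorem pairing_comm (X Y : Mat) : pairing c X Y = pairing c Y X := by
  simp only [pairing, Matrix.trace_mul_comm X Y]

theorem pairing_add_left (X Y Z : Mat) : pairing c (X + Y) Z = pairing c X Z + pairing c Y Z := by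
  simp only [pairing, add_mul, Matrix.trace_add, Complex.add_re, mul_add]

theorem pairing_add_right (X Y Z : Mat) : pairing c X (Y + Z) = pairing c X Y + pairing c X Z := by
  simp only [pairing, mul_add, Matrix.trace_add, Complex.add_re]

theorem pairing_neg_left (X Y : Mat) : pairing c (-X) Y = -pairing c X Y := by
  simp [pairing]

theorem pairing_neg_right (X Y : Mat) : pairing c X (-Y) = -pairing c X Y := by
  simp [pairing]

theorem pairing_sub_left (X Y Z : Mat) : pairing c (X - Y) Z = pairing c X Z - pairing c Y Z := by
  rw [sub_eq_add_neg, pairing_add_left, pairing_neg_left, sub_eq_add_neg]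

theorem pairing_sub_right (X Y Z : Mat) : pairing c X (Y - Z) = pairing c X Y - pairing c X Z := by
  rw [sub_eq_add_neg, pairing_add_right, pairing_neg_right, sub_eq_add_neg]

@[simp] theorem pairing_zero_left (X : Mat) : pairing c 0 X = 0 := by simp [pairing]

@[simp] theorem pairing_zero_right (X : Mat) : pairing c X 0 = 0 := by simp [pairing]

/-- The pairing is nondegenerate on the Lie algebra. -/
theorem eq_zero_of_pairing_eq_zero {c : ℝ} (hc : c ≠ 0) {X : Mat} (hX : X ∈ su2)
    (h : ∀ Y ∈ su2, pairing c Y X = 0) : X = 0 := by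
  have h1 := h X hX
  have h2 : (Matrix.trace (star X * X)).re = 0 := by
    have := (mul_eq_zero.1 h1).resolve_left hc
    rw [hX.1]
    simpa using this
  simp only [Matrix.trace, Fin.sum_univ_two, Matrix.diag_apply, Matrix.mul_apply,
    Matrix.star_apply, Complex.add_re, RCLike.star_def, ← Complex.normSq_eq_conj_mul_self,
    Complex.ofReal_re] at h2
  have n0 := Complex.normSq_nonneg (X 0 0)
  have n1 := Complex.normSq_nonneg (X 1 0)
  have n2 := Complex.normSq_nonneg (X 0 1)
  have n3 := Complex.normSq_nonneg (X 1 1)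
  ext i j
  fin_cases i <;> fin_cases j <;> refine Complex.normSq_eq_zero.1 (le_antisymm ?_ ?_) <;>
    simp only [Fin.mk_zero, Fin.mk_one, Fin.isValue] <;> linarith

/-- The adjoint action of `SU(2)`, on all matrices. -/
def Ad (g : SU2) : Mat →L[ℝ] Mat :=
  (ContinuousLinearMap.mul ℝ Mat (g : Mat)).comp
    ((ContinuousLinearMap.mul ℝ Mat).flip ((g⁻¹ : SU2) : Mat))

theorem Ad_apply (g : SU2) (X : Mat) : Ad g X = g * X * ((g⁻¹ : SU2) : Mat) :=
  (mul_assoc _ _ _).symm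

@[simp] theorem coe_mul_inv (g : SU2) : (g : Mat) * ((g⁻¹ : SU2) : Mat) = 1 := by
  rw [← Submonoid.coe_mul, mul_inv_cancel, Submonoid.coe_one]

@[simp] theorem coe_inv_mul (g : SU2) : ((g⁻¹ : SU2) : Mat) * (g : Mat) = 1 := by
  rw [← Submonoid.coe_mul, inv_mul_cancel, Submonoid.coe_one]

@[simp] theorem Ad_one (X : Mat) : Ad 1 X = X := by simp [Ad_apply]

@[simp] theorem Ad_mul (g h : SU2) (X : Mat) : Ad (g * h) X = Ad g (Ad h X) := by
  simp only [Ad_apply, mul_inv_rev, Submonoid.coe_mul, mul_assoc]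

@[simp] theorem Ad_inv_Ad (g : SU2) (X : Mat) : Ad g⁻¹ (Ad g X) = X := by
  rw [← Ad_mul, inv_mul_cancel, Ad_one]

@[simp] theorem Ad_Ad_inv (g : SU2) (X : Mat) : Ad g (Ad g⁻¹ X) = X := by
  rw [← Ad_mul, mul_inv_cancel, Ad_one]

theorem Ad_mem_su2 (g : SU2) {X : Mat} (hX : X ∈ su2) : Ad g X ∈ su2 := by
  obtain ⟨h1, h2⟩ := hX
  rw [Ad_apply]
  constructor
  · rw [SU2.coe_inv, star_mul, star_mul, star_star, h1]
    simp [mul_assoc]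
  · rw [mul_assoc, Matrix.trace_mul_comm, mul_assoc, coe_inv_mul, mul_one, h2]

/-- The pairing is `Ad`-invariant. -/
theorem pairing_Ad (g : SU2) (X Y : Mat) : pairing c (Ad g X) Y = pairing c X (Ad g⁻¹ Y) := by
  have h : Matrix.trace (Ad g X * Y) = Matrix.trace (X * Ad g⁻¹ Y) := by
    rw [Ad_apply, Ad_apply, inv_inv, mul_assoc, mul_assoc, Matrix.trace_mul_comm]
    simp only [mul_assoc]
  simp only [pairing, h]

theorem pairing_Ad_Ad (g : SU2) (X Y : Mat) : pairing c (Ad g X) (Ad g Y) = pairing c X Y := by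
  rw [pairing_Ad, Ad_inv_Ad]

end Algebra

section Jet

variable {V : Type*} [AddCommGroup V] [Module ℝ V] [TopologicalSpace V]

theorem wedge_apply (c : ℝ) (α β : V →L[ℝ] Mat) (v : Fin 2 → V) :
    wedge c α β v = pairing c (α (v 0)) (β (v 1)) - pairing c (α (v 1)) (β (v 0)) := rfl

/-- An element `g` of `SU(2)`, the value `θ` at a point of the left Maurer-Cartan form of an
`SU(2)`-valued map with value `g` at that point, and the value `s` of a two-form. The product of
jets is the one of the maps, with the two-forms added up and corrected by the cocycle
`(1/2) ⟨g^*θ, h^*θ̄⟩`. -/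
@[ext] structure Jet (c : ℝ) (V : Type*) [AddCommGroup V] [Module ℝ V] [TopologicalSpace V] where
  /-- the group element -/
  g : SU2
  /-- the left Maurer-Cartan form -/
  θ : V →L[ℝ] Mat
  /-- the two-form -/
  s : V [⋀^Fin 2]→L[ℝ] ℝ

namespace Jet

variable {c : ℝ}

/-- The right Maurer-Cartan form `θ̄ = Ad_g θ` of a jet. -/
def θbar (x : Jet c V) : V →L[ℝ] Mat := (Ad x.g).comp x.θ

instance : Mul (Jet c V) where
  mul x y := ⟨x.g * y.g, (Ad y.g⁻¹).comp x.θ + y.θ, x.s + y.s + (1 / 2 : ℝ) • wedge c x.θ y.θbar⟩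

instance : One (Jet c V) := ⟨⟨1, 0, 0⟩⟩

instance : Inv (Jet c V) := ⟨fun x => ⟨x.g⁻¹, -x.θbar, -x.s⟩⟩

@[simp] theorem mul_g (x y : Jet c V) : (x * y).g = x.g * y.g := rfl
@[simp] theorem mul_θ (x y : Jet c V) : (x * y).θ = (Ad y.g⁻¹).comp x.θ + y.θ := rfl
@[simp] theorem mul_s (x y : Jet c V) :
    (x * y).s = x.s + y.s + (1 / 2 : ℝ) • wedge c x.θ y.θbar := rfl
@[simp] theorem one_g : (1 : Jet c V).g = 1 := rfl
@[simp] theorem one_θ : (1 : Jet c V).θ = 0 := rfl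
@[simp] theorem one_s : (1 : Jet c V).s = 0 := rfl
@[simp] theorem inv_g (x : Jet c V) : x⁻¹.g = x.g⁻¹ := rfl
@[simp] theorem inv_θ (x : Jet c V) : x⁻¹.θ = -x.θbar := rfl
@[simp] theorem inv_s (x : Jet c V) : x⁻¹.s = -x.s := rfl
theorem θbar_apply (x : Jet c V) (v : V) : x.θbar v = Ad x.g (x.θ v) := rfl

instance : Group (Jet c V) := by
  refine Group.ofLeftAxioms (fun x y z => ?_) (fun x => ?_) (fun x => ?_)
  · ext v
    · simp only [mul_g, mul_assoc]
    · simp [add_assoc]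
    · simp [wedge_apply, θbar_apply, pairing_add_left, pairing_add_right, pairing_Ad]
      ring
  · ext v <;> simp [wedge_apply]
  · ext v
    · simp
    · simp [θbar_apply]
    · simp [wedge_apply, θbar_apply, pairing_neg_left]
      rw [pairing_comm]
      ring

@[simp] theorem inv_θbar (x : Jet c V) : x⁻¹.θbar = -x.θ := by
  ext1 v
  simp [θbar_apply]

theorem mul_θbar (x y : Jet c V) : (x * y).θbar = x.θbar + (Ad x.g).comp y.θbar := by
  ext1 v
  simp [θbar_apply]

/-- The two-form `s` alone, as a central element. -/
def central (c : ℝ) (s : V [⋀^Fin 2]→L[ℝ] ℝ) : Jet c V := ⟨1, 0, s⟩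

theorem central_mul (s : V [⋀^Fin 2]→L[ℝ] ℝ) (x : Jet c V) :
    central c s * x = ⟨x.g, x.θ, s + x.s⟩ := by
  ext v <;> simp [central, wedge_apply]

theorem mul_central (s : V [⋀^Fin 2]→L[ℝ] ℝ) (x : Jet c V) :
    x * central c s = ⟨x.g, x.θ, s + x.s⟩ := by
  ext v <;> simp [central, wedge_apply, θbar_apply, add_comm]

end Jet

end Jet

/-! ### Words in jets -/

section Jet

variable {V : Type*} [AddCommGroup V] [Module ℝ V] [TopologicalSpace V]

theorem twoForm_swap (τ : V [⋀^Fin 2]→L[ℝ] ℝ) (v w : V) : τ ![w, v] = -τ ![v, w] := by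
  have h := τ.toAlternatingMap.map_swap ![v, w] (i := 0) (j := 1) (by simp)
  have h1 : ![v, w] ∘ Equiv.swap (0 : Fin 2) 1 = ![w, v] := by
    ext i
    fin_cases i <;> simp
  rw [h1] at h
  exact h

namespace Jet

variable {c : ℝ}

/-- The two-form of a product of jets has the shape of the two-form of a fusion product: the sum
of the two-forms of the factors and of one cocycle for each multiplication by a further factor. -/
theorem prod_ofFn_s {r : ℕ} (f : Fin r → Jet c V) : (List.ofFn f).prod.s =
    ∑ i, ((f i).s + (1 / 2 : ℝ) • wedge c ((List.ofFn f).take i).prod.θ (f i).θbar) := by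
  induction r with
  | zero => simp
  | succ r ih =>
    rw [List.ofFn_succ', List.concat_eq_append, List.prod_append, List.prod_singleton, mul_s, ih,
      Fin.sum_univ_castSucc]
    have h : ∀ i : Fin r, ((List.ofFn fun i : Fin r => f i.castSucc) ++ [f (Fin.last r)]).take i =
        (List.ofFn fun i : Fin r => f i.castSucc).take i := fun i =>
      List.take_append_of_le_length (by simp)
    simp only [Fin.val_castSucc, h, Fin.val_last]
    rw [List.take_append_of_le_length (by simp), List.take_of_length_le (by simp)]
    abel

/-- In the direction `v`, the jet `x` moves like `g ↦ e^{tξ} g e^{-tη}`, and the contraction of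
its two-form with `v` is, up to the number `d`, the one which the moment map condition asks for. -/
structure Acts (x : Jet c V) (v w : V) (ξ η : Mat) (d : ℝ) : Prop where
  θ_eq : x.θ v = Ad x.g⁻¹ ξ - η
  s_eq : x.s ![v, w] = (1 / 2 : ℝ) * pairing c ξ (x.θbar w) + (1 / 2 : ℝ) * pairing c η (x.θ w) + d

/-- The condition on the two-form in `Jet.Acts` just defines the number `d`. -/
theorem acts_of_θ_eq {x : Jet c V} {v : V} {ξ η : Mat} (h : x.θ v = Ad x.g⁻¹ ξ - η) (w : V) :
    x.Acts v w ξ η (x.s ![v, w] -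
      ((1 / 2 : ℝ) * pairing c ξ (x.θbar w) + (1 / 2 : ℝ) * pairing c η (x.θ w))) :=
  ⟨h, by ring⟩

theorem Acts.mul {x y : Jet c V} {v w : V} {ξ η ζ : Mat} {d e : ℝ} (hx : x.Acts v w ξ η d)
    (hy : y.Acts v w η ζ e) : (x * y).Acts v w ξ ζ (d + e) := by
  constructor
  · simp [hx.θ_eq, hy.θ_eq]
  · simp [wedge_apply, hx.s_eq, hy.s_eq, mul_θbar, hx.θ_eq, hy.θ_eq, θbar_apply,
      pairing_add_right, pairing_sub_left, pairing_sub_right]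
    rw [pairing_Ad c x.g⁻¹, inv_inv, pairing_comm c ζ (Ad y.g⁻¹ _), pairing_Ad c y.g⁻¹, inv_inv,
      pairing_comm c (x.θ w) η]
    ring

theorem Acts.inv {x : Jet c V} {v w : V} {ξ η : Mat} {d : ℝ} (hx : x.Acts v w ξ η d) :
    x⁻¹.Acts v w η ξ (-d) := by
  constructor
  · simp [θbar_apply, hx.θ_eq]
  · simp [hx.s_eq, pairing_neg_right]
    ring

theorem Acts.prod_ofFn {r : ℕ} {f : Fin r → Jet c V} {v w : V} {ξ : Mat} {d : Fin r → ℝ}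
    (h : ∀ i, (f i).Acts v w ξ ξ (d i)) : (List.ofFn f).prod.Acts v w ξ ξ (∑ i, d i) := by
  induction r with
  | zero => constructor <;> simp [θbar_apply]
  | succ r ih =>
    rw [List.ofFn_succ, List.prod_cons, Fin.sum_univ_succ]
    exact (h 0).mul (ih fun i => h i.succ)

theorem Acts.list_prod {l : List (Jet c V)} {v w : V} {ξ : Mat}
    (h : ∀ x ∈ l, x.Acts v w ξ ξ 0) : l.prod.Acts v w ξ ξ 0 := by
  induction l with
  | nil => constructor <;> simp [θbar_apply]
  | cons x l ih =>
    rw [List.prod_cons, ← add_zero (0 : ℝ)]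
    exact (h x (by simp)).mul (ih fun y hy => h y (by simp [hy]))

theorem θ_list_prod_mem_su2 {l : List (Jet c V)} {v : V} (h : ∀ x ∈ l, x.θ v ∈ su2) :
    l.prod.θ v ∈ su2 := by
  induction l with
  | nil => simp
  | cons x l ih =>
    rw [List.prod_cons, mul_θ]
    exact su2.add_mem (Ad_mem_su2 _ (h x (by simp))) (ih fun y hy => h y (by simp [hy]))

/-- The list of the `a_i b_i a_i⁻¹`; its product is the word of interest, and the products of its
initial segments occur in the two-form of the word. -/
def word {r : ℕ} (a b : Fin r → Jet c V) : List (Jet c V) :=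
  List.ofFn fun i => a i * b i * (a i)⁻¹

/-- The contributions of `a` and `a⁻¹` cancel. -/
theorem acts_conj {a b : Jet c V} {v w : V} {ξ η : Mat} {d : ℝ}
    (ha : a.θ v = Ad a.g⁻¹ ξ - η) (hb : b.Acts v w η η d) : (a * b * a⁻¹).Acts v w ξ ξ d := by
  have h := acts_of_θ_eq ha w
  have := (h.mul hb).mul h.inv
  convert this using 1
  ring

/-- If the `a_i` move like `a_i ↦ e^{tξ} a_i e^{-tη_i}` and the `b_i` by conjugation with
`e^{tη_i}`, then the word moves by conjugation with `e^{tξ}`, and its two-form satisfies the moment map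
condition, with the `b_i` contributing the correction term. -/
theorem acts_prod_word {r : ℕ} {a b : Fin r → Jet c V} {v w : V} {ξ : Mat} {η : Fin r → Mat}
    (ha : ∀ i, (a i).θ v = Ad (a i).g⁻¹ ξ - η i) (hb : ∀ i, (b i).θ v = Ad (b i).g⁻¹ (η i) - η i)
    (hs : ∀ i, (b i).s = 0) : (word a b).prod.Acts v w ξ ξ
      (-((1 / 2 : ℝ) * ∑ i, pairing c ((b i).θ w + (b i).θbar w) (η i))) := by
  rw [Finset.mul_sum, ← Finset.sum_neg_distrib]
  refine Acts.prod_ofFn fun i => acts_conj (ha i) ?_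
  refine ⟨hb i, ?_⟩
  rw [hs, pairing_add_left, pairing_comm c _ (η i), pairing_comm c _ (η i)]
  simp
  ring

/-- If in the direction `v` the `b_i` and the product of the `a_i b_i a_i⁻¹` do not move and the
contraction of the two-form with `v` vanishes, then the partial products of the `a_i b_i a_i⁻¹` do
not move: test with the directions in which the first `k` of the `a_i` are multiplied by `e^{tξ}`
from the left. -/
theorem θ_take_word_eq_zero {r : ℕ} {a b : Fin r → Jet c V} {v : V} (hc : c ≠ 0)
    (has : ∀ i, (a i).θ v ∈ su2)
    (hb : ∀ i, (b i).s = 0)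
    (hw : ∀ X Y : Fin r → Mat, (∀ i, X i ∈ su2) → (∀ i, Y i ∈ su2) →
      ∃ w, ∀ i, (a i).θ w = X i ∧ (b i).θ w = Y i)
    (hv : ∀ w, (word a b).prod.s ![v, w] = 0) (hbv : ∀ i, (b i).θ v = 0)
    (hX : (word a b).prod.θ v = 0) (k : ℕ) : ((word a b).take k).prod.θ v = 0 := by
  have hsu : ((word a b).take k).prod.θ v ∈ su2 := by
    refine θ_list_prod_mem_su2 fun x hx => ?_
    obtain ⟨i, rfl⟩ := List.mem_ofFn.1 (List.mem_of_mem_take hx)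
    simp only [mul_θ, inv_θ, add_apply, ContinuousLinearMap.comp_apply,
      neg_apply, hbv, add_zero, θbar_apply]
    exact su2.add_mem (Ad_mem_su2 _ (Ad_mem_su2 _ (has i)))
      (su2.neg_mem (Ad_mem_su2 _ (has i)))
  refine eq_zero_of_pairing_eq_zero hc hsu fun ξ hξ => ?_
  obtain ⟨w, hw⟩ := hw (fun i => if (i : ℕ) < k then Ad (a i).g⁻¹ ξ else 0) (fun _ => 0)
    (fun i => by split_ifs; exacts [Ad_mem_su2 _ hξ, su2.zero_mem]) (fun _ => su2.zero_mem)
  have hbw : ∀ i, (b i).Acts w v 0 0 0 := fun i => ⟨by simp [(hw i).2], by simp [hb]⟩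
  have hP : ((word a b).take k).prod.Acts w v ξ ξ 0 := by
    refine Acts.list_prod fun x hx => ?_
    obtain ⟨i, hi, rfl⟩ := List.mem_take_iff_getElem.1 hx
    simp only [word, List.getElem_ofFn]
    exact acts_conj (by simp only [(hw _).1]; rw [if_pos (by simp at hi; exact hi.1)]; simp) (hbw _)
  have hQ : ((word a b).drop k).prod.Acts w v 0 0 0 := by
    refine Acts.list_prod fun x hx => ?_
    obtain ⟨i, hi, rfl⟩ := List.mem_drop_iff_getElem.1 hx
    simp only [word, List.getElem_ofFn]
    exact acts_conj (by simp only [(hw _).1]; rw [if_neg (by simp)]; simp) (hbw _)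
  have hPQ := List.prod_take_mul_prod_drop (word a b) k
  generalize ((word a b).take k).prod = P at *
  generalize ((word a b).drop k).prod = Q at *
  have h1 : (word a b).prod.s ![w, v] = 0 := by
    rw [twoForm_swap, hv w, neg_zero]
  rw [← hPQ] at h1 hX
  have h2 : Q.θbar v = -P.θ v := by
    have := congrArg (Ad Q.g) hX
    simp at this
    rw [θbar_apply, eq_neg_iff_add_eq_zero, add_comm]
    exact this
  have h3 : Q.θbar w = 0 := by simp [θbar_apply, hQ.θ_eq]
  simp only [mul_s, ContinuousAlternatingMap.add_apply, ContinuousAlternatingMap.smul_apply,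
    wedge_apply, hP.s_eq, hQ.s_eq, Matrix.cons_val_zero, Matrix.cons_val_one, h2, h3, hP.θ_eq,
    pairing_zero_left, pairing_zero_right, pairing_neg_right, pairing_sub_left, smul_eq_mul] at h1
  rw [pairing_Ad, inv_inv, ← θbar_apply] at h1
  linarith

/-- The minimal degeneracy of the two-form: a direction in its kernel in which the `b_i` and the
product of the `a_i b_i a_i⁻¹` do not move is zero. -/
theorem θ_eq_zero_of_word {r : ℕ} {a b : Fin r → Jet c V} {v : V} (hc : c ≠ 0)
    (has : ∀ i, (a i).θ v ∈ su2)
    (ha : ∀ i, (a i).s = 0) (hb : ∀ i, (b i).s = 0)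
    (hw : ∀ X Y : Fin r → Mat, (∀ i, X i ∈ su2) → (∀ i, Y i ∈ su2) →
      ∃ w, ∀ i, (a i).θ w = X i ∧ (b i).θ w = Y i)
    (hv : ∀ w, (word a b).prod.s ![v, w] = 0) (hbv : ∀ i, (b i).θ v = 0)
    (hX : (word a b).prod.θ v = 0) (k : Fin r) : (a k).θ v = 0 := by
  have hP := θ_take_word_eq_zero hc has hb hw hv hbv hX
  -- as the partial products do not move, neither do the factors
  have hf : ∀ i, (a i * b i * (a i)⁻¹).θ v = 0 := by
    intro i
    have h := List.prod_take_succ (word a b) i (by simp [word])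
    have h1 := hP (i + 1)
    rw [h, mul_θ, add_apply, ContinuousLinearMap.comp_apply, hP i, map_zero,
      zero_add] at h1
    simpa only [word, List.getElem_ofFn] using h1
  -- hence the motion of `a_k` commutes with `b_k`
  have hα : Ad (b k).g⁻¹ ((a k).θ v) = (a k).θ v := by
    have h1 := congrArg (Ad (a k).g⁻¹) (hf k)
    simp [hbv, θbar_apply, ← sub_eq_add_neg, sub_eq_zero] at h1
    exact h1
  -- test with the direction in which only `b_k` moves, by `Y`
  refine eq_zero_of_pairing_eq_zero hc (has k) fun Y hY => ?_
  obtain ⟨w, hw⟩ := hw (fun _ => 0) (fun i => if i = k then Y else 0) (fun _ => su2.zero_mem)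
    (fun i => by split_ifs; exacts [hY, su2.zero_mem])
  have h1 := hv w
  rw [word, prod_ofFn_s, ContinuousAlternatingMap.sum_apply, Finset.sum_eq_single k] at h1
  · have hα' : Ad (b k).g ((a k).θ v) = (a k).θ v := by
      conv_lhs => rw [← hα, Ad_Ad_inv]
    have hP' : (List.take k (List.ofFn fun i => a i * b i * (a i)⁻¹)).prod.θ v = 0 := hP k
    have hf' : (a k * b k * (a k)⁻¹).θbar v = 0 := by rw [θbar_apply, hf, map_zero]
    simp only [ContinuousAlternatingMap.add_apply, ContinuousAlternatingMap.smul_apply,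
      wedge_apply, Matrix.cons_val_zero, Matrix.cons_val_one, hP', hf', pairing_zero_left,
      pairing_zero_right, sub_zero, smul_zero, add_zero] at h1
    simp [wedge_apply, ha, hb, hw, hbv, hα, θbar_apply, pairing_neg_right] at h1
    rw [← hα', pairing_Ad_Ad, pairing_comm c _ Y, hα'] at h1
    linarith
  · intro i _ hi
    have hP' : (List.take i (List.ofFn fun i => a i * b i * (a i)⁻¹)).prod.θ v = 0 := hP i
    have hf' : (a i * b i * (a i)⁻¹).θbar v = 0 := by rw [θbar_apply, hf, map_zero]
    simp only [ContinuousAlternatingMap.add_apply, ContinuousAlternatingMap.smul_apply,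
      wedge_apply, Matrix.cons_val_zero, Matrix.cons_val_one, hP', hf', pairing_zero_left,
      pairing_zero_right, sub_zero, smul_zero, add_zero]
    simp [wedge_apply, ha, hb, hw, hbv, hi, θbar_apply]
  · simp

end Jet
end Jet

/-! ### Maurer-Cartan forms of products, and jets of maps -/

section MaurerCartan

variable {E : Type*} [NormedAddCommGroup E] [NormedSpace ℝ E] {H : Type*} [TopologicalSpace H]
  {I : ModelWithCorners ℝ E H} {M : Type*} [TopologicalSpace M] [ChartedSpace H M]

/-- Differentiability at `x` of `f : M → SU(2)` as a matrix-valued map. -/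
abbrev MatDiffAt (I : ModelWithCorners ℝ E H) (f : M → SU2) (x : M) : Prop :=
  MDifferentiableAt I 𝓘(ℝ, Mat) (fun y => (f y : Mat)) x

theorem MDifferentiableAt.matDiffAt {f : M → SU2} {x : M} (hf : MDifferentiableAt I (𝓡 3) f x) :
    MatDiffAt I f x :=
  ((contMDiff_coe_SU2 (n := ∞)).mdifferentiable (by simp) (f x)).comp x hf

theorem matDiffAt_of_contMDiff {f : M → SU2} {x : M} (hf : ContMDiff I (𝓡 3) ∞ f) :
    MatDiffAt I f x :=
  MDifferentiableAt.matDiffAt (hf.mdifferentiable (by simp) x)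

theorem mcRight_eq (f : M → SU2) (x : M) : mcRight I f x = (Ad (f x)).comp (mcLeft I f x) := by
  ext1 v
  rw [ContinuousLinearMap.comp_apply, Ad_apply, mcRight_apply, mcLeft_apply, ← mul_assoc,
    coe_mul_inv, one_mul]

theorem hasMFDerivAt_mul {f g : M → SU2} {x : M} (hf : MatDiffAt I f x) (hg : MatDiffAt I g x) :
    HasMFDerivAt I 𝓘(ℝ, Mat) (fun y => ((f y * g y : SU2) : Mat)) x
      ((ContinuousLinearMap.mul ℝ Mat (f x)).comp (matDeriv I g x) +
        ((ContinuousLinearMap.mul ℝ Mat).flip (g x)).comp (matDeriv I f x)) := by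
  exact hf.hasMFDerivAt.mul' hg.hasMFDerivAt

theorem MatDiffAt.mul {f g : M → SU2} {x : M} (hf : MatDiffAt I f x) (hg : MatDiffAt I g x) :
    MatDiffAt I (fun y => f y * g y) x :=
  (hasMFDerivAt_mul hf hg).mdifferentiableAt

theorem MatDiffAt.inv {f : M → SU2} {x : M} (hf : MatDiffAt I f x) :
    MatDiffAt I (fun y => (f y)⁻¹) x :=
  (starCLM.hasMFDerivAt.comp x hf.hasMFDerivAt).mdifferentiableAt

theorem mcLeft_mul {f g : M → SU2} {x : M} (hf : MatDiffAt I f x) (hg : MatDiffAt I g x) :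
    mcLeft I (fun y => f y * g y) x = (Ad (g x)⁻¹).comp (mcLeft I f x) + mcLeft I g x := by
  ext1 v
  have h : matDeriv I (fun y => f y * g y) x = _ := (hasMFDerivAt_mul hf hg).mfderiv
  rw [add_apply, ContinuousLinearMap.comp_apply, Ad_apply, mcLeft_apply, mcLeft_apply,
    mcLeft_apply, h]
  have e1 : ((((f x * g x)⁻¹ : SU2)) : Mat) = ((g x)⁻¹ : SU2) * ((f x)⁻¹ : SU2) := by
    rw [mul_inv_rev]; rfl
  rw [e1, inv_inv]
  show (((g x)⁻¹ : SU2) : Mat) * ((f x)⁻¹ : SU2) *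
    ((f x : Mat) * matDeriv I g x v + matDeriv I f x v * (g x : Mat)) = _
  rw [mul_add, mul_assoc _ _ ((f x : Mat) * _), ← mul_assoc _ (f x : Mat), coe_inv_mul, one_mul,
    add_comm]
  simp only [mul_assoc]

theorem mcLeft_const (g : SU2) (x : M) : mcLeft I (fun _ => g) x = 0 := by
  ext1 v
  have h : matDeriv I (fun _ : M => g) x = 0 := mfderiv_const
  rw [mcLeft_apply, h]
  simp

theorem mcLeft_inv {f : M → SU2} {x : M} (hf : MatDiffAt I f x) :
    mcLeft I (fun y => (f y)⁻¹) x = -mcRight I f x := by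
  have h := mcLeft_mul hf.inv hf
  simp only [inv_mul_cancel, mcLeft_const] at h
  rw [mcRight_eq]
  ext1 v
  have h1 := congrArg (Ad (f x)) (DFunLike.congr_fun h.symm v)
  simp at h1
  exact eq_neg_of_add_eq_zero_left h1

end MaurerCartan

/-! ### Exterior derivatives -/

section Calculus

variable {E : Type*} [NormedAddCommGroup E] [NormedSpace ℝ E]

theorem abs_pairing_le (c : ℝ) (X Y : Mat) : |pairing c X Y| ≤ ‖pairingCLM c‖ * ‖X‖ * ‖Y‖ :=
  (pairingCLM c).le_opNorm₂ X Y

/-- The wedge product of matrix-valued one-forms as a continuous bilinear map. -/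
def wedgeCLM (E : Type*) [NormedAddCommGroup E] [NormedSpace ℝ E] (c : ℝ) :
    (E →L[ℝ] Mat) →L[ℝ] (E →L[ℝ] Mat) →L[ℝ] E [⋀^Fin 2]→L[ℝ] ℝ :=
  LinearMap.mkContinuous₂
    (LinearMap.mk₂ ℝ (wedge c)
      (fun α α' β => by ext v; simp [wedge_apply, pairing_add_left]; ring)
      (fun r α β => by ext v; simp [wedge_apply, pairing]; ring)
      (fun α β β' => by ext v; simp [wedge_apply, pairing_add_right]; ring)
      (fun r α β => by ext v; simp [wedge_apply, pairing]; ring))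
    (2 * ‖pairingCLM c‖) (fun α β => by
      refine ContinuousAlternatingMap.opNorm_le_bound _ (by positivity) fun v => ?_
      simp only [LinearMap.mk₂_apply, wedge_apply, Fin.prod_univ_two, Real.norm_eq_abs]
      have h : ∀ i j, |pairing c (α (v i)) (β (v j))| ≤
          ‖pairingCLM c‖ * (‖α‖ * ‖v i‖) * (‖β‖ * ‖v j‖) := fun i j =>
        (abs_pairing_le c _ _).trans (by gcongr <;> exact ContinuousLinearMap.le_opNorm _ _)
      calc _ ≤ |pairing c (α (v 0)) (β (v 1))| + |pairing c (α (v 1)) (β (v 0))| := abs_sub _ _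
        _ ≤ _ := add_le_add (h 0 1) (h 1 0)
        _ = _ := by ring)

theorem wedgeCLM_apply (c : ℝ) (α β : E →L[ℝ] Mat) : wedgeCLM E c α β = wedge c α β := rfl

/-- The exterior derivative of `⟨α, β⟩`, `d⟨α, β⟩ = ⟨dα, β⟩ - ⟨α, dβ⟩`. -/
theorem extDeriv_wedge (c : ℝ) {α β : E → E →L[ℝ] Mat} {y : E} (hα : DifferentiableAt ℝ α y)
    (hβ : DifferentiableAt ℝ β y) {dα dβ : E → E → Mat}
    (h1 : ∀ u v, fderiv ℝ α y u v - fderiv ℝ α y v u = dα u v)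
    (h2 : ∀ u v, fderiv ℝ β y u v - fderiv ℝ β y v u = dβ u v) (u v w : E) :
    extDeriv (fun z => wedge c (α z) (β z)) y ![u, v, w] =
      pairing c (dα u v) (β y w) + pairing c (dα v w) (β y u) + pairing c (dα w u) (β y v) -
      (pairing c (α y u) (dβ v w) + pairing c (α y v) (dβ w u) + pairing c (α y w) (dβ u v)) := by
  have h := ContinuousLinearMap.hasFDerivAt_of_bilinear (E := E →L[ℝ] Mat) (F := E →L[ℝ] Mat)
    (G := E [⋀^Fin 2]→L[ℝ] ℝ) (wedgeCLM E c) (f := α) (g := β) (x := y) (G' := E)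
    hα.hasFDerivAt hβ.hasFDerivAt
  show extDeriv (fun z => wedgeCLM E c (α z) (β z)) y _ = _
  rw [extDeriv, h.fderiv, ContinuousAlternatingMap.alternatizeUncurryFin_apply]
  simp only [← h1, ← h2]
  have e0 : Fin.removeNth (0 : Fin 3) ![u, v, w] = ![v, w] := by ext i; fin_cases i <;> rfl
  have e1 : Fin.removeNth (1 : Fin 3) ![u, v, w] = ![u, w] := by ext i; fin_cases i <;> rfl
  have e2 : Fin.removeNth (2 : Fin 3) ![u, v, w] = ![u, v] := by ext i; fin_cases i <;> rfl
  simp [Fin.sum_univ_three, e0, e1, e2, wedgeCLM_apply, wedge_apply, pairing_sub_left,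
    pairing_sub_right]
  ring

theorem matDeriv_eq_fderiv (f : E → SU2) (z : E) :
    matDeriv 𝓘(ℝ, E) f z = fderiv ℝ (fun y => (f y : Mat)) z := mfderiv_eq_fderiv

theorem contDiffAt_star_SU2 {n : ℕ∞ω} {f : E → SU2} {y : E}
    (hf : ContDiffAt ℝ n (fun z => (f z : Mat)) y) :
    ContDiffAt ℝ n (fun z => (((f z)⁻¹ : SU2) : Mat)) y :=
  starCLM.contDiff.contDiffAt.comp y hf

/-- `mcLeft` on a normed space, as a function with values in continuous linear maps. -/
def mcLeftE (f : E → SU2) (z : E) : E →L[ℝ] Mat := mcLeft 𝓘(ℝ, E) f z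

/-- `mcRight` on a normed space, as a function with values in continuous linear maps. -/
def mcRightE (f : E → SU2) (z : E) : E →L[ℝ] Mat := mcRight 𝓘(ℝ, E) f z

theorem mcLeftE_eq (f : E → SU2) (z : E) : mcLeftE f z =
    (ContinuousLinearMap.mul ℝ Mat (((f z)⁻¹ : SU2) : Mat)).comp
      (fderiv ℝ (fun y => (f y : Mat)) z) := by
  rw [← matDeriv_eq_fderiv]
  rfl

theorem mcRightE_eq (f : E → SU2) (z : E) : mcRightE f z =
    ((ContinuousLinearMap.mul ℝ Mat).flip (((f z)⁻¹ : SU2) : Mat)).comp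
      (fderiv ℝ (fun y => (f y : Mat)) z) := by
  rw [← matDeriv_eq_fderiv]
  rfl

theorem contDiffAt_mcLeftE {f : E → SU2} {y : E} (hf : ContDiffAt ℝ ∞ (fun z => (f z : Mat)) y) :
    ContDiffAt ℝ ∞ (mcLeftE f) y := by
  rw [funext (mcLeftE_eq f)]
  exact ((ContinuousLinearMap.mul ℝ Mat).contDiff.contDiffAt.comp y
    (contDiffAt_star_SU2 hf)).clm_comp
    (hf.fderiv_right (m := ∞) (by simp))

theorem matDiffAt_of_contDiffAt {f : E → SU2} {y : E}
    (hf : ContDiffAt ℝ ∞ (fun z => (f z : Mat)) y) : MatDiffAt 𝓘(ℝ, E) f y :=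
  (hf.differentiableAt (by simp)).mdifferentiableAt

theorem eventuallyEq_mcRightE {f : E → SU2} {y : E}
    (hf : ContDiffAt ℝ ∞ (fun z => (f z : Mat)) y) :
    mcRightE f =ᶠ[nhds y] fun z => -mcLeftE (fun x => (f x)⁻¹) z := by
  have h := (hf.of_le (m := 1) (by simp)).eventually (by simp)
  filter_upwards [h] with z hz
  have h1 : MatDiffAt 𝓘(ℝ, E) f z := (hz.differentiableAt (by simp)).mdifferentiableAt
  ext1 w
  have h2 := DFunLike.congr_fun (mcLeft_inv h1) w
  exact (neg_eq_iff_eq_neg.2 h2).symm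

theorem contDiffAt_mcRightE {f : E → SU2} {y : E} (hf : ContDiffAt ℝ ∞ (fun z => (f z : Mat)) y) :
    ContDiffAt ℝ ∞ (mcRightE f) y :=
  (contDiffAt_mcLeftE (contDiffAt_star_SU2 hf)).neg.congr_of_eventuallyEq (eventuallyEq_mcRightE hf)

/-- The Maurer-Cartan equation `dθ = -(1/2) [θ, θ]`. -/
theorem fderiv_mcLeftE_sub {f : E → SU2} {y : E} (hf : ContDiffAt ℝ ∞ (fun z => (f z : Mat)) y)
    (u v : E) :
    fderiv ℝ (mcLeftE f) y u v - fderiv ℝ (mcLeftE f) y v u =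
      -⁅mcLeftE f y u, mcLeftE f y v⁆ := by
  have hF := (hf.differentiableAt (by simp)).hasFDerivAt
  have hF' := ((hf.fderiv_right (m := ∞) (by simp)).differentiableAt (by simp)).hasFDerivAt
  have hS := (starCLM.hasFDerivAt.comp y hF)
  have hM : ∀ u v, fderiv ℝ (mcLeftE f) y u v =
      (((f y)⁻¹ : SU2) : Mat) * fderiv ℝ (fderiv ℝ fun z => (f z : Mat)) y u v +
      star (fderiv ℝ (fun z => (f z : Mat)) y u) * fderiv ℝ (fun z => (f z : Mat)) y v := by
    intro u v
    have hA : HasFDerivAt (fun z => ContinuousLinearMap.mul ℝ Mat (((f z)⁻¹ : SU2) : Mat))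
        ((ContinuousLinearMap.mul ℝ Mat).comp
          (starCLM.comp (fderiv ℝ (fun z => (f z : Mat)) y))) y :=
      (ContinuousLinearMap.mul ℝ Mat).hasFDerivAt.comp y hS
    rw [funext (mcLeftE_eq f), (hA.clm_comp hF').fderiv]
    rfl
  have hsymm := (hf.isSymmSndFDerivAt (by simp; exact WithTop.coe_le_coe.2 le_top)) u v
  have hstar : ∀ u, star (fderiv ℝ (fun z => (f z : Mat)) y u) =
      -((((f y)⁻¹ : SU2) : Mat) * fderiv ℝ (fun z => (f z : Mat)) y u *
        (((f y)⁻¹ : SU2) : Mat)) := by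
    intro u
    have h := mcLeft_inv (matDiffAt_of_contDiffAt hf)
    have h1 : mcLeftE (fun y => (f y)⁻¹) y u = -mcRightE f y u := DFunLike.congr_fun h u
    rw [mcLeftE_eq, mcRightE_eq, inv_inv, show (fun z => (((f z)⁻¹ : SU2) : Mat)) =
        starCLM ∘ fun z => (f z : Mat) from rfl, hS.fderiv] at h1
    have h2 := congrArg (fun X : Mat => (((f y)⁻¹ : SU2) : Mat) * X) h1
    simp only [ContinuousLinearMap.comp_apply, ContinuousLinearMap.mul_apply',
      ContinuousLinearMap.flip_apply] at h2
    simp only [← mul_assoc, coe_inv_mul, one_mul] at h2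
    rw [mul_neg, ← mul_assoc] at h2
    exact h2
  rw [hM, hM, hsymm, hstar, hstar, mcLeftE_eq]
  simp [Ring.lie_def, mul_assoc]
  abel

/- The general lemmas on brackets are stated for Lie rings, while the bracket in the definition of
`χ` is the commutator of the ring of matrices. -/

theorem lie_neg_neg_mat (X Y : Mat) : ⁅-X, -Y⁆ = ⁅X, Y⁆ := by
  simp only [Ring.lie_def, neg_mul_neg]

theorem lie_add_mat (X Y Z : Mat) : ⁅X, Y + Z⁆ = ⁅X, Y⁆ + ⁅X, Z⁆ := by
  simp only [Ring.lie_def, mul_add, add_mul]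
  abel

theorem add_lie_mat (X Y Z : Mat) : ⁅X + Y, Z⁆ = ⁅X, Z⁆ + ⁅Y, Z⁆ := by
  simp only [Ring.lie_def, mul_add, add_mul]
  abel

/-- The Maurer-Cartan equation `dθ̄ = (1/2) [θ̄, θ̄]`, from the one for `θ` by inversion. -/
theorem fderiv_mcRightE_sub {f : E → SU2} {y : E} (hf : ContDiffAt ℝ ∞ (fun z => (f z : Mat)) y)
    (u v : E) :
    fderiv ℝ (mcRightE f) y u v - fderiv ℝ (mcRightE f) y v u =
      ⁅mcRightE f y u, mcRightE f y v⁆ := by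
  have h := fderiv_mcLeftE_sub (contDiffAt_star_SU2 hf) u v
  rw [(eventuallyEq_mcRightE hf).fderiv_eq, (eventuallyEq_mcRightE hf).self_of_nhds]
  have h1 : fderiv ℝ (fun z => -mcLeftE (fun x => (f x)⁻¹) z) y =
      -fderiv ℝ (mcLeftE (fun x => (f x)⁻¹)) y :=
    fderiv_fun_neg (F := E →L[ℝ] Mat) (f := mcLeftE fun x => (f x)⁻¹)
  rw [h1]
  show -_ - -_ = ⁅-(mcLeftE (fun x => (f x)⁻¹) y u), -(mcLeftE (fun x => (f x)⁻¹) y v)⁆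
  rw [lie_neg_neg_mat, ← neg_eq_iff_eq_neg.2 h]
  abel

/-- The canonical three-form `(1/12) ⟨θ, [θ, θ]⟩`, as a function of the values of `θ` on three
vectors. -/
def chi (c : ℝ) (X Y Z : Mat) : ℝ :=
  (1 / 12 : ℝ) * (pairing c X ((2 : ℝ) • ⁅Y, Z⁆) + pairing c Y ((2 : ℝ) • ⁅Z, X⁆) +
    pairing c Z ((2 : ℝ) • ⁅X, Y⁆))

theorem pairing_lie_cycle (c : ℝ) (X Y Z : Mat) : pairing c X ⁅Y, Z⁆ = pairing c Y ⁅Z, X⁆ := by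
  simp only [Ring.lie_def, pairing_sub_right]
  simp only [pairing, ← mul_assoc]
  rw [Matrix.trace_mul_cycle Y Z X, Matrix.trace_mul_cycle X Z Y]

theorem chi_eq (c : ℝ) (X Y Z : Mat) : chi c X Y Z = (1 / 2 : ℝ) * pairing c X ⁅Y, Z⁆ := by
  have h : ∀ A B : Mat, pairing c A ((2 : ℝ) • B) = 2 * pairing c A B := by
    intro A B
    simp [pairing]
    ring
  rw [chi, h, h, h, ← pairing_lie_cycle c X Y Z, pairing_lie_cycle c Z X Y]
  ring

theorem chi_Ad (c : ℝ) (g : SU2) (X Y Z : Mat) :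
    chi c (Ad g X) (Ad g Y) (Ad g Z) = chi c X Y Z := by
  have h : ⁅Ad g Y, Ad g Z⁆ = Ad g ⁅Y, Z⁆ := by
    have h1 : ∀ A B : Mat, Ad g A * Ad g B = Ad g (A * B) := by
      intro A B
      rw [Ad_apply, Ad_apply, Ad_apply, mul_assoc, mul_assoc, mul_assoc, mul_assoc,
        ← mul_assoc ((g⁻¹ : SU2) : Mat) (g : Mat), coe_inv_mul, one_mul, mul_assoc]
    rw [Ring.lie_def, Ring.lie_def, h1, h1, map_sub]
  rw [chi_eq, chi_eq, h, pairing_Ad_Ad]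

theorem chi_neg (c : ℝ) (X Y Z : Mat) : chi c (-X) (-Y) (-Z) = -chi c X Y Z := by
  simp [chi_eq, pairing_neg_left, lie_neg_neg_mat]

/-- The mixed terms are those of `-(1/2) d⟨α, β⟩` for one-forms with `dα = -(1/2) [α, α]` and
`dβ = (1/2) [β, β]`. -/
theorem chi_add (c : ℝ) (X X' X'' Y Y' Y'' : Mat) :
    chi c (X + Y) (X' + Y') (X'' + Y'') = chi c X X' X'' + chi c Y Y' Y'' + (1 / 2 : ℝ) *
      (pairing c ⁅X, X'⁆ Y'' + pairing c ⁅X', X''⁆ Y + pairing c ⁅X'', X⁆ Y' +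
        (pairing c X ⁅Y', Y''⁆ + pairing c X' ⁅Y'', Y⁆ + pairing c X'' ⁅Y, Y'⁆)) := by
  simp only [chi_eq, add_lie_mat, lie_add_mat, pairing_add_left, pairing_add_right]
  rw [pairing_lie_cycle c X X' Y'', pairing_lie_cycle c X' Y'' X, pairing_comm c ⁅X, X'⁆,
    pairing_lie_cycle c X Y' X'', pairing_comm c ⁅X'', X⁆, pairing_comm c ⁅X', X''⁆,
    pairing_lie_cycle c Y X' Y'', ← pairing_lie_cycle c X'' Y Y']
  ring

theorem mcRightE_apply (f : E → SU2) (y u : E) : mcRightE f y u = Ad (f y) (mcLeftE f y u) :=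
  DFunLike.congr_fun (mcRight_eq (I := 𝓘(ℝ, E)) f y) u

theorem chi_inv (c : ℝ) {f : E → SU2} {y : E} (hf : ContDiffAt ℝ ∞ (fun z => (f z : Mat)) y)
    (u v w : E) :
    chi c (mcLeftE (fun z => (f z)⁻¹) y u) (mcLeftE (fun z => (f z)⁻¹) y v)
      (mcLeftE (fun z => (f z)⁻¹) y w) =
    -chi c (mcLeftE f y u) (mcLeftE f y v) (mcLeftE f y w) := by
  have h : ∀ u, mcLeftE (fun z => (f z)⁻¹) y u = -mcRightE f y u := fun u =>
    DFunLike.congr_fun (mcLeft_inv (matDiffAt_of_contDiffAt hf)) u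
  rw [h, h, h, chi_neg, mcRightE_apply, mcRightE_apply, mcRightE_apply, chi_Ad]

/-- The cocycle `(1/2) ⟨f^*θ, g^*θ̄⟩`. -/
def cocycleE (c : ℝ) (f g : E → SU2) (z : E) : E [⋀^Fin 2]→L[ℝ] ℝ :=
  (1 / 2 : ℝ) • wedge c (mcLeftE f z) (mcRightE g z)

theorem contDiffAt_cocycleE (c : ℝ) {f g : E → SU2} {y : E}
    (hf : ContDiffAt ℝ ∞ (fun z => (f z : Mat)) y) (hg : ContDiffAt ℝ ∞ (fun z => (g z : Mat)) y) :
    ContDiffAt ℝ ∞ (cocycleE c f g) y :=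
  (((wedgeCLM E c).contDiff.contDiffAt.comp y (contDiffAt_mcLeftE hf)).clm_apply
    (contDiffAt_mcRightE hg)).const_smul (1 / 2 : ℝ)

/-- The Polyakov-Wiegmann identity: `(1/2) d⟨f^*θ, g^*θ̄⟩ = f^*χ + g^*χ - (fg)^*χ`. -/
theorem extDeriv_cocycleE (c : ℝ) {f g : E → SU2} {y : E}
    (hf : ContDiffAt ℝ ∞ (fun z => (f z : Mat)) y) (hg : ContDiffAt ℝ ∞ (fun z => (g z : Mat)) y)
    (u v w : E) : extDeriv (cocycleE c f g) y ![u, v, w] =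
      chi c (mcLeftE f y u) (mcLeftE f y v) (mcLeftE f y w) +
      chi c (mcLeftE g y u) (mcLeftE g y v) (mcLeftE g y w) -
      chi c (mcLeftE (fun z => f z * g z) y u) (mcLeftE (fun z => f z * g z) y v)
        (mcLeftE (fun z => f z * g z) y w) := by
  have h : ∀ u, mcLeftE (fun z => f z * g z) y u =
      Ad (g y)⁻¹ (mcLeftE f y u + mcRightE g y u) := by
    intro u
    have h1 := DFunLike.congr_fun (mcLeft_mul (matDiffAt_of_contDiffAt hf)
      (matDiffAt_of_contDiffAt hg)) u
    rw [map_add, mcRightE_apply, Ad_inv_Ad]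
    exact h1
  have h2 : cocycleE c f g = (1 / 2 : ℝ) • fun z => wedge c (mcLeftE f z) (mcRightE g z) := rfl
  rw [h2, extDeriv_smul, ContinuousAlternatingMap.smul_apply,
    extDeriv_wedge c ((contDiffAt_mcLeftE hf).differentiableAt (by simp))
    ((contDiffAt_mcRightE hg).differentiableAt (by simp)) (fderiv_mcLeftE_sub hf)
    (fderiv_mcRightE_sub hg), h, h, h, chi_Ad, chi_add]
  have h3 : ∀ u v w, chi c (mcRightE g y u) (mcRightE g y v) (mcRightE g y w) =
      chi c (mcLeftE g y u) (mcLeftE g y v) (mcLeftE g y w) := by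
    intro u v w
    rw [mcRightE_apply, mcRightE_apply, mcRightE_apply, chi_Ad]
  rw [h3]
  simp only [pairing_neg_left, smul_eq_mul]
  ring

end Calculus

/-! ### Holonomies as smooth maps -/

namespace ExtModuli

variable {r : ℕ}

theorem contMDiff_coords {n : ℕ∞ω} : ContMDiff (model r) (model r) n (coords r) :=
  contMDiff_transportCharts (model r) (coords r)

theorem contMDiff_coords_symm {n : ℕ∞ω} : ContMDiff (model r) (model r) n (coords r).symm :=
  contMDiff_symm_transportCharts (model r) (coords r)

theorem contMDiff_a (i : Fin r) : ContMDiff (model r) (𝓡 3) ∞ fun p : ExtModuli r => p.a i :=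
  have h : ContMDiff (model r) (Ipow r) ∞ fun p : ExtModuli r => (coords r p).1 :=
    contMDiff_fst.comp contMDiff_coords
  (contMDiff_apply_Gpow i).comp h

theorem contMDiff_b_succ (i : Fin r) :
    ContMDiff (model r) (𝓡 3) ∞ fun p : ExtModuli r => p.b i.succ :=
  have h : ContMDiff (model r) (Ipow r) ∞ fun p : ExtModuli r => (coords r p).2 :=
    contMDiff_snd.comp contMDiff_coords
  (contMDiff_apply_Gpow i).comp h

theorem contMDiff_doubleMoment (i : Fin r) :
    ContMDiff (model r) (𝓡 3) ∞ (doubleMoment (r := r) i) :=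
  contMDiff_mul_SU2 (contMDiff_mul_SU2 (contMDiff_a i) (contMDiff_b_succ i))
    (contMDiff_inv_SU2 (contMDiff_a i))

theorem b_zero (p : ExtModuli r) : p.b 0 = (List.ofFn fun i : Fin r => doubleMoment i p).prod⁻¹ :=
  eq_inv_of_mul_eq_one_left p.rel

theorem contMDiff_b (j : Fin (r + 1)) :
    ContMDiff (model r) (𝓡 3) ∞ fun p : ExtModuli r => p.b j := by
  refine Fin.cases ?_ contMDiff_b_succ j
  simp only [b_zero]
  exact contMDiff_inv_SU2 (contMDiff_prod_ofFn_SU2 contMDiff_doubleMoment)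

theorem contMDiff_moment : ContMDiff (model r) (Ipow (r + 1)) ∞ (moment (r := r)) :=
  contMDiff_Gpow fun j => contMDiff_inv_SU2 (contMDiff_b j)

variable {E : Type*} [NormedAddCommGroup E] [NormedSpace ℝ E] {H : Type*} [TopologicalSpace H]
  {I : ModelWithCorners ℝ E H} {M : Type*} [TopologicalSpace M] [ChartedSpace H M]

/-- A map to the moduli space is smooth if its holonomies are; `b_1` is determined by the others. -/
theorem contMDiff_of_a_b {f : M → ExtModuli r} (ha : ∀ i, ContMDiff I (𝓡 3) ∞ fun x => (f x).a i)
    (hb : ∀ i : Fin r, ContMDiff I (𝓡 3) ∞ fun x => (f x).b i.succ) :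
    ContMDiff I (model r) ∞ f := by
  have h : ContMDiff I (model r) ∞ fun x => coords r (f x) :=
    (contMDiff_Gpow ha).prodMk (contMDiff_Gpow hb)
  convert contMDiff_coords_symm.comp h using 1
  funext x
  exact ((coords r).symm_apply_apply (f x)).symm

/-- The first components of a tangent vector of the moduli space are its images under the
differentials of the `a_i`, since the charts are products of charts in the holonomies. -/
theorem mfderiv_a (i : Fin r) (p : ExtModuli r) (v : TangentSpace (model r) p) :
    mfderiv (model r) (𝓡 3) (fun p : ExtModuli r => p.a i) p v = v.1 i := by
  have h : HasMFDerivAt (model r) (𝓡 3) (fun p : ExtModuli r => p.a i) p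
     ((ContinuousLinearMap.proj (R := ℝ) (φ := fun _ : Fin r => EuclideanSpace ℝ (Fin 3)) i).comp
      (ContinuousLinearMap.fst ℝ (Fin r → EuclideanSpace ℝ (Fin 3))
        (Fin r → EuclideanSpace ℝ (Fin 3)))) := by
    refine ⟨(contMDiff_a i).continuous.continuousAt, ?_⟩
    have h1 : ∀ y ∈ (extChartAt (model r) p).target,
        writtenInExtChartAt (model r) (𝓡 3) p (fun p : ExtModuli r => p.a i) y = y.1 i :=
      fun y hy => congrFun (congrArg Prod.fst ((extChartAt (model r) p).right_inv hy)) i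
    refine (ContinuousLinearMap.hasFDerivWithinAt _).congr_of_eventuallyEq ?_
      (h1 _ (mem_extChartAt_target p))
    filter_upwards [extChartAt_target_mem_nhdsWithin (I := model r) p] with y hy
    exact h1 y hy
  rw [h.mfderiv]
  rfl

theorem mfderiv_b_succ (i : Fin r) (p : ExtModuli r) (v : TangentSpace (model r) p) :
    mfderiv (model r) (𝓡 3) (fun p : ExtModuli r => p.b i.succ) p v = v.2 i := by
  have h : HasMFDerivAt (model r) (𝓡 3) (fun p : ExtModuli r => p.b i.succ) p
     ((ContinuousLinearMap.proj (R := ℝ) (φ := fun _ : Fin r => EuclideanSpace ℝ (Fin 3)) i).comp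
      (ContinuousLinearMap.snd ℝ (Fin r → EuclideanSpace ℝ (Fin 3))
        (Fin r → EuclideanSpace ℝ (Fin 3)))) := by
    refine ⟨(contMDiff_b_succ i).continuous.continuousAt, ?_⟩
    have h1 : ∀ y ∈ (extChartAt (model r) p).target,
        writtenInExtChartAt (model r) (𝓡 3) p (fun p : ExtModuli r => p.b i.succ) y = y.2 i :=
      fun y hy => congrFun (congrArg Prod.snd ((extChartAt (model r) p).right_inv hy)) i
    refine (ContinuousLinearMap.hasFDerivWithinAt _).congr_of_eventuallyEq ?_
      (h1 _ (mem_extChartAt_target p))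
    filter_upwards [extChartAt_target_mem_nhdsWithin (I := model r) p] with y hy
    exact h1 y hy
  rw [h.mfderiv]
  rfl

theorem mcLeft_a (i : Fin r) (p : ExtModuli r) (v : TangentSpace (model r) p) :
    mcLeft (model r) (fun p : ExtModuli r => p.a i) p v =
      (((p.a i)⁻¹ : SU2) : Mat) * matDeriv (𝓡 3) (fun g : SU2 => g) (p.a i) (v.1 i) := by
  rw [mcLeft_apply, matDeriv_comp (I' := 𝓡 3) (g := fun g => g) mdifferentiableAt_id
    ((contMDiff_a i).mdifferentiable (by simp) p), ContinuousLinearMap.comp_apply, mfderiv_a]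

theorem mcLeft_b_succ (i : Fin r) (p : ExtModuli r) (v : TangentSpace (model r) p) :
    mcLeft (model r) (fun p : ExtModuli r => p.b i.succ) p v =
      (((p.b i.succ)⁻¹ : SU2) : Mat) *
        matDeriv (𝓡 3) (fun g : SU2 => g) (p.b i.succ) (v.2 i) := by
  rw [mcLeft_apply, matDeriv_comp (I' := 𝓡 3) (g := fun g => g) mdifferentiableAt_id
    ((contMDiff_b_succ i).mdifferentiable (by simp) p), ContinuousLinearMap.comp_apply,
    mfderiv_b_succ]

end ExtModuli

theorem exists_inv_mul_matDeriv (g : SU2) {X : Mat} (hX : X ∈ su2) :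
    ∃ u, ((g⁻¹ : SU2) : Mat) * matDeriv (𝓡 3) (fun g : SU2 => g) g u = X := by
  obtain ⟨u, hu⟩ := exists_mfderiv_coe_SU2 g hX
  exact ⟨u, by rw [hu, ← mul_assoc, coe_inv_mul, one_mul]⟩

theorem eq_of_inv_mul_matDeriv_eq {g : SU2} {u v : TangentSpace (𝓡 3) g}
    (h : ((g⁻¹ : SU2) : Mat) * matDeriv (𝓡 3) (fun g : SU2 => g) g u =
      ((g⁻¹ : SU2) : Mat) * matDeriv (𝓡 3) (fun g : SU2 => g) g v) : u = v := by
  apply injective_mfderiv_coe_SU2 g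
  have h1 := congrArg (fun X : Mat => (g : Mat) * X) h
  simpa only [← mul_assoc, coe_mul_inv, one_mul] using h1

namespace ExtModuli

variable {r : ℕ}

/-- The `a_i^*θ` and `b_{i+1}^*θ` form a coframe with values in the Lie algebra. -/
theorem exists_mcLeft_eq (p : ExtModuli r) {X Y : Fin r → Mat} (hX : ∀ i, X i ∈ su2)
    (hY : ∀ i, Y i ∈ su2) : ∃ w : TangentSpace (model r) p, ∀ i,
      mcLeft (model r) (fun p : ExtModuli r => p.a i) p w = X i ∧
      mcLeft (model r) (fun p : ExtModuli r => p.b i.succ) p w = Y i := by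
  choose u hu using fun i => exists_inv_mul_matDeriv (p.a i) (hX i)
  choose w hw using fun i => exists_inv_mul_matDeriv (p.b i.succ) (hY i)
  exact ⟨(u, w), fun i => ⟨(mcLeft_a i p _).trans (hu i), (mcLeft_b_succ i p _).trans (hw i)⟩⟩

/-- A tangent vector is determined by the values of the `a_i^*θ` and `b_{i+1}^*θ`. -/
theorem tangent_ext {p : ExtModuli r} {v w : TangentSpace (model r) p}
    (ha : ∀ i, mcLeft (model r) (fun p : ExtModuli r => p.a i) p v =
      mcLeft (model r) (fun p : ExtModuli r => p.a i) p w)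
    (hb : ∀ i : Fin r, mcLeft (model r) (fun p : ExtModuli r => p.b i.succ) p v =
      mcLeft (model r) (fun p : ExtModuli r => p.b i.succ) p w) : v = w := by
  refine Prod.ext (funext fun i => ?_) (funext fun i => ?_)
  · have h := ha i
    rw [mcLeft_a, mcLeft_a] at h
    exact eq_of_inv_mul_matDeriv_eq h
  · have h := hb i
    rw [mcLeft_b_succ, mcLeft_b_succ] at h
    exact eq_of_inv_mul_matDeriv_eq h

end ExtModuli

theorem lieMat_eq {n : ℕ} (ξ : TangentSpace (Ipow n) (1 : Gpow n)) (i : Fin n) :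
    lieMat ξ i = mcLeft (Ipow n) (fun σ : Gpow n => σ i) 1 ξ := by
  rw [mcLeft_apply, Pi.one_apply, inv_one, Submonoid.coe_one, one_mul]
  rfl

theorem lieMat_eq_matDeriv {n : ℕ} (ξ : TangentSpace (Ipow n) (1 : Gpow n)) (i : Fin n) :
    lieMat ξ i = ((1⁻¹ : SU2) : Mat) * matDeriv (𝓡 3) (fun g : SU2 => g) 1 (ξ i) := by
  rw [lieMat_eq, mcLeft_apply, matDeriv_comp (I' := 𝓡 3) (g := fun g => g) mdifferentiableAt_id
    ((contMDiff_apply_Gpow (n := ∞) i).mdifferentiable (by simp) _),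
    ContinuousLinearMap.comp_apply, mfderiv_apply_Gpow]
  rfl

/-- The Lie algebra of `Gⁿ` is `𝔰𝔲(2)ⁿ`. -/
theorem exists_lieMat_eq {n : ℕ} {X : Fin n → Mat} (hX : ∀ i, X i ∈ su2) :
    ∃ ξ : TangentSpace (Ipow n) (1 : Gpow n), ∀ i, lieMat ξ i = X i := by
  choose u hu using fun i => exists_inv_mul_matDeriv 1 (hX i)
  exact ⟨u, fun i => (lieMat_eq_matDeriv _ i).trans (hu i)⟩

/-! ### Jets of maps, and the two-form of the moduli space -/

section JetOfMap

variable {E : Type*} [NormedAddCommGroup E] [NormedSpace ℝ E] {H : Type*} [TopologicalSpace H]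
  {I : ModelWithCorners ℝ E H} {M : Type*} [TopologicalSpace M] [ChartedSpace H M]

/-- The jet at `x` of a map `f : M → SU(2)`, with the two-form `0`. -/
def jet (c : ℝ) (I : ModelWithCorners ℝ E H) (f : M → SU2) (x : M) : Jet c (TangentSpace I x) :=
  ⟨f x, mcLeft I f x, 0⟩

variable {c : ℝ} {x : M}

@[simp] theorem jet_g (f : M → SU2) : (jet c I f x).g = f x := rfl
@[simp] theorem jet_θ (f : M → SU2) : (jet c I f x).θ = mcLeft I f x := rfl
@[simp] theorem jet_s (f : M → SU2) : (jet c I f x).s = 0 := rfl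

/-- The group element and the Maurer-Cartan form of a jet are those of the map `f` at `x`. -/
structure Represents (y : Jet c (TangentSpace I x)) (f : M → SU2) : Prop where
  diff : MatDiffAt I f x
  g_eq : y.g = f x
  θ_eq : y.θ = mcLeft I f x

namespace Represents

theorem jet {f : M → SU2} (hf : MatDiffAt I f x) : Represents (jet c I f x) f := ⟨hf, rfl, rfl⟩

variable {y z : Jet c (TangentSpace I x)} {f g : M → SU2}

theorem mul (hy : Represents y f) (hz : Represents z g) :
    Represents (y * z) fun q => f q * g q :=
  ⟨hy.diff.mul hz.diff, by rw [Jet.mul_g, hy.g_eq, hz.g_eq],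
    by rw [Jet.mul_θ, hy.θ_eq, hz.θ_eq, hz.g_eq, mcLeft_mul hy.diff hz.diff]⟩

theorem θbar_eq (hy : Represents y f) : y.θbar = mcRight I f x := by
  rw [Jet.θbar, hy.θ_eq, hy.g_eq, mcRight_eq]

theorem inv (hy : Represents y f) : Represents y⁻¹ fun q => (f q)⁻¹ :=
  ⟨hy.diff.inv, by rw [Jet.inv_g, hy.g_eq], by rw [Jet.inv_θ, hy.θbar_eq, mcLeft_inv hy.diff]⟩

theorem one : Represents (1 : Jet c (TangentSpace I x)) fun _ => 1 :=
  ⟨mdifferentiableAt_const, rfl, (mcLeft_const 1 x).symm⟩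

theorem take_ofFn {r : ℕ} {y : Fin r → Jet c (TangentSpace I x)} {f : Fin r → M → SU2}
    (h : ∀ i, Represents (y i) (f i)) (k : ℕ) :
    Represents ((List.ofFn y).take k).prod fun q => ((List.ofFn fun i => f i q).take k).prod := by
  induction k with
  | zero => simpa using one
  | succ k ih =>
    by_cases hk : k < r
    · have h1 := ih.mul (h ⟨k, hk⟩)
      rw [List.prod_take_succ _ _ (by simpa using hk)]
      have h2 : (fun q => ((List.ofFn fun i => f i q).take (k + 1)).prod) =
          fun q => ((List.ofFn fun i => f i q).take k).prod * f ⟨k, hk⟩ q := by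
        funext q
        rw [List.prod_take_succ _ _ (by simpa using hk), List.getElem_ofFn]
      rw [h2, List.getElem_ofFn]
      exact h1
    · have h2 : ((List.ofFn y).take (k + 1)) = (List.ofFn y).take k := by
        rw [List.take_of_length_le (by simp; omega), List.take_of_length_le (by simp; omega)]
      have h3 : ∀ q, ((List.ofFn fun i => f i q).take (k + 1)) =
          (List.ofFn fun i => f i q).take k := fun q => by
        rw [List.take_of_length_le (by simp; omega), List.take_of_length_le (by simp; omega)]
      simp only [h2, h3]
      exact ih

theorem prod_ofFn {r : ℕ} {y : Fin r → Jet c (TangentSpace I x)} {f : Fin r → M → SU2}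
    (h : ∀ i, Represents (y i) (f i)) :
    Represents (List.ofFn y).prod fun q => (List.ofFn fun i => f i q).prod := by
  have h1 := take_ofFn h r
  rw [List.take_of_length_le (by simp)] at h1
  simp_rw [List.take_of_length_le (List.length_ofFn (f := fun i => f i _)).le] at h1
  exact h1

end Represents

end JetOfMap

namespace ExtModuli

variable {r : ℕ} {c : ℝ}

theorem matDiffAt_a (i : Fin r) (p : ExtModuli r) : MatDiffAt (model r) (fun q => q.a i) p :=
  matDiffAt_of_contMDiff (contMDiff_a i)

theorem matDiffAt_b (j : Fin (r + 1)) (p : ExtModuli r) :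
    MatDiffAt (model r) (fun q => q.b j) p :=
  matDiffAt_of_contMDiff (contMDiff_b j)

/-- The word `∏ a_i b_i a_i⁻¹` in the jets of the holonomies. -/
def jetWord (c : ℝ) (p : ExtModuli r) : List (Jet c (TangentSpace (model r) p)) :=
  Jet.word (fun i => jet c (model r) (fun q => q.a i) p)
    (fun i => jet c (model r) (fun q => q.b i.succ) p)

theorem represents_double (i : Fin r) (p : ExtModuli r) :
    Represents (jet c (model r) (fun q => q.a i) p * jet c (model r) (fun q => q.b i.succ) p *
      (jet c (model r) (fun q => q.a i) p)⁻¹) (doubleMoment i) :=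
  ((Represents.jet (matDiffAt_a i p)).mul (Represents.jet (matDiffAt_b i.succ p))).mul
    (Represents.jet (matDiffAt_a i p)).inv

theorem double_s (i : Fin r) (p : ExtModuli r) :
    (jet c (model r) (fun q => q.a i) p * jet c (model r) (fun q => q.b i.succ) p *
      (jet c (model r) (fun q => q.a i) p)⁻¹).s = doubleForm c i p := by
  ext v
  have h : ∀ α : TangentSpace (model r) p →L[ℝ] Mat,
      adForm (model r) (fun q : ExtModuli r => q.b i.succ) p α = (Ad (p.b i.succ)).comp α :=
    fun _ => rfl
  simp only [doubleForm, h]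
  simp [wedge_apply, Jet.θbar_apply, mcRight_eq, pairing_add_right, pairing_add_left,
    pairing_neg_right]
  generalize mcLeft (model r) (fun q : ExtModuli r => q.a i) p (v 0) = X
  generalize mcLeft (model r) (fun q : ExtModuli r => q.a i) p (v 1) = X'
  rw [pairing_Ad c _ X X', pairing_Ad c _ X' X, inv_inv, pairing_comm c (Ad _ X') X,
    pairing_comm c (Ad _ X) X', pairing_comm c _ X, pairing_comm c _ X']
  ring

/-- The two-form of the extended moduli space is the two-form of the word in the jets. -/
theorem form_eq (p : ExtModuli r) : form c r p = (jetWord c p).prod.s := by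
  rw [jetWord, Jet.word, Jet.prod_ofFn_s]
  refine Finset.sum_congr rfl fun i _ => ?_
  rw [double_s, (represents_double i p).θbar_eq,
    (Represents.take_ofFn (fun i => represents_double i p) i).θ_eq]
  rfl

/-- By the relation between the holonomies, the word represents `b_1⁻¹`, the first component of the
moment map. -/
theorem represents_jetWord (p : ExtModuli r) :
    Represents (jetWord c p).prod fun q => (q.b 0)⁻¹ := by
  simp only [b_zero, inv_inv]
  exact Represents.prod_ofFn fun i => represents_double i p

end ExtModuli

/-! ### Invariance and the moment map condition -/

section Pullback

variable {V W : Type*} [AddCommGroup V] [Module ℝ V] [TopologicalSpace V]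
  [AddCommGroup W] [Module ℝ W] [TopologicalSpace W] {c : ℝ}

/-- The pull-back of jets under a linear map. -/
def Jet.map (L : V →L[ℝ] W) : Jet c W →* Jet c V where
  toFun x := ⟨x.g, x.θ.comp L, x.s.compContinuousLinearMap L⟩
  map_one' := by
    ext v <;> simp
  map_mul' x y := by
    ext v <;> simp [wedge_apply, Jet.θbar_apply]

theorem Jet.map_word {r : ℕ} (L : V →L[ℝ] W) (a b : Fin r → Jet c W) :
    (Jet.word a b).map (Jet.map L) =
      Jet.word (fun i => Jet.map L (a i)) (fun i => Jet.map L (b i)) := by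
  simp only [Jet.word, List.map_ofFn]
  congr 1

end Pullback

section Naturality

variable {E : Type*} [NormedAddCommGroup E] [NormedSpace ℝ E] {H : Type*} [TopologicalSpace H]
  {I : ModelWithCorners ℝ E H} {M : Type*} [TopologicalSpace M] [ChartedSpace H M]
  {E' : Type*} [NormedAddCommGroup E'] [NormedSpace ℝ E'] {H' : Type*} [TopologicalSpace H']
  {I' : ModelWithCorners ℝ E' H'} {M' : Type*} [TopologicalSpace M'] [ChartedSpace H' M'] {c : ℝ}

theorem map_jet {g : M' → SU2} {f : M → M'} {x : M} (hg : MDifferentiableAt I' (𝓡 3) g (f x))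
    (hf : MDifferentiableAt I I' f x) :
    Jet.map (mfderiv I I' f x) (jet c I' g (f x)) = jet c I (fun y => g (f y)) x := by
  ext v
  · rfl
  · exact (DFunLike.congr_fun (mcLeft_comp hg hf) v).symm ▸ rfl
  · rfl

/-- The two-form of the extended moduli space is natural: its pull-back is the two-form of the
word in the jets of the pulled back holonomies. -/
theorem pullback_form {r : ℕ} {f : M → ExtModuli r} {x : M}
    (hf : MDifferentiableAt I (ExtModuli.model r) f x) :
    (ExtModuli.form c r).pullback I (ExtModuli.model r) f x =
      (Jet.word (fun i => jet c I (fun y => (f y).a i) x)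
        (fun i => jet c I (fun y => (f y).b i.succ) x)).prod.s := by
  rw [TwoForm.pullback, ExtModuli.form_eq]
  have h := map_list_prod (Jet.map (c := c) (mfderiv I (ExtModuli.model r) f x))
    (ExtModuli.jetWord c (f x))
  rw [ExtModuli.jetWord, Jet.map_word] at h
  have h1 := congrArg Jet.s h
  have ha : ∀ i, Jet.map (mfderiv I (ExtModuli.model r) f x)
      (jet c (ExtModuli.model r) (fun q : ExtModuli r => q.a i) (f x)) = _ := fun i =>
    map_jet ((ExtModuli.contMDiff_a i).mdifferentiable (by simp) _) hf
  have hb : ∀ i : Fin r, Jet.map (mfderiv I (ExtModuli.model r) f x)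
      (jet c (ExtModuli.model r) (fun q : ExtModuli r => q.b i.succ) (f x)) = _ := fun i =>
    map_jet ((ExtModuli.contMDiff_b i.succ).mdifferentiable (by simp) _) hf
  simp only [ha, hb] at h1
  exact h1

/-- Multiplying a map by constants from both sides multiplies its jet by theirs: the cocycles
vanish, as the Maurer-Cartan form of a constant does. -/
theorem jet_mul_const {f : M → SU2} {x : M} (hf : MatDiffAt I f x) (σ τ : SU2) :
    jet c I (fun y => σ * f y * τ⁻¹) x =
      jet c I (fun _ => σ) x * jet c I f x * (jet c I (fun _ => τ) x)⁻¹ := by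
  have h1 : MatDiffAt I (fun _ : M => σ) x := mdifferentiableAt_const
  have h2 : MatDiffAt I (fun _ : M => τ) x := mdifferentiableAt_const
  have h3 : mcLeft I (fun y => σ * f y * τ⁻¹) x = _ := mcLeft_mul (h1.mul hf) h2.inv
  rw [mcLeft_mul h1 hf, mcLeft_inv h2, mcRight_eq, mcLeft_const, mcLeft_const] at h3
  ext v
  · rfl
  · simp [h3, mcLeft_const, Jet.θbar]
  · simp [wedge_apply, mcLeft_const, Jet.θbar_apply]

end Naturality

namespace ExtModuli

variable {r : ℕ} {c : ℝ}

/-- A shortcut: without it, the search for this instance is very long. -/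
instance : SMul (Gpow (r + 1)) (ExtModuli r) :=
  (inferInstance : MulAction (Gpow (r + 1)) (ExtModuli r)).toSemigroupAction.toSMul

theorem contMDiff_smul :
    ContMDiff ((Ipow (r + 1)).prod (model r)) (model r) ∞
      fun p : Gpow (r + 1) × ExtModuli r => p.1 • p.2 := by
  have hσ : ∀ j, ContMDiff ((Ipow (r + 1)).prod (model r)) (𝓡 3) ∞
      fun p : Gpow (r + 1) × ExtModuli r => p.1 j := fun j =>
    (contMDiff_apply_Gpow j).comp contMDiff_fst
  refine contMDiff_of_a_b (fun i => ?_) (fun i => ?_)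
  · exact contMDiff_mul_SU2 (contMDiff_mul_SU2 (hσ 0) ((contMDiff_a i).comp contMDiff_snd))
      (contMDiff_inv_SU2 (hσ i.succ))
  · exact contMDiff_mul_SU2 (contMDiff_mul_SU2 (hσ i.succ)
      ((contMDiff_b i.succ).comp contMDiff_snd)) (contMDiff_inv_SU2 (hσ i.succ))

theorem contMDiff_const_smul (σ : Gpow (r + 1)) :
    ContMDiff (model r) (model r) ∞ fun p : ExtModuli r => σ • p := by
  refine contMDiff_of_a_b (fun i => ?_) (fun i => ?_)
  · exact contMDiff_mul_SU2 (contMDiff_mul_SU2 contMDiff_const (contMDiff_a i)) contMDiff_const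
  · exact contMDiff_mul_SU2 (contMDiff_mul_SU2 contMDiff_const (contMDiff_b i.succ))
      contMDiff_const

theorem contMDiff_smul_const (p : ExtModuli r) :
    ContMDiff (Ipow (r + 1)) (model r) ∞ fun σ : Gpow (r + 1) => σ • p := by
  refine contMDiff_of_a_b (fun i => ?_) (fun i => ?_)
  · exact contMDiff_mul_SU2 (contMDiff_mul_SU2 (contMDiff_apply_Gpow 0) contMDiff_const)
      (contMDiff_inv_SU2 (contMDiff_apply_Gpow i.succ))
  · exact contMDiff_mul_SU2 (contMDiff_mul_SU2 (contMDiff_apply_Gpow i.succ) contMDiff_const)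
      (contMDiff_inv_SU2 (contMDiff_apply_Gpow i.succ))

/-- Acting by `σ` conjugates the word by the jet of the constant `σ_1`, which does not change the
two-form. -/
theorem form_invariant (σ : Gpow (r + 1)) :
    (form c r).pullback (model r) (model r) (fun p : ExtModuli r => σ • p) = form c r := by
  funext p
  rw [pullback_form ((contMDiff_const_smul σ).mdifferentiable (by simp) p), form_eq, jetWord]
  have h : Jet.word (fun i => jet c (model r) (fun q : ExtModuli r => (σ • q).a i) p)
      (fun i => jet c (model r) (fun q : ExtModuli r => (σ • q).b i.succ) p) =
      (Jet.word (fun i => jet c (model r) (fun q : ExtModuli r => q.a i) p)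
        (fun i => jet c (model r) (fun q : ExtModuli r => q.b i.succ) p)).map
        (MulAut.conj (jet c (model r) (fun _ : ExtModuli r => σ 0) p)) := by
    simp only [Jet.word, List.map_ofFn]
    congr 1
    funext i
    simp only [smul_a, smul_b, jet_mul_const (matDiffAt_a i p), jet_mul_const (matDiffAt_b _ p),
      Function.comp_apply, MulAut.conj_apply]
    group
  rw [h, ← map_list_prod, MulAut.conj_apply]
  ext v
  simp [wedge_apply, mcLeft_const, Jet.θbar_apply]

/-- The infinitesimal action of `ξ` moves a map `f` with `f (σ • p) = σ_i f(p) σ_j⁻¹` like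
`e^{tξ_i} f e^{-tξ_j}`. -/
theorem mcLeft_infAction {f : ExtModuli r → SU2} (hf : ContMDiff (model r) (𝓡 3) ∞ f)
    {i j : Fin (r + 1)} (h : ∀ (σ : Gpow (r + 1)) p, f (σ • p) = σ i * f p * (σ j)⁻¹)
    (ξ : TangentSpace (Ipow (r + 1)) (1 : Gpow (r + 1))) (p : ExtModuli r) :
    mcLeft (model r) f p (infAction (model r) ξ p) =
      Ad (f p)⁻¹ (lieMat ξ i) - lieMat ξ j := by
  have h1 : mcLeft (model r) f ((1 : Gpow (r + 1)) • p) (mfderiv (Ipow (r + 1)) (model r)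
      (fun σ : Gpow (r + 1) => σ • p) 1 ξ) = mcLeft (Ipow (r + 1)) (fun σ => f (σ • p)) 1 ξ :=
    (DFunLike.congr_fun (mcLeft_comp (hf.mdifferentiable (by simp) _)
      ((contMDiff_smul_const p).mdifferentiable (by simp) _)) ξ).symm
  have h2 : mcLeft (model r) f p (infAction (model r) ξ p) = mcLeft (model r) f
      ((1 : Gpow (r + 1)) • p) (mfderiv (Ipow (r + 1)) (model r)
      (fun σ : Gpow (r + 1) => σ • p) 1 ξ) := by
    -- both sides are at the same point, but `1 • p` and `p` are not syntactically equal
    have h3 : ∀ q, q = p → ∀ v : (Fin r → EuclideanSpace ℝ (Fin 3)) ×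
        (Fin r → EuclideanSpace ℝ (Fin 3)), mcLeft (model r) f p v = mcLeft (model r) f q v := by
      rintro q rfl v
      rfl
    exact h3 _ (one_smul _ p) _
  have hσ : ∀ j, MatDiffAt (Ipow (r + 1)) (fun σ : Gpow (r + 1) => σ j) 1 := fun j =>
    matDiffAt_of_contMDiff (contMDiff_apply_Gpow j)
  have hc : MatDiffAt (Ipow (r + 1)) (fun σ : Gpow (r + 1) => f p) 1 := mdifferentiableAt_const
  have h4 := DFunLike.congr_fun (mcLeft_mul ((hσ i).mul hc) (hσ j).inv) ξ
  rw [mcLeft_mul (hσ i) hc, mcLeft_inv (hσ j), mcRight_eq, mcLeft_const] at h4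
  rw [h2, h1]
  simp only [h]
  rw [h4, lieMat_eq, lieMat_eq]
  simp [sub_eq_add_neg]

theorem equivariant_moment (σ : Gpow (r + 1)) (p : ExtModuli r) :
    moment (σ • p) = σ * moment p * σ⁻¹ := by
  funext j
  simp [moment, mul_assoc]

theorem moment_condition (ξ : TangentSpace (Ipow (r + 1)) (1 : Gpow (r + 1))) (p : ExtModuli r)
    (w : TangentSpace (model r) p) :
    form c r p ![infAction (model r) ξ p, w] = (1 / 2 : ℝ) * ∑ j, pairing c
      (mcLeft (model r) (fun q => moment q j) p w + mcRight (model r) (fun q => moment q j) p w)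
      (lieMat ξ j) := by
  have h := Jet.acts_prod_word (v := infAction (model r) ξ p) (w := w) (ξ := lieMat ξ 0)
    (η := fun i => lieMat ξ i.succ)
    (a := fun i => jet c (model r) (fun q : ExtModuli r => q.a i) p)
    (b := fun i => jet c (model r) (fun q : ExtModuli r => q.b i.succ) p)
    (fun i => mcLeft_infAction (contMDiff_a i) (fun σ q => rfl) ξ p)
    (fun i => mcLeft_infAction (contMDiff_b i.succ) (fun σ q => rfl) ξ p) (fun i => rfl)
  have hX := represents_jetWord (c := c) p
  rw [form_eq, jetWord, h.s_eq, Fin.sum_univ_succ]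
  rw [jetWord] at hX
  rw [hX.θbar_eq, hX.θ_eq]
  have h1 : ∀ j, mcLeft (model r) (fun q => moment q j) p w =
      -mcRight (model r) (fun q : ExtModuli r => q.b j) p w := fun j =>
    DFunLike.congr_fun (mcLeft_inv (matDiffAt_b j p)) w
  have h2 : ∀ j, mcRight (model r) (fun q => moment q j) p w =
      -mcLeft (model r) (fun q : ExtModuli r => q.b j) p w := by
    intro j
    rw [mcRight_eq, ContinuousLinearMap.comp_apply, h1, mcRight_eq]
    simp [moment]
  have h3 : ∀ i : Fin r, (jet c (model r) (fun q : ExtModuli r => q.b i.succ) p).θbar =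
    mcRight (model r) (fun q : ExtModuli r => q.b i.succ) p := fun i =>
      (Represents.jet (matDiffAt_b i.succ p)).θbar_eq
  have h4 : ∀ i : Fin r, pairing c (mcLeft (model r) (fun q => moment q i.succ) p w +
      mcRight (model r) (fun q => moment q i.succ) p w) (lieMat ξ i.succ) =
      -pairing c (mcLeft (model r) (fun q : ExtModuli r => q.b i.succ) p w +
        mcRight (model r) (fun q : ExtModuli r => q.b i.succ) p w) (lieMat ξ i.succ) := by
    intro i
    rw [h1, h2, ← neg_add, pairing_neg_left, add_comm]
  simp only [h3, h4, jet_θ, Finset.sum_neg_distrib, pairing_add_left, pairing_comm c (lieMat ξ 0)]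
  have h5 : mcLeft (model r) (fun q => moment q 0) p w =
    mcLeft (model r) (fun q : ExtModuli r => (q.b 0)⁻¹) p w := rfl
  have h6 : mcRight (model r) (fun q => moment q 0) p w =
    mcRight (model r) (fun q : ExtModuli r => (q.b 0)⁻¹) p w := rfl
  rw [h5, h6]
  ring

end ExtModuli

/-! ### The differential of the two-form -/

section WordForm

variable {E : Type*} [NormedAddCommGroup E] [NormedSpace ℝ E] {c : ℝ} {r : ℕ}

/-- The two-form of the word `∏ a_i b_i a_i⁻¹` in `SU(2)`-valued maps on a normed space, as an
explicit sum of cocycles. -/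
def wordFormE (c : ℝ) (a b : Fin r → E → SU2) (z : E) : E [⋀^Fin 2]→L[ℝ] ℝ :=
  ∑ i, (cocycleE c (a i) (b i) z +
    cocycleE c (fun y => a i y * b i y) (fun y => (a i y)⁻¹) z +
    cocycleE c (fun y => ((List.ofFn fun j => a j y * b j y * (a j y)⁻¹).take i).prod)
      (fun y => a i y * b i y * (a i y)⁻¹) z)

theorem prod_word_jet_s {a b : Fin r → E → SU2} {z : E}
    (ha : ∀ i, MatDiffAt 𝓘(ℝ, E) (a i) z) (hb : ∀ i, MatDiffAt 𝓘(ℝ, E) (b i) z) :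
    (Jet.word (fun i => jet c 𝓘(ℝ, E) (a i) z) (fun i => jet c 𝓘(ℝ, E) (b i) z)).prod.s =
      wordFormE c a b z := by
  have h1 := fun i => (Represents.jet (c := c) (ha i)).mul (Represents.jet (hb i))
  have h2 := fun i => (h1 i).mul (Represents.jet (ha i)).inv
  rw [Jet.word, Jet.prod_ofFn_s]
  refine Finset.sum_congr rfl fun i _ => ?_
  rw [(h2 i).θbar_eq, (Represents.take_ofFn h2 i).θ_eq, Jet.mul_s, Jet.mul_s,
    (h1 i).θ_eq, (Represents.jet (ha i)).inv.θbar_eq, (Represents.jet (hb i)).θbar_eq]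
  simp only [jet_s, Jet.inv_s, neg_zero, add_zero, zero_add, jet_θ]
  rfl

theorem contDiffAt_mul_SU2 {f g : E → SU2} {y : E}
    (hf : ContDiffAt ℝ ∞ (fun z => (f z : Mat)) y) (hg : ContDiffAt ℝ ∞ (fun z => (g z : Mat)) y) :
    ContDiffAt ℝ ∞ (fun z => ((f z * g z : SU2) : Mat)) y := by
  have h : (fun z => ((f z * g z : SU2) : Mat)) = fun z => (f z : Mat) * (g z : Mat) := rfl
  rw [h]
  exact hf.mul hg

theorem contDiffAt_list_prod_SU2 {l : List (E → SU2)} {y : E}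
    (h : ∀ f ∈ l, ContDiffAt ℝ ∞ (fun z => (f z : Mat)) y) :
    ContDiffAt ℝ ∞ (fun z => (((l.map fun f => f z).prod : SU2) : Mat)) y := by
  induction l with
  | nil => simpa using contDiffAt_const
  | cons f l ih =>
    simp only [List.map_cons, List.prod_cons]
    exact contDiffAt_mul_SU2 (h f (by simp)) (ih fun g hg => h g (by simp [hg]))

theorem contDiffAt_take_ofFn_SU2 {f : Fin r → E → SU2} {y : E}
    (h : ∀ i, ContDiffAt ℝ ∞ (fun z => (f i z : Mat)) y) (k : ℕ) :
    ContDiffAt ℝ ∞ (fun z => ((((List.ofFn fun i => f i z).take k).prod : SU2) : Mat)) y := by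
  have h1 := contDiffAt_list_prod_SU2 (l := (List.ofFn f).take k) (y := y) (by
    intro g hg
    obtain ⟨i, rfl⟩ := List.mem_ofFn.1 (List.mem_of_mem_take hg)
    exact h i)
  simp only [List.map_take, List.map_ofFn] at h1
  exact h1

theorem contDiffAt_wordFormE {a b : Fin r → E → SU2} {y : E}
    (ha : ∀ i, ContDiffAt ℝ ∞ (fun z => (a i z : Mat)) y)
    (hb : ∀ i, ContDiffAt ℝ ∞ (fun z => (b i z : Mat)) y) :
    ContDiffAt ℝ ∞ (wordFormE c a b) y := by
  have h1 := fun i => contDiffAt_mul_SU2 (ha i) (hb i)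
  have h2 := fun i => contDiffAt_mul_SU2 (h1 i) (contDiffAt_star_SU2 (ha i))
  exact ContDiffAt.sum fun i _ => ((contDiffAt_cocycleE c (ha i) (hb i)).add
    (contDiffAt_cocycleE c (h1 i) (contDiffAt_star_SU2 (ha i)))).add
      (contDiffAt_cocycleE c (contDiffAt_take_ofFn_SU2 h2 i) (h2 i))

theorem extDeriv_finset_sum {ι : Type*} (s : Finset ι) {τ : ι → E → E [⋀^Fin 2]→L[ℝ] ℝ} {y : E}
    (h : ∀ i ∈ s, DifferentiableAt ℝ (τ i) y) :
    extDeriv (fun z => ∑ i ∈ s, τ i z) y = ∑ i ∈ s, extDeriv (τ i) y := by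
  simp only [extDeriv]
  rw [fderiv_fun_sum h]
  exact map_sum (ContinuousAlternatingMap.alternatizeUncurryFinCLM ℝ E ℝ) _ s

/-- The pull-back of `χ` under `f : E → SU(2)`. -/
def chiE (c : ℝ) (f : E → SU2) (y u v w : E) : ℝ :=
  chi c (mcLeftE f y u) (mcLeftE f y v) (mcLeftE f y w)

/-- The exterior derivative of the two-form of a word: by the Polyakov-Wiegmann identity the
contributions of the `a_i` cancel and those of the partial products telescope. -/
theorem extDeriv_wordFormE {a b : Fin r → E → SU2} {y : E}
    (ha : ∀ i, ContDiffAt ℝ ∞ (fun z => (a i z : Mat)) y)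
    (hb : ∀ i, ContDiffAt ℝ ∞ (fun z => (b i z : Mat)) y) (u v w : E) :
    extDeriv (wordFormE c a b) y ![u, v, w] = ∑ i, chiE c (b i) y u v w -
      chiE c (fun z => (List.ofFn fun i => a i z * b i z * (a i z)⁻¹).prod) y u v w := by
  have h1 := fun i => contDiffAt_mul_SU2 (ha i) (hb i)
  have h2 := fun i => contDiffAt_mul_SU2 (h1 i) (contDiffAt_star_SU2 (ha i))
  have hM := contDiffAt_take_ofFn_SU2 h2
  set M : ℕ → E → SU2 := fun k z =>
    ((List.ofFn fun j => a j z * b j z * (a j z)⁻¹).take k).prod with hMdef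
  have hd1 := fun i => (contDiffAt_cocycleE c (ha i) (hb i)).differentiableAt (by simp)
  have hd2 := fun i => (contDiffAt_cocycleE c (h1 i)
    (contDiffAt_star_SU2 (ha i))).differentiableAt (by simp)
  have hd3 := fun i : Fin r => (contDiffAt_cocycleE c (hM i) (h2 i)).differentiableAt (by simp)
  have hs : ∀ i : Fin r, extDeriv (fun z => cocycleE c (a i) (b i) z +
      cocycleE c (fun y => a i y * b i y) (fun y => (a i y)⁻¹) z +
      cocycleE c (M i) (fun y => a i y * b i y * (a i y)⁻¹) z) y ![u, v, w] =
      chiE c (b i) y u v w + (chiE c (M i) y u v w - chiE c (M (i + 1)) y u v w) := by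
    intro i
    have hM1 : M (i + 1) = fun z => M i z * (a i z * b i z * (a i z)⁻¹) := by
      funext z
      simp only [hMdef]
      rw [List.prod_take_succ _ _ (by simp), List.getElem_ofFn]
    rw [extDeriv_fun_add ((hd1 i).fun_add (hd2 i)) (hd3 i), extDeriv_fun_add (hd1 i) (hd2 i),
      ContinuousAlternatingMap.add_apply, ContinuousAlternatingMap.add_apply,
      extDeriv_cocycleE c (ha i) (hb i), extDeriv_cocycleE c (h1 i) (contDiffAt_star_SU2 (ha i)),
      extDeriv_cocycleE c (hM i) (h2 i), chi_inv c (ha i), hM1]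
    simp only [chiE]
    ring
  have h0 : chiE c (M 0) y u v w = 0 := by
    have hz : ∀ u, mcLeftE (M 0) y u = 0 := fun u => by
      have : M 0 = fun _ => 1 := by funext z; simp [hMdef]
      rw [this]
      exact DFunLike.congr_fun (mcLeft_const (I := 𝓘(ℝ, E)) 1 y) u
    simp [chiE, chi_eq, hz]
  have hr : M r = fun z => (List.ofFn fun i => a i z * b i z * (a i z)⁻¹).prod := by
    funext z
    simp only [hMdef]
    rw [List.take_of_length_le (by simp)]
  have he : extDeriv (wordFormE c a b) y = _ := extDeriv_finset_sum Finset.univ fun i _ =>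
    ((hd1 i).fun_add (hd2 i)).fun_add (hd3 i)
  rw [he, ContinuousAlternatingMap.sum_apply, Finset.sum_congr rfl fun i _ => hs i,
    Finset.sum_add_distrib,
    Fin.sum_univ_eq_sum_range fun k => chiE c (M k) y u v w - chiE c (M (k + 1)) y u v w,
    Finset.sum_range_sub', h0, hr]
  ring

end WordForm

section Charts

variable {E : Type*} [NormedAddCommGroup E] [NormedSpace ℝ E] {H : Type*} [TopologicalSpace H]
  {I : ModelWithCorners ℝ E H} {M : Type*} [TopologicalSpace M] [ChartedSpace H M]

theorem mcLeft_congr {f g : M → SU2} {x : M} (h : f =ᶠ[nhds x] g) (v : TangentSpace I x) :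
    mcLeft I f x v = mcLeft I g x v := by
  have h1 : matDeriv I f x = matDeriv I g x :=
    (h.fun_comp fun g : SU2 => (g : Mat)).mfderiv_eq
  rw [mcLeft_apply, mcLeft_apply, h1, h.eq_of_nhds]

variable [I.Boundaryless] [IsManifold I ∞ M]

theorem contMDiffAt_symm_extChartAt {x : M} {y : E} (hy : y ∈ (extChartAt I x).target) :
    ContMDiffAt 𝓘(ℝ, E) I ∞ (extChartAt I x).symm y :=
  (contMDiffOn_extChartAt_symm x).contMDiffAt ((isOpen_extChartAt_target x).mem_nhds hy)

/-- The Maurer-Cartan form of a map, computed in a chart. -/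
theorem mcLeft_eq_mcLeftE {f : M → SU2} (hf : ContMDiff I (𝓡 3) ∞ f) (x : M)
    (v : TangentSpace I x) : mcLeftE (fun z => f ((extChartAt I x).symm z)) (extChartAt I x x)
      (mfderiv I 𝓘(ℝ, E) (extChartAt I x) x v) = mcLeft I f x v := by
  have hg : ContMDiffAt 𝓘(ℝ, E) (𝓡 3) ∞ (fun z => f ((extChartAt I x).symm z))
      (extChartAt I x x) :=
    hf.contMDiffAt.comp _ (contMDiffAt_symm_extChartAt (mem_extChartAt_target x))
  have h := mcLeft_comp (I := I) (hg.mdifferentiableAt (by simp))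
    ((contMDiffAt_extChartAt (n := ∞)).mdifferentiableAt (by simp))
  have h2 : (fun y => f ((extChartAt I x).symm (extChartAt I x y))) =ᶠ[nhds x] f := by
    filter_upwards [extChartAt_source_mem_nhds (I := I) x] with y hy
    rw [(extChartAt I x).left_inv hy]
  rw [← mcLeft_congr h2 v]
  exact (DFunLike.congr_fun h v).symm

end Charts

instance (r : ℕ) : (Ipow r).Boundaryless where
  range_eq_univ := Set.range_eq_univ.2 fun y => ⟨y, rfl⟩

namespace ExtModuli

variable {r : ℕ} {c : ℝ}

theorem contDiffAt_comp_symm_extChartAt {f : ExtModuli r → SU2}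
    (hf : ContMDiff (model r) (𝓡 3) ∞ f) {x : ExtModuli r}
    {y : (Fin r → EuclideanSpace ℝ (Fin 3)) × (Fin r → EuclideanSpace ℝ (Fin 3))}
    (hy : y ∈ (extChartAt (model r) x).target) :
    ContDiffAt ℝ ∞ (fun z => (f ((extChartAt (model r) x).symm z) : Mat)) y :=
  contMDiffAt_iff_contDiffAt.1 ((contMDiff_coe_SU2.comp hf).contMDiffAt.comp y
    (contMDiffAt_symm_extChartAt hy))

/-- In a chart, the two-form is the one of the word in the holonomies. -/
theorem form_inChart (x : ExtModuli r)
    {y : (Fin r → EuclideanSpace ℝ (Fin 3)) × (Fin r → EuclideanSpace ℝ (Fin 3))}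
    (hy : y ∈ (extChartAt (model r) x).target) :
    (form c r).inChart (model r) x y =
      wordFormE c (fun i z => ((extChartAt (model r) x).symm z).a i)
        (fun i z => ((extChartAt (model r) x).symm z).b i.succ) y := by
  have h := (contMDiffAt_symm_extChartAt hy).mdifferentiableAt (by simp)
  refine (pullback_form h).trans (prod_word_jet_s (fun i => ?_) (fun i => ?_))
  · exact (matDiffAt_a i _).comp y h
  · exact (matDiffAt_b i.succ _).comp y h

theorem isSmooth_form : (form c r).IsSmooth (model r) := by
  intro x y hy
  refine ContDiffWithinAt.congr (ContDiffAt.contDiffWithinAt (contDiffAt_wordFormE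
    (fun i => contDiffAt_comp_symm_extChartAt (contMDiff_a i) hy)
    fun i => contDiffAt_comp_symm_extChartAt (contMDiff_b i.succ) hy))
    (fun z hz => form_inChart x hz) (form_inChart x hy)

theorem deriv_form (x : ExtModuli r) (u v w : TangentSpace (model r) x) :
    (form c r).extDeriv (model r) x ![u, v, w] = -cartanForm c (model r) moment x u v w := by
  have hy := mem_extChartAt_target (I := model r) x
  have h1 : (form c r).inChart (model r) x =ᶠ[nhds (extChartAt (model r) x x)] _ :=
    Filter.eventuallyEq_of_mem ((isOpen_extChartAt_target x).mem_nhds hy)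
      fun z hz => form_inChart (c := c) x hz
  obtain ⟨L, hL⟩ : ∃ L : TangentSpace (model r) x →
      (Fin r → EuclideanSpace ℝ (Fin 3)) × (Fin r → EuclideanSpace ℝ (Fin 3)),
      ∀ u, mfderiv (model r) 𝓘(ℝ, (Fin r → EuclideanSpace ℝ (Fin 3)) ×
        (Fin r → EuclideanSpace ℝ (Fin 3))) (extChartAt (model r) x) x u = L u :=
    ⟨_, fun _ => rfl⟩
  have h2 : (form c r).extDeriv (model r) x ![u, v, w] =
      extDeriv ((form c r).inChart (model r) x) (extChartAt (model r) x x)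
        ![L u, L v, L w] := by
    refine congrArg (extDeriv ((form c r).inChart (model r) x) (extChartAt (model r) x x)) ?_
    ext1 i
    fin_cases i
    exacts [hL u, hL v, hL w]
  have hθ : ∀ {f : ExtModuli r → SU2}, ContMDiff (model r) (𝓡 3) ∞ f → ∀ u,
      mcLeftE (fun z => f ((extChartAt (model r) x).symm z)) (extChartAt (model r) x x) (L u) =
        mcLeft (model r) f x u := fun hf u => by
    rw [← mcLeft_eq_mcLeftE hf x u, hL u]
  have hb : ∀ j : Fin (r + 1), chiE c (fun z => ((extChartAt (model r) x).symm z).b j)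
      (extChartAt (model r) x x) (L u) (L v) (L w) =
      -chi c (mcLeft (model r) (fun p => moment p j) x u)
        (mcLeft (model r) (fun p => moment p j) x v)
        (mcLeft (model r) (fun p => moment p j) x w) := by
    intro j
    have h := chi_inv c (contDiffAt_comp_symm_extChartAt (contMDiff_inv_SU2 (contMDiff_b j)) hy)
      (L u) (L v) (L w)
    simp only [inv_inv] at h
    refine h.trans ?_
    rw [hθ (contMDiff_inv_SU2 (contMDiff_b j)), hθ (contMDiff_inv_SU2 (contMDiff_b j)),
      hθ (contMDiff_inv_SU2 (contMDiff_b j))]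
    rfl
  rw [h2, h1.extDeriv_eq, extDeriv_wordFormE
    (fun i => contDiffAt_comp_symm_extChartAt (contMDiff_a i) hy)
    fun i => contDiffAt_comp_symm_extChartAt (contMDiff_b i.succ) hy]
  -- the word is `b_1⁻¹`, so that its term has the same shape as those of the other `b_j`
  have h3 : (fun z => (List.ofFn fun i => ((extChartAt (model r) x).symm z).a i *
      ((extChartAt (model r) x).symm z).b i.succ *
      (((extChartAt (model r) x).symm z).a i)⁻¹).prod) =
      fun z => (((extChartAt (model r) x).symm z).b 0)⁻¹ := by
    funext z
    rw [b_zero, inv_inv]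
    rfl
  have h4 : chiE c (fun z => (((extChartAt (model r) x).symm z).b 0)⁻¹)
      (extChartAt (model r) x x) (L u) (L v) (L w) = -chiE c _ _ _ _ _ :=
    chi_inv c (contDiffAt_comp_symm_extChartAt (contMDiff_b 0) hy) (L u) (L v) (L w)
  rw [h3, h4, sub_neg_eq_add, add_comm, ← Fin.sum_univ_succ (fun j : Fin (r + 1) =>
    chiE c (fun z => ((extChartAt (model r) x).symm z).b j)
      (extChartAt (model r) x x) (L u) (L v) (L w)), Finset.sum_congr rfl fun j _ => hb j,
    Finset.sum_neg_distrib]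
  rfl

end ExtModuli

/-! ### The kernel of the two-form -/

theorem twoForm_sub_left {V : Type*} [AddCommGroup V] [Module ℝ V] [TopologicalSpace V]
    (τ : V [⋀^Fin 2]→L[ℝ] ℝ) (u v w : V) : τ ![u - v, w] = τ ![u, w] - τ ![v, w] := by
  have h := τ.toAlternatingMap.map_update_sub ![u, w] 0 u v
  have e : ∀ x : V, Function.update ![u, w] 0 x = ![x, w] := fun x => by
    ext i
    fin_cases i <;> simp
  rw [e, e, e] at h
  exact h

namespace ExtModuli

variable {r : ℕ} {c : ℝ}

theorem mcLeft_moment_infAction (ξ : TangentSpace (Ipow (r + 1)) (1 : Gpow (r + 1)))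
    (p : ExtModuli r) (j : Fin (r + 1)) :
    mcLeft (model r) (fun q => moment q j) p (infAction (model r) ξ p) =
      Ad (moment p j)⁻¹ (lieMat ξ j) - lieMat ξ j :=
  mcLeft_infAction (f := fun q => moment q j) (contMDiff_inv_SU2 (contMDiff_b j))
    (fun σ q => by rw [equivariant_moment]; rfl) ξ p

/-- The two-form is nondegenerate on the kernel of the differential of the moment map. -/
theorem eq_zero_of_kernel_form (hc : c ≠ 0) {p : ExtModuli r} {v : TangentSpace (model r) p}
    (hv : ∀ w : TangentSpace (model r) p, form c r p ![v, w] = 0)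
    (hμ : ∀ j, mcLeft (model r) (fun q => moment q j) p v = 0) : v = 0 := by
  have hb : ∀ j, mcLeft (model r) (fun q : ExtModuli r => q.b j) p v = 0 := by
    intro j
    have h := DFunLike.congr_fun (mcLeft_inv (matDiffAt_b j p)) v
    have h1 := (hμ j).symm.trans h
    rw [mcRight_eq] at h1
    have h2 := congrArg (Ad (p.b j)⁻¹) h1
    simpa using h2.symm
  have ha : ∀ i, mcLeft (model r) (fun q : ExtModuli r => q.a i) p v = 0 :=
    Jet.θ_eq_zero_of_word (a := fun i => jet c (model r) (fun q : ExtModuli r => q.a i) p)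
      (b := fun i => jet c (model r) (fun q : ExtModuli r => q.b i.succ) p) hc
      (fun i => mcLeft_mem_su2 ((contMDiff_a i).mdifferentiable (by simp) p) v)
      (fun i => rfl) (fun i => rfl) (fun X Y hX hY => exists_mcLeft_eq p hX hY)
      (fun w => by
        have := hv w
        rw [form_eq] at this
        exact this)
      (fun i => hb i.succ) (by
        have := (represents_jetWord (c := c) p).θ_eq
        exact (DFunLike.congr_fun this v).trans (hμ 0))
  exact tangent_ext (fun i => (ha i).trans (map_zero _).symm)
    fun i => (hb i.succ).trans (map_zero _).symm

theorem kernel_form (hc : c ≠ 0) (p : ExtModuli r) (v : TangentSpace (model r) p) :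
    (∀ w : TangentSpace (model r) p, form c r p ![v, w] = 0) ↔
      ∃ ξ : TangentSpace (Ipow (r + 1)) (1 : Gpow (r + 1)),
        (∀ j, (moment p j : Mat) * lieMat ξ j * (((moment p j)⁻¹ : SU2) : Mat) +
          lieMat ξ j = 0) ∧ v = infAction (model r) ξ p := by
  have hμ : ∀ j, ContMDiff (model r) (𝓡 3) ∞ fun q : ExtModuli r => moment q j := fun j =>
    contMDiff_inv_SU2 (contMDiff_b j)
  have hbar : ∀ (j : Fin (r + 1)) (w : TangentSpace (model r) p),
      mcRight (model r) (fun q : ExtModuli r => moment q j) p w =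
        Ad (moment p j) (mcLeft (model r) (fun q => moment q j) p w) := fun j w =>
    DFunLike.congr_fun (mcRight_eq _ p) w
  constructor
  · intro hv
    have hη : ∀ j, mcLeft (model r) (fun q => moment q j) p v ∈ su2 := fun j =>
      mcLeft_mem_su2 ((hμ j).mdifferentiable (by simp) p) v
    -- testing with the infinitesimal action shows that `Ad_μ` acts as `-1` on `μ^*θ(v)`
    have h1 : ∀ j, Ad (moment p j) (mcLeft (model r) (fun q => moment q j) p v) =
        -mcLeft (model r) (fun q => moment q j) p v := by
      intro j
      refine eq_neg_of_add_eq_zero_right (eq_zero_of_pairing_eq_zero hc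
        (su2.add_mem (hη j) (Ad_mem_su2 _ (hη j))) fun Y hY => ?_)
      obtain ⟨ξ, hξ⟩ := exists_lieMat_eq (X := fun i : Fin (r + 1) => if i = j then Y else 0)
        (fun i => by split_ifs; exacts [hY, su2.zero_mem])
      have h2 := moment_condition (c := c) ξ p v
      rw [twoForm_swap, hv, Finset.sum_eq_single j (fun i _ hi => by simp [hξ, hi]) (by simp),
        hbar, hξ, if_pos rfl, pairing_comm] at h2
      linarith
    -- so the infinitesimal action of `-(1/2) μ^*θ(v)` moves `μ` as `v` does
    obtain ⟨ξ, hξ⟩ := exists_lieMat_eq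
      (X := fun j => (-(1 / 2 : ℝ)) • mcLeft (model r) (fun q => moment q j) p v)
      (fun j => su2.smul_mem _ (hη j))
    have h2 : ∀ j, Ad (moment p j) (lieMat ξ j) = -lieMat ξ j := by
      intro j
      rw [hξ, map_smul, h1, smul_neg]
    have h3 : ∀ j, Ad (moment p j)⁻¹ (lieMat ξ j) = -lieMat ξ j := by
      intro j
      conv_lhs => rw [← neg_neg (lieMat ξ j), ← h2, map_neg, Ad_inv_Ad]
    refine ⟨ξ, fun j => ?_, ?_⟩
    · rw [← Ad_apply, h2, neg_add_cancel]
    -- the difference is a vector of the kernel in whose direction `μ` does not move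
    have hv' : ∀ w, form c r p ![v - infAction (model r) ξ p, w] = 0 := by
      intro w
      have h4 := moment_condition (c := c) ξ p w
      rw [Finset.sum_eq_zero, mul_zero] at h4
      · exact (twoForm_sub_left _ _ _ _).trans (by rw [hv w, h4, sub_zero])
      · intro j _
        rw [hbar, pairing_add_left, pairing_Ad, h3, pairing_neg_right, add_neg_cancel]
    have hμ' : ∀ j, mcLeft (model r) (fun q => moment q j) p (v - infAction (model r) ξ p) = 0 := by
      intro j
      rw [map_sub, mcLeft_moment_infAction, h3, hξ, ← neg_add', ← add_smul, ← neg_smul]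
      norm_num
    exact sub_eq_zero.1 (eq_zero_of_kernel_form hc hv' hμ')
  · rintro ⟨ξ, hξ, rfl⟩ w
    rw [moment_condition, Finset.sum_eq_zero, mul_zero]
    intro j _
    have h1 : Ad (moment p j) (lieMat ξ j) = -lieMat ξ j := by
      rw [Ad_apply]
      exact eq_neg_of_add_eq_zero_left (hξ j)
    have h2 : Ad (moment p j)⁻¹ (lieMat ξ j) = -lieMat ξ j := by
      conv_lhs => rw [← neg_neg (lieMat ξ j), ← h1, map_neg, Ad_inv_Ad]
    rw [hbar, pairing_add_left, pairing_Ad, h2, pairing_neg_right, add_neg_cancel]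

theorem isQuasiHamiltonian (hc : c ≠ 0) (r : ℕ) :
    IsQuasiHamiltonian c (model r) (r + 1) (form c r) moment where
  isManifold := inferInstance
  smooth_action := contMDiff_smul
  smooth_form := isSmooth_form
  invariant_form := form_invariant
  smooth_moment := contMDiff_moment
  equivariant_moment := equivariant_moment
  deriv_form := deriv_form
  moment_condition := moment_condition
  kernel_form := kernel_form hc

end ExtModuli

/-! ### Transport of quasi-Hamiltonian structures -/

section Transfer

variable {E : Type*} [NormedAddCommGroup E] [NormedSpace ℝ E] {H : Type*} [TopologicalSpace H]
  {I : ModelWithCorners ℝ E H} {M : Type*} [TopologicalSpace M] [ChartedSpace H M]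
  {E' : Type*} [NormedAddCommGroup E'] [NormedSpace ℝ E'] {H' : Type*} [TopologicalSpace H']
  {I' : ModelWithCorners ℝ E' H'} {M' : Type*} [TopologicalSpace M'] [ChartedSpace H' M']
  {E'' : Type*} [NormedAddCommGroup E''] [NormedSpace ℝ E''] {H'' : Type*} [TopologicalSpace H'']
  {I'' : ModelWithCorners ℝ E'' H''} {M'' : Type*} [TopologicalSpace M''] [ChartedSpace H'' M'']

theorem pullback_pullback {g : M' → M''} {f : M → M'} {x : M} (Ω : TwoForm I'' M'')
    (hg : MDifferentiableAt I' I'' g (f x)) (hf : MDifferentiableAt I I' f x) :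
    (Ω.pullback I' I'' g).pullback I I' f x = Ω.pullback I I'' (fun y => g (f y)) x := by
  have h : mfderiv I I'' (fun y => g (f y)) x = (mfderiv I' I'' g (f x)).comp (mfderiv I I' f x) :=
    mfderiv_comp x hg hf
  simp only [TwoForm.pullback]
  rw [h]
  rfl

theorem pullback_apply (Ω : TwoForm I' M') (f : M → M') (x : M) (v w : TangentSpace I x) :
    Ω.pullback I I' f x ![v, w] = Ω (f x) ![mfderiv I I' f x v, mfderiv I I' f x w] := by
  refine congrArg (Ω (f x)) ?_
  ext1 i
  fin_cases i <;> rfl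

end Transfer

section Transport

variable {E : Type*} [NormedAddCommGroup E] [NormedSpace ℝ E] {H : Type*} [TopologicalSpace H]
  {I : ModelWithCorners ℝ E H} {M : Type*} [TopologicalSpace M] [ChartedSpace H M]
  {P : Type*} [TopologicalSpace P] [ChartedSpace H P]

/-- For a diffeomorphism which matches the preferred charts, the expressions in charts of a
two-form and its pull-back agree. -/
theorem inChart_pullback [I.Boundaryless] [IsManifold I ∞ M] (Φ : M ≃ₘ⟮I, I⟯ P) (Ω : TwoForm I P)
    (hsymm : ∀ x y, Φ ((extChartAt I x).symm y) = (extChartAt I (Φ x)).symm y) (x : M) {y : E}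
    (hy : y ∈ (extChartAt I x).target) :
    (Ω.pullback I I Φ).inChart I x y = Ω.inChart I (Φ x) y := by
  refine (pullback_pullback Ω (Φ.contMDiff.mdifferentiable (by simp) _)
    ((contMDiffAt_symm_extChartAt hy).mdifferentiableAt (by simp))).trans ?_
  simp only [hsymm]
  rfl

/-- The exterior derivative commutes with the pull-back under a diffeomorphism which matches the
preferred charts. -/
theorem extDeriv_pullback [I.Boundaryless] [IsManifold I ∞ M] [IsManifold I ∞ P]
    (Φ : M ≃ₘ⟮I, I⟯ P) (Ω : TwoForm I P)
    (hchart : ∀ x, (extChartAt I x : M → E) = fun y => extChartAt I (Φ x) (Φ y))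
    (hsymm : ∀ x y, Φ ((extChartAt I x).symm y) = (extChartAt I (Φ x)).symm y) (x : M)
    (u v w : TangentSpace I x) :
    (Ω.pullback I I Φ).extDeriv I x ![u, v, w] =
      Ω.extDeriv I (Φ x) ![mfderiv I I Φ x u, mfderiv I I Φ x v, mfderiv I I Φ x w] := by
  have h1 : (Ω.pullback I I Φ).inChart I x =ᶠ[nhds (extChartAt I x x)] Ω.inChart I (Φ x) :=
    Filter.eventuallyEq_of_mem ((isOpen_extChartAt_target x).mem_nhds (mem_extChartAt_target x))
      fun y hy => inChart_pullback Φ Ω hsymm x hy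
  have h2 : mfderiv I 𝓘(ℝ, E) (fun y => extChartAt I (Φ x) (Φ y)) x =
      (mfderiv I 𝓘(ℝ, E) (extChartAt I (Φ x)) (Φ x)).comp (mfderiv I I Φ x) :=
    mfderiv_comp x ((contMDiffAt_extChartAt (n := ∞)).mdifferentiableAt (by simp))
      (Φ.contMDiff.mdifferentiable (by simp) x)
  have h3 : ∀ u, (mfderiv I 𝓘(ℝ, E) (extChartAt I x) x u : E) =
      (mfderiv I 𝓘(ℝ, E) (extChartAt I (Φ x)) (Φ x) (mfderiv I I Φ x u) : E) := fun u => by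
    have h4 : ∀ f : M → E, f = extChartAt I x → (mfderiv I 𝓘(ℝ, E) (extChartAt I x) x u : E) =
        (mfderiv I 𝓘(ℝ, E) f x u : E) := by
      rintro f rfl
      rfl
    exact (h4 _ (hchart x).symm).trans (DFunLike.congr_fun h2 u)
  have h5 : extChartAt I x x = extChartAt I (Φ x) (Φ x) := congrFun (hchart x) x
  rw [h5] at h1
  simp only [TwoForm.extDeriv]
  have h6 : ∀ τ : E [⋀^Fin 3]→L[ℝ] ℝ, τ (fun i => mfderiv I 𝓘(ℝ, E) (extChartAt I x) x
      (![u, v, w] i)) = τ (fun i => mfderiv I 𝓘(ℝ, E) (extChartAt I (Φ x)) (Φ x)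
      (![mfderiv I I Φ x u, mfderiv I I Φ x v, mfderiv I I Φ x w] i)) := by
    intro τ
    refine congrArg τ ?_
    ext1 i
    fin_cases i
    exacts [h3 u, h3 v, h3 w]
  refine Eq.trans ?_ (h6 _)
  have h7 : extDeriv ((Ω.pullback I I Φ).inChart I x) (extChartAt I x x) =
      extDeriv (Ω.inChart I (Φ x)) (extChartAt I (Φ x) (Φ x)) := by
    rw [h5, h1.extDeriv_eq]
  exact DFunLike.congr_fun h7 _

variable {n : ℕ} [MulAction (Gpow n) M] [MulAction (Gpow n) P]

theorem contMDiff_smul_const_of_action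
    (hact : ContMDiff ((Ipow n).prod I) I ∞ fun p : Gpow n × M => p.1 • p.2) (x : M) :
    ContMDiff (Ipow n) I ∞ fun σ : Gpow n => σ • x :=
  ContMDiff.comp (g := fun p : Gpow n × M => p.1 • p.2) (f := fun σ => (σ, x)) hact
    (contMDiff_id.prodMk contMDiff_const)

theorem contMDiff_const_smul_of_action
    (hact : ContMDiff ((Ipow n).prod I) I ∞ fun p : Gpow n × M => p.1 • p.2) (σ : Gpow n) :
    ContMDiff I I ∞ fun x : M => σ • x :=
  ContMDiff.comp (g := fun p : Gpow n × M => p.1 • p.2) (f := fun x => (σ, x)) hact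
    ((contMDiff_const (I' := Ipow n)).prodMk contMDiff_id)

theorem contMDiff_action_of_diffeomorph (Φ : M ≃ₘ⟮I, I⟯ P)
    (hact : ContMDiff ((Ipow n).prod I) I ∞ fun p : Gpow n × P => p.1 • p.2)
    (hΦ : ∀ (σ : Gpow n) (x : M), Φ (σ • x) = σ • Φ x) :
    ContMDiff ((Ipow n).prod I) I ∞ fun p : Gpow n × M => p.1 • p.2 := by
  have h1 : ContMDiff ((Ipow n).prod I) ((Ipow n).prod I) ∞ fun p : Gpow n × M => (p.1, Φ p.2) :=
    contMDiff_fst.prodMk (Φ.contMDiff.comp contMDiff_snd)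
  have h2 : (fun p : Gpow n × M => p.1 • p.2) = fun p => Φ.symm (p.1 • Φ p.2) :=
    funext fun p => by rw [← hΦ, Φ.symm_apply_apply]
  rw [h2]
  exact Φ.symm.contMDiff.comp
    (ContMDiff.comp (g := fun p : Gpow n × P => p.1 • p.2) hact h1)

/-- An equivariant diffeomorphism respects the infinitesimal actions. -/
theorem mfderiv_infAction (Φ : M ≃ₘ⟮I, I⟯ P)
    (hact : ContMDiff ((Ipow n).prod I) I ∞ fun p : Gpow n × M => p.1 • p.2)
    (hΦ : ∀ (σ : Gpow n) (x : M), Φ (σ • x) = σ • Φ x)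
    (ξ : TangentSpace (Ipow n) (1 : Gpow n)) (x : M) :
    mfderiv I I Φ x (infAction I ξ x) = infAction I ξ (Φ x) := by
  have h3 : mfderiv (Ipow n) I (fun σ : Gpow n => Φ (σ • x)) 1 =
      (mfderiv I I Φ ((1 : Gpow n) • x)).comp (mfderiv (Ipow n) I (fun σ : Gpow n => σ • x) 1) :=
    mfderiv_comp 1 (Φ.contMDiff.mdifferentiable (by simp) _)
      ((contMDiff_smul_const_of_action hact x).mdifferentiable (by simp) 1)
  -- `1 • x` and `x` are equal, but not syntactically, and the tangent spaces depend on them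
  have h4 : ∀ q, q = x → ∀ v : E, (mfderiv I I Φ q v : E) = (mfderiv I I Φ x v : E) := by
    rintro q rfl v
    rfl
  have h5 : ∀ f : Gpow n → P, (fun σ : Gpow n => Φ (σ • x)) = f →
      (mfderiv (Ipow n) I (fun σ : Gpow n => Φ (σ • x)) 1 ξ : E) =
        (mfderiv (Ipow n) I f 1 ξ : E) := by
    rintro f rfl
    rfl
  exact (h4 _ (one_smul (Gpow n) x) _).symm.trans ((DFunLike.congr_fun h3 ξ).symm.trans
    (h5 (fun σ => σ • Φ x) (funext fun σ => hΦ σ x)))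

variable [I.Boundaryless] [IsManifold I ∞ M] [IsManifold I ∞ P]

/-- A quasi-Hamiltonian structure can be pulled back under an equivariant diffeomorphism. It is
assumed to match the preferred charts, in which smoothness and the exterior derivative of two-forms
are defined, so that no change of charts is needed. -/
theorem IsQuasiHamiltonian.pullback {c : ℝ} {Ω : TwoForm I P} {μ : P → Gpow n}
    (h : IsQuasiHamiltonian c I n Ω μ) (Φ : M ≃ₘ⟮I, I⟯ P)
    (hchart : ∀ x, (extChartAt I x : M → E) = fun y => extChartAt I (Φ x) (Φ y))
    (hsymm : ∀ x y, Φ ((extChartAt I x).symm y) = (extChartAt I (Φ x)).symm y)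
    (htarget : ∀ x, (extChartAt I x).target = (extChartAt I (Φ x)).target)
    (hΦ : ∀ (σ : Gpow n) (x : M), Φ (σ • x) = σ • Φ x) :
    IsQuasiHamiltonian c I n (Ω.pullback I I Φ) (fun x => μ (Φ x)) := by
  have hd : ∀ x, MDifferentiableAt I I Φ x := fun x => Φ.contMDiff.mdifferentiable (by simp) x
  have hbij : ∀ x, Function.Bijective (mfderiv I I Φ x) := fun x =>
    (Φ.mfderivToContinuousLinearEquiv (by simp) x).bijective
  have hact := contMDiff_action_of_diffeomorph Φ h.smooth_action hΦ
  have hactM : ∀ (σ : Gpow n) (x : M), MDifferentiableAt I I (fun x : M => σ • x) x := fun σ =>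
    (contMDiff_const_smul_of_action hact σ).mdifferentiable (by simp)
  have hactP : ∀ (σ : Gpow n) (x : P), MDifferentiableAt I I (fun x : P => σ • x) x := fun σ =>
    (contMDiff_const_smul_of_action h.smooth_action σ).mdifferentiable (by simp)
  have hμs : ∀ i, ContMDiff I (𝓡 3) ∞ (fun y => μ y i) := fun i =>
    ContMDiff.comp (g := fun σ : Gpow n => σ i) (f := μ) (contMDiff_apply_Gpow i) h.smooth_moment
  have hμd : ∀ x i, MDifferentiableAt I (𝓡 3) (fun y => μ y i) x := fun x i =>
    (hμs i).mdifferentiable (by simp) x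
  have hμ : ∀ x i, mcLeft I (fun y => μ (Φ y) i) x =
      (mcLeft I (fun y => μ y i) (Φ x)).comp (mfderiv I I Φ x) := fun x i =>
    mcLeft_comp (g := fun y => μ y i) (f := Φ) (hμd (Φ x) i) (hd x)
  exact
  { isManifold := inferInstance
    smooth_action := hact
    smooth_form := fun x => by
      rw [htarget x]
      exact (h.smooth_form (Φ x)).congr fun y hy => inChart_pullback Φ Ω hsymm x (htarget x ▸ hy)
    invariant_form := fun σ => by
      funext x
      rw [pullback_pullback Ω (hd _) (hactM σ x)]
      simp only [hΦ]
      rw [← pullback_pullback (g := fun x : P => σ • x) Ω (hactP σ _) (hd x), h.invariant_form σ]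
    smooth_moment := h.smooth_moment.comp Φ.contMDiff
    equivariant_moment := fun σ x => by rw [hΦ, h.equivariant_moment]
    deriv_form := fun x u v w => by
      rw [extDeriv_pullback Φ Ω hchart hsymm, h.deriv_form]
      simp only [cartanForm, hμ]
      rfl
    moment_condition := fun ξ x w => by
      have hbar : ∀ i, mcRight I (fun y => μ (Φ y) i) x w =
          mcRight I (fun y => μ y i) (Φ x) (mfderiv I I Φ x w) := fun i => by
        rw [mcRight_eq, mcRight_eq, ContinuousLinearMap.comp_apply, hμ]
        rfl
      rw [pullback_apply, mfderiv_infAction Φ hact hΦ, h.moment_condition]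
      simp only [hbar, hμ]
      rfl
    kernel_form := fun x v => by
      have h1 := h.kernel_form (Φ x) (mfderiv I I Φ x v)
      simp only [pullback_apply]
      rw [← (hbij x).2.forall (p := fun w => Ω (Φ x) ![mfderiv I I Φ x v, w] = 0), h1]
      refine exists_congr fun ξ => and_congr_right fun _ => ?_
      rw [← mfderiv_infAction Φ hact hΦ]
      exact (hbij x).1.eq_iff }

end Transport

/-! ### The level set and the quotient as manifolds -/

namespace ExtModuli

theorem ext_of_succ {r : ℕ} {p q : ExtModuli r} (ha : ∀ i, p.a i = q.a i)
    (hb : ∀ i : Fin r, p.b i.succ = q.b i.succ) : p = q :=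
  (coords r).injective (Prod.ext (funext ha) (funext hb))

/-- The point with the given holonomies, where `b_1` is determined by the relation. -/
def ofCoords {r : ℕ} (a b : Gpow r) : ExtModuli r := (coords r).symm (a, b)

@[simp] theorem ofCoords_a {r : ℕ} (a b : Gpow r) (i : Fin r) : (ofCoords a b).a i = a i := rfl

@[simp] theorem ofCoords_b_succ {r : ℕ} (a b : Gpow r) (i : Fin r) :
    (ofCoords a b).b i.succ = b i := rfl

end ExtModuli

namespace Level

open ExtModuli

variable {m k : ℕ}

/-- A shortcut for instance search. -/
instance : SMul SU2 (Level m k) :=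
  (inferInstance : MulAction SU2 (Level m k)).toSemigroupAction.toSMul

/-- A shortcut for instance search. -/
instance : SMul (Gpow (m + k + 1)) (Level m k) :=
  (inferInstance : MulAction (Gpow (m + k + 1)) (Level m k)).toSemigroupAction.toSMul

/-- The part on `Σ⁻` of the point of the level set with glued holonomies `p` and `a⁺_{m+2} = A`. -/
def ungluedMinus (p : ExtModuli (m + k)) (A : SU2) : ExtModuli k :=
  ofCoords (fun j => A⁻¹ * p.a (Fin.natAdd m j)) (fun j => p.b (Fin.natAdd m j).succ)

/-- The point of the level set with glued holonomies `p` and `a⁺_{m+2} = A`. -/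
def unglued (p : ExtModuli (m + k)) (A : SU2) : CutModuli m k :=
  (ofCoords (Fin.snoc (α := fun _ => SU2) (fun i : Fin m => p.a (Fin.castAdd k i)) A)
    (Fin.snoc (α := fun _ => SU2) (fun i : Fin m => p.b (Fin.castAdd k i).succ)
      ((ungluedMinus p A).b 0)⁻¹), ungluedMinus p A)

theorem unglued_b_last (p : ExtModuli (m + k)) (A : SU2) :
    (unglued p A).1.b (Fin.last (m + 1)) = ((ungluedMinus p A).b 0)⁻¹ := by
  rw [← Fin.succ_last, unglued, ofCoords_b_succ, Fin.snoc_last]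

theorem nu_unglued (p : ExtModuli (m + k)) (A : SU2) : nu (unglued p A) = 1 := by
  rw [nu_eq_one_iff, unglued_b_last]
  exact mul_inv_cancel _

/-- An extension of the gluing map to all of `CutModuli`: off the level set, the glued holonomies
other than `b_1` are defined by the same formulas, and `b_1` by the relation. -/
def glueExt (q : CutModuli m k) : ExtModuli (m + k) :=
  ofCoords (Fin.append (fun i : Fin m => q.1.a i.castSucc)
      (fun j : Fin k => q.1.a (Fin.last m) * q.2.a j))
    (Fin.append (fun i : Fin m => q.1.b i.castSucc.succ) (fun j : Fin k => q.2.b j.succ))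

theorem glueExt_incl (z : Level m k) : glueExt z.incl = z.glue :=
  ext_of_succ (fun _ => rfl) fun _ => rfl

theorem glueExt_unglued (p : ExtModuli (m + k)) (A : SU2) : glueExt (unglued p A) = p := by
  refine ext_of_succ (fun i => ?_) (fun i => ?_)
  · refine Fin.addCases (fun i => ?_) (fun j => ?_) i <;> simp [glueExt, unglued, ungluedMinus]
  · refine Fin.addCases (fun i => ?_) (fun j => ?_) i <;> simp [glueExt, unglued, ungluedMinus]

theorem unglued_glue (z : Level m k) : unglued z.glue (z.1.1.a (Fin.last m)) = z.incl := by
  have ha : ∀ j : Fin (m + k), z.glue.a j = z.glueA j := fun _ => rfl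
  have hb : ∀ j : Fin (m + k + 1), z.glue.b j = z.glueB j := fun _ => rfl
  have h : ungluedMinus z.glue (z.1.1.a (Fin.last m)) = z.1.2 := by
    refine ext_of_succ (fun i => ?_) (fun i => ?_) <;>
      simp [ungluedMinus, ha, hb, glueA, glueB]
  refine Prod.ext (ext_of_succ (fun i => ?_) (fun i => ?_)) h
  · refine Fin.lastCases ?_ (fun i => ?_) i <;> simp [unglued, ha, glueA, incl]
  · refine Fin.lastCases ?_ (fun i => ?_) i
    · simp only [unglued, h, ofCoords_b_succ, Fin.snoc_last, incl]
      exact inv_eq_of_mul_eq_one_right z.b_mul_b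
    · simp [unglued, hb, glueB, incl]

theorem contMDiff_unglued : ContMDiff ((model (m + k)).prod (𝓡 3)) (cutModel m k) ∞
    fun x : ExtModuli (m + k) × SU2 => unglued x.1 x.2 := by
  have ha : ∀ i, ContMDiff ((model (m + k)).prod (𝓡 3)) (𝓡 3) ∞
      fun x : ExtModuli (m + k) × SU2 => x.1.a i := fun i => (contMDiff_a i).comp contMDiff_fst
  have hb : ∀ j, ContMDiff ((model (m + k)).prod (𝓡 3)) (𝓡 3) ∞
      fun x : ExtModuli (m + k) × SU2 => x.1.b j := fun j => (contMDiff_b j).comp contMDiff_fst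
  have hA : ContMDiff ((model (m + k)).prod (𝓡 3)) (𝓡 3) ∞
      fun x : ExtModuli (m + k) × SU2 => x.2 := contMDiff_snd
  have h : ContMDiff ((model (m + k)).prod (𝓡 3)) (model k) ∞
      fun x : ExtModuli (m + k) × SU2 => ungluedMinus x.1 x.2 :=
    contMDiff_of_a_b (fun i => contMDiff_mul_SU2 (contMDiff_inv_SU2 hA) (ha _)) fun i => hb _
  refine ContMDiff.prodMk (contMDiff_of_a_b (fun i => ?_) (fun i => ?_)) h
  · refine Fin.lastCases ?_ (fun i => ?_) i
    · simpa [unglued] using hA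
    · simpa [unglued] using ha _
  · refine Fin.lastCases ?_ (fun i => ?_) i
    · simp only [ofCoords_b_succ, Fin.snoc_last]
      exact contMDiff_inv_SU2 ((contMDiff_b 0).comp h)
    · simpa [unglued] using hb _

theorem contMDiff_glueExt :
    ContMDiff (cutModel m k) (model (m + k)) ∞ (glueExt (m := m) (k := k)) := by
  have ha : ∀ i, ContMDiff (cutModel m k) (𝓡 3) ∞ fun q : CutModuli m k => q.1.a i :=
    fun i => (contMDiff_a i).comp contMDiff_fst
  have hb : ∀ i, ContMDiff (cutModel m k) (𝓡 3) ∞ fun q : CutModuli m k => q.1.b i :=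
    fun i => (contMDiff_b i).comp contMDiff_fst
  have ha' : ∀ i, ContMDiff (cutModel m k) (𝓡 3) ∞ fun q : CutModuli m k => q.2.a i :=
    fun i => (contMDiff_a i).comp contMDiff_snd
  have hb' : ∀ i, ContMDiff (cutModel m k) (𝓡 3) ∞ fun q : CutModuli m k => q.2.b i :=
    fun i => (contMDiff_b i).comp contMDiff_snd
  refine contMDiff_of_a_b (fun i => ?_) (fun i => ?_) <;>
    refine Fin.addCases (fun i => ?_) (fun j => ?_) i <;>
    simp only [glueExt, ofCoords_a, ofCoords_b_succ, Fin.append_left, Fin.append_right]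
  exacts [ha _, contMDiff_mul_SU2 (ha _) (ha' _), hb _, hb' _]

/-- An extension of `Level.homeo` to all of `CutModuli`. -/
def homeoExt (q : CutModuli m k) : ExtModuli (m + k) × SU2 := (glueExt q, q.1.a (Fin.last m))

theorem contMDiff_homeoExt : ContMDiff (cutModel m k) ((model (m + k)).prod (𝓡 3)) ∞
    (homeoExt (m := m) (k := k)) :=
  contMDiff_glueExt.prodMk ((contMDiff_a (Fin.last m)).comp contMDiff_fst)

theorem continuous_incl : Continuous (incl (m := m) (k := k)) := continuous_subtype_val

theorem homeoExt_incl (z : Level m k) :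
    homeoExt z.incl = (z.glue, z.1.1.a (Fin.last m)) :=
  Prod.ext (glueExt_incl z) rfl

/-- The level set is the product of the glued moduli space and a copy of `SU(2)`. -/
def homeo (m k : ℕ) : Level m k ≃ₜ ExtModuli (m + k) × SU2 where
  toFun z := (z.glue, z.1.1.a (Fin.last m))
  invFun x := ⟨unglued x.1 x.2, nu_unglued x.1 x.2⟩
  left_inv z := Subtype.ext (unglued_glue z)
  right_inv x := by
    refine Prod.ext ?_ ?_
    · exact (glueExt_incl _).symm.trans (glueExt_unglued x.1 x.2)
    · simp [unglued]
  continuous_toFun := by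
    simp only [← homeoExt_incl]
    exact contMDiff_homeoExt.continuous.comp continuous_incl
  continuous_invFun := contMDiff_unglued.continuous.subtype_mk _

/-- The manifold structure of the level set. -/
abbrev charts (m k : ℕ) :
    ChartedSpace (ModelProd (Model (m + k)) (EuclideanSpace ℝ (Fin 3))) (Level m k) :=
  transportCharts (homeo m k)

attribute [local instance] charts

theorem isManifold_charts : IsManifold ((model (m + k)).prod (𝓡 3)) ∞ (Level m k) :=
  isManifold_transportCharts _ (homeo m k)

/-- `Level.homeo` as a diffeomorphism. -/
def diffeo (m k : ℕ) : Level m k ≃ₘ⟮(model (m + k)).prod (𝓡 3), (model (m + k)).prod (𝓡 3)⟯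
    ExtModuli (m + k) × SU2 :=
  transportDiffeo _ (homeo m k)

theorem contMDiff_incl : ContMDiff ((model (m + k)).prod (𝓡 3)) (cutModel m k) ∞
    (incl (m := m) (k := k)) := by
  have h : incl (m := m) (k := k) = fun z => unglued (diffeo m k z).1 (diffeo m k z).2 :=
    funext fun z => (unglued_glue z).symm
  rw [h]
  exact contMDiff_unglued.comp (diffeo m k).contMDiff

/-- The inclusion is an immersion since it has the left inverse `homeoExt`, up to a
diffeomorphism. -/
theorem isSmoothEmb_incl : IsSmoothEmb ((model (m + k)).prod (𝓡 3)) (cutModel m k)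
    (incl (m := m) (k := k)) where
  smooth := contMDiff_incl
  injective_mfderiv z := by
    have h1 : mfderiv ((model (m + k)).prod (𝓡 3)) ((model (m + k)).prod (𝓡 3))
        (fun z : Level m k => homeoExt z.incl) z =
        (mfderiv (cutModel m k) ((model (m + k)).prod (𝓡 3)) homeoExt z.incl).comp
          (mfderiv ((model (m + k)).prod (𝓡 3)) (cutModel m k) incl z) :=
      mfderiv_comp z (contMDiff_homeoExt.mdifferentiable (by simp) _)
        (contMDiff_incl.mdifferentiable (by simp) z)
    have h2 : Function.Injective (mfderiv ((model (m + k)).prod (𝓡 3))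
        ((model (m + k)).prod (𝓡 3)) (fun z : Level m k => homeoExt z.incl) z) := by
      have h3 : (fun z : Level m k => homeoExt z.incl) = diffeo m k := funext homeoExt_incl
      rw [h3]
      exact ((diffeo m k).mfderivToContinuousLinearEquiv (by simp) z).injective
    rw [h1] at h2
    exact Function.Injective.of_comp h2
  isEmbedding := Topology.IsEmbedding.subtypeVal

theorem contMDiff_glue : ContMDiff ((model (m + k)).prod (𝓡 3)) (model (m + k)) ∞
    (glue (m := m) (k := k)) :=
  contMDiff_fst.comp (diffeo m k).contMDiff

theorem surjective_mfderiv_glue (z : Level m k) : Function.Surjective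
    (mfderiv ((model (m + k)).prod (𝓡 3)) (model (m + k)) (glue (m := m) (k := k)) z) := by
  have h1 : mfderiv ((model (m + k)).prod (𝓡 3)) (model (m + k)) (glue (m := m) (k := k)) z =
      (mfderiv ((model (m + k)).prod (𝓡 3)) (model (m + k)) Prod.fst (diffeo m k z)).comp
        (mfderiv ((model (m + k)).prod (𝓡 3)) ((model (m + k)).prod (𝓡 3)) (diffeo m k) z) :=
    mfderiv_comp z mdifferentiableAt_fst ((diffeo m k).contMDiff.mdifferentiable (by simp) z)
  rw [h1, mfderiv_fst]
  intro v
  obtain ⟨w, hw⟩ := ((diffeo m k).mfderivToContinuousLinearEquiv (by simp) z).surjective (v, 0)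
  exact ⟨w, congrArg Prod.fst hw⟩

theorem curve_smul_fst (σ : SU2) (z : Level m k) : (σ • z).1.1 = curvePlus m σ • z.1.1 := rfl

theorem curve_smul_snd (σ : SU2) (z : Level m k) : (σ • z).1.2 = curveMinus k σ • z.1.2 := rfl

theorem outer_smul_fst (σ : Gpow (m + k + 1)) (z : Level m k) :
    (σ • z).1.1 = outerPlus m k σ • z.1.1 := rfl

theorem outer_smul_snd (σ : Gpow (m + k + 1)) (z : Level m k) :
    (σ • z).1.2 = outerMinus m k σ • z.1.2 := rfl

theorem curve_smul_a_last (σ : SU2) (z : Level m k) :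
    (σ • z).1.1.a (Fin.last m) = z.1.1.a (Fin.last m) * σ⁻¹ := by
  rw [curve_smul_fst]
  simp [curvePlus]

theorem glue_curve_smul (σ : SU2) (z : Level m k) : (σ • z).glue = z.glue := by
  have ha : ∀ (z : Level m k) j, z.glue.a j = z.glueA j := fun _ _ => rfl
  have hb : ∀ (z : Level m k) j, z.glue.b j = z.glueB j := fun _ _ => rfl
  refine ext_of_succ (fun i => ?_) (fun i => ?_) <;>
    refine Fin.addCases (fun i => ?_) (fun j => ?_) i <;>
    simp [ha, hb, glueA, glueB, curve_smul_fst, curve_smul_snd, curvePlus, curveMinus]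

theorem glue_outer_smul (σ : Gpow (m + k + 1)) (z : Level m k) : (σ • z).glue = σ • z.glue := by
  have ha : ∀ (z : Level m k) j, z.glue.a j = z.glueA j := fun _ _ => rfl
  have hb : ∀ (z : Level m k) j, z.glue.b j = z.glueB j := fun _ _ => rfl
  refine ext_of_succ (fun i => ?_) (fun i => ?_) <;>
    refine Fin.addCases (fun i => ?_) (fun j => ?_) i <;>
    simp [ha, hb, glueA, glueB, outer_smul_fst, outer_smul_snd, outerPlus, outerMinus, mul_assoc]

theorem moment_glue (z : Level m k) : moment z.glue = z.outerMoment := by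
  funext j
  refine Fin.cases rfl (fun i => ?_) j
  refine Fin.addCases (fun i => ?_) (fun j => ?_) i <;>
    simp only [outerMoment, Fin.cons_succ, Fin.append_left, Fin.append_right]
  · show (z.glueB (Fin.castAdd k i).succ)⁻¹ = _
    rw [glueB, Fin.cons_succ, Fin.append_left]
    rfl
  · show (z.glueB (Fin.natAdd m j).succ)⁻¹ = _
    rw [glueB, Fin.cons_succ, Fin.append_right]
    rfl

end Level

namespace Reduced

open ExtModuli Level

variable {m k : ℕ}

/-- A shortcut for instance search. -/
instance : SMul (Gpow (m + k + 1)) (Reduced m k) :=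
  (inferInstance : MulAction (Gpow (m + k + 1)) (Reduced m k)).toSemigroupAction.toSMul

theorem mk_curve_smul (σ : SU2) (z : Level m k) : mk (σ • z) = mk z :=
  Quotient.sound ⟨σ, rfl⟩

/-- The map on the quotient induced by the gluing map. -/
def glued : Reduced m k → ExtModuli (m + k) :=
  Quotient.lift Level.glue (by
    rintro _ z ⟨τ, rfl⟩
    exact glue_curve_smul τ z)

theorem continuous_mk : Continuous (mk (m := m) (k := k)) := continuous_quotient_mk'

/-- The quotient is the glued moduli space: every `G_C`-orbit contains exactly one point with
`a⁺_{m+2} = 1`. -/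
def homeo (m k : ℕ) : Reduced m k ≃ₜ ExtModuli (m + k) where
  toFun := glued
  invFun p := mk ((Level.homeo m k).symm (p, 1))
  left_inv := by
    rintro ⟨z⟩
    -- the point of the orbit with `a⁺_{m+2} = 1` is obtained by acting with `a⁺_{m+2}`
    have h : Level.homeo m k (z.1.1.a (Fin.last m) • z) = (z.glue, 1) :=
      Prod.ext (glue_curve_smul _ z) ((curve_smul_a_last _ z).trans (mul_inv_cancel _))
    show mk ((Level.homeo m k).symm (z.glue, 1)) = mk z
    rw [← h, Homeomorph.symm_apply_apply, mk_curve_smul]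
  right_inv p := congrArg Prod.fst ((Level.homeo m k).apply_symm_apply (p, 1))
  continuous_toFun :=
    Continuous.quotient_lift (continuous_fst.comp (Level.homeo m k).continuous) _
  continuous_invFun := continuous_mk.comp ((Level.homeo m k).symm.continuous.comp (by fun_prop))

/-- The manifold structure of the quotient. -/
abbrev charts (m k : ℕ) : ChartedSpace (Model (m + k)) (Reduced m k) :=
  transportCharts (homeo m k)

attribute [local instance] Level.charts charts

theorem isManifold_charts : IsManifold (model (m + k)) ∞ (Reduced m k) :=
  isManifold_transportCharts _ (homeo m k)

/-- The diffeomorphism induced by the gluing map. -/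
def diffeo (m k : ℕ) : Reduced m k ≃ₘ⟮model (m + k), model (m + k)⟯ ExtModuli (m + k) :=
  transportDiffeo _ (homeo m k)

theorem diffeo_mk (z : Level m k) : diffeo m k (mk z) = z.glue := rfl

theorem mk_eq : mk (m := m) (k := k) = fun z => (diffeo m k).symm z.glue :=
  funext fun z => ((diffeo m k).symm_apply_apply (mk z)).symm

theorem isSurjSubmersion_mk : IsSurjSubmersion ((model (m + k)).prod (𝓡 3)) (model (m + k))
    (mk (m := m) (k := k)) where
  smooth := by
    rw [mk_eq]
    exact (diffeo m k).symm.contMDiff.comp contMDiff_glue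
  surjective := Quotient.mk_surjective
  surjective_mfderiv z := by
    have h1 : mfderiv ((model (m + k)).prod (𝓡 3)) (model (m + k))
        (fun z : Level m k => (diffeo m k).symm z.glue) z =
        (mfderiv (model (m + k)) (model (m + k)) (diffeo m k).symm z.glue).comp
          (mfderiv ((model (m + k)).prod (𝓡 3)) (model (m + k)) glue z) :=
      mfderiv_comp z ((diffeo m k).symm.contMDiff.mdifferentiable (by simp) _)
        (contMDiff_glue.mdifferentiable (by simp) z)
    rw [mk_eq, h1]
    intro v
    obtain ⟨w, hw⟩ :=
      ((diffeo m k).symm.mfderivToContinuousLinearEquiv (by simp) z.glue).surjective v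
    obtain ⟨u, hu⟩ := surjective_mfderiv_glue z w
    exact ⟨u, (congrArg _ hu).trans hw⟩

theorem diffeo_smul (σ : Gpow (m + k + 1)) (x : Reduced m k) :
    diffeo m k (σ • x) = σ • diffeo m k x := by
  obtain ⟨z, rfl⟩ := Quotient.mk_surjective x
  exact glue_outer_smul σ z

theorem moment_diffeo (x : Reduced m k) :
    ExtModuli.moment (diffeo m k x) = Reduced.moment x := by
  obtain ⟨z, rfl⟩ := Quotient.mk_surjective x
  exact moment_glue z

/-- The two-form of the quotient, defined as the pull-back of the one of the glued moduli space. -/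
def form (c : ℝ) (m k : ℕ) : TwoForm (model (m + k)) (Reduced m k) :=
  (ExtModuli.form c (m + k)).pullback (model (m + k)) (model (m + k)) (diffeo m k)

theorem pullback_mk_form (c : ℝ) :
    (form c m k).pullback ((model (m + k)).prod (𝓡 3)) (model (m + k)) mk =
      (ExtModuli.form c (m + k)).pullback ((model (m + k)).prod (𝓡 3)) (model (m + k)) glue := by
  funext z
  exact pullback_pullback _ ((diffeo m k).contMDiff.mdifferentiable (by simp) _)
    (isSurjSubmersion_mk.smooth.mdifferentiable (by simp) z)

theorem isQuasiHamiltonian_form {c : ℝ} (hc : c ≠ 0) (m k : ℕ) :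
    IsQuasiHamiltonian c (model (m + k)) (m + k + 1) (form c m k) Reduced.moment := by
  have := isManifold_charts (m := m) (k := k)
  have h : Reduced.moment (m := m) (k := k) = fun x => ExtModuli.moment (diffeo m k x) :=
    funext fun x => (moment_diffeo x).symm
  rw [h]
  exact (isQuasiHamiltonian hc (m + k)).pullback (diffeo m k) (fun x => rfl)
    (fun x y => (homeo m k).apply_symm_apply _)
    (extChartAt_target_transportCharts (model (m + k)) (homeo m k)) diffeo_smul

end Reduced

/-! ### The two-forms on the level set -/

namespace Jet

variable {V : Type*} [AddCommGroup V] [Module ℝ V] [TopologicalSpace V] {c : ℝ}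

theorem central_comm (s : V [⋀^Fin 2]→L[ℝ] ℝ) (x : Jet c V) : x * central c s = central c s * x :=
  (mul_central s x).trans (central_mul s x).symm

theorem conj_central_mul (s : V [⋀^Fin 2]→L[ℝ] ℝ) (x y : Jet c V) :
    central c s * x * y * (central c s * x)⁻¹ = x * y * x⁻¹ := by
  calc _ = central c s * (x * y * x⁻¹) * (central c s)⁻¹ := by group
    _ = _ := by rw [← central_comm, mul_inv_cancel_right]

theorem mul_conj_central_mul (s : V [⋀^Fin 2]→L[ℝ] ℝ) (x y z : Jet c V) :
    x * (y * (central c s * z) * y⁻¹) = central c s * (x * (y * z * y⁻¹)) := by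
  calc _ = x * (y * central c s) * z * y⁻¹ := by group
    _ = x * central c s * (y * z * y⁻¹) := by rw [central_comm]; group
    _ = _ := by rw [central_comm, mul_assoc]

theorem central_mul_s (s : V [⋀^Fin 2]→L[ℝ] ℝ) (x : Jet c V) :
    (central c s * x).s = s + x.s := by rw [central_mul]

end Jet

section

variable {E : Type*} [NormedAddCommGroup E] [NormedSpace ℝ E] {H : Type*} [TopologicalSpace H]
  {I : ModelWithCorners ℝ E H} {M : Type*} [TopologicalSpace M] [ChartedSpace H M]

/-- A jet which represents `f` is the jet of `f` up to a central factor, its two-form. -/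
theorem Represents.exists_eq {c : ℝ} {x : M} {y : Jet c (TangentSpace I x)} {f : M → SU2}
    (h : Represents y f) : y = Jet.central c y.s * Gluing.jet c I f x := by
  rw [Jet.central_mul, ← show y.g = (Gluing.jet c I f x).g from h.g_eq,
    ← show y.θ = (Gluing.jet c I f x).θ from h.θ_eq, jet_s, add_zero]

/-- Although the jet of a product of maps differs from the product of the jets, they act in the same
way by conjugation, as they differ by a central factor. -/
theorem conj_jet_mul {c : ℝ} {x : M} {f g : M → SU2} (hf : MatDiffAt I f x) (hg : MatDiffAt I g x)
    (y : Jet c (TangentSpace I x)) :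
    jet c I (fun q => f q * g q) x * y * (jet c I (fun q => f q * g q) x)⁻¹ =
      jet c I f x * (jet c I g x * y * (jet c I g x)⁻¹) * (jet c I f x)⁻¹ := by
  have h := ((Represents.jet (c := c) hf).mul (Represents.jet hg)).exists_eq
  calc _ = (jet c I f x * jet c I g x) * y * (jet c I f x * jet c I g x)⁻¹ := by
        rw [h, Jet.conj_central_mul]
    _ = _ := by group

end

theorem mcRight_comp {E : Type*} [NormedAddCommGroup E] [NormedSpace ℝ E] {H : Type*}
    [TopologicalSpace H] {I : ModelWithCorners ℝ E H} {M : Type*} [TopologicalSpace M]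
    [ChartedSpace H M] {E' : Type*} [NormedAddCommGroup E'] [NormedSpace ℝ E'] {H' : Type*}
    [TopologicalSpace H'] {I' : ModelWithCorners ℝ E' H'} {M' : Type*} [TopologicalSpace M']
    [ChartedSpace H' M'] {g : M' → SU2} {f : M → M'} {x : M}
    (hg : MDifferentiableAt I' (𝓡 3) g (f x)) (hf : MDifferentiableAt I I' f x) :
    mcRight I (fun y => g (f y)) x = (mcRight I' g (f x)).comp (mfderiv I I' f x) := by
  rw [mcRight_eq, mcRight_eq, mcLeft_comp hg hf]
  rfl

theorem wedge_neg_self {V : Type*} [AddCommGroup V] [Module ℝ V] [TopologicalSpace V] (c : ℝ)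
    (α : V →L[ℝ] Mat) : wedge c (-α) α = 0 := by
  ext v
  simp [wedge_apply, pairing_neg_left, pairing_comm c (α (v 1))]

namespace Level

open ExtModuli

variable {m k : ℕ} {c : ℝ}

attribute [local instance] charts

theorem contMDiff_plus : ContMDiff ((model (m + k)).prod (𝓡 3)) (model (m + 1)) ∞
    fun z : Level m k => z.1.1 := contMDiff_fst.comp contMDiff_incl

theorem contMDiff_minus : ContMDiff ((model (m + k)).prod (𝓡 3)) (model k) ∞
    fun z : Level m k => z.1.2 := contMDiff_snd.comp contMDiff_incl

/-- The two-form of the glued surface on the level set is the sum of those of the two parts: the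
jets of the glued holonomies multiply to the product of the word of `Σ⁺` without its last factor
and of the word of `Σ⁻` conjugated by `a⁺_{m+2}`; on the level set the latter is, up to its
two-form, the last factor of the word of `Σ⁺`. -/
theorem pullback_glue_form (z : Level m k) :
    (form c (m + k)).pullback ((model (m + k)).prod (𝓡 3)) (model (m + k)) glue z =
      (form c (m + 1)).pullback ((model (m + k)).prod (𝓡 3)) (model (m + 1))
        (fun z : Level m k => z.1.1) z +
      (form c k).pullback ((model (m + k)).prod (𝓡 3)) (model k)
        (fun z : Level m k => z.1.2) z := by
  set J := fun f : Level m k → SU2 => jet c ((model (m + k)).prod (𝓡 3)) f z with hJ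
  have hap : ∀ i, MatDiffAt ((model (m + k)).prod (𝓡 3)) (fun z : Level m k => z.1.1.a i) z :=
    fun i => matDiffAt_of_contMDiff ((contMDiff_a i).comp contMDiff_plus)
  have hbp : ∀ i, MatDiffAt ((model (m + k)).prod (𝓡 3)) (fun z : Level m k => z.1.1.b i) z :=
    fun i => matDiffAt_of_contMDiff ((contMDiff_b i).comp contMDiff_plus)
  have ham : ∀ i, MatDiffAt ((model (m + k)).prod (𝓡 3)) (fun z : Level m k => z.1.2.a i) z :=
    fun i => matDiffAt_of_contMDiff ((contMDiff_a i).comp contMDiff_minus)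
  have hbm : ∀ i, MatDiffAt ((model (m + k)).prod (𝓡 3)) (fun z : Level m k => z.1.2.b i) z :=
    fun i => matDiffAt_of_contMDiff ((contMDiff_b i).comp contMDiff_minus)
  rw [pullback_form (contMDiff_glue.mdifferentiable (by simp) z),
    pullback_form (contMDiff_plus.mdifferentiable (by simp) z),
    pullback_form (contMDiff_minus.mdifferentiable (by simp) z)]
  set A := J fun z => z.1.1.a (Fin.last m) with hA
  set Wp := Jet.word (fun i => J fun z => z.1.1.a i) (fun i => J fun z => z.1.1.b i.succ) with hWp
  set Wm := Jet.word (fun i => J fun z => z.1.2.a i) (fun i => J fun z => z.1.2.b i.succ) with hWm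
  set f : Fin m → Jet c (TangentSpace ((model (m + k)).prod (𝓡 3)) z) := fun i =>
    (J fun z => z.1.1.a i.castSucc) * (J fun z => z.1.1.b i.castSucc.succ) *
      (J fun z => z.1.1.a i.castSucc)⁻¹ with hf
  -- on the level set, the word of `Σ⁻` represents the holonomy around the curve `C`
  have hm : Wm.prod = Jet.central c Wm.prod.s * J fun z => z.1.1.b (Fin.last m).succ := by
    have h1 : Represents Wm.prod fun q : Level m k => q.1.1.b (Fin.last m).succ := by
      have h2 : (fun q : Level m k => q.1.1.b (Fin.last m).succ) = fun q =>
          (List.ofFn fun j => q.1.2.a j * q.1.2.b j.succ * (q.1.2.a j)⁻¹).prod := by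
        funext q
        rw [Fin.succ_last, eq_inv_of_mul_eq_one_right q.b_mul_b, b_zero, inv_inv]
        rfl
      rw [h2]
      exact Represents.prod_ofFn fun j => ((Represents.jet (ham j)).mul
        (Represents.jet (hbm j.succ))).mul (Represents.jet (ham j)).inv
    exact h1.exists_eq
  have hp : Wp.prod = (List.ofFn f).prod *
      (A * (J fun z => z.1.1.b (Fin.last m).succ) * A⁻¹) := by
    rw [hWp, Jet.word, List.ofFn_succ', List.concat_eq_append, List.prod_append,
      List.prod_singleton]
  have hg : (Jet.word (fun i => J fun z => z.glue.a i) (fun i => J fun z => z.glue.b i.succ)).prod =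
      (List.ofFn f).prod * (A * Wm.prod * A⁻¹) := by
    have h1 : (fun i : Fin (m + k) => (J fun z => z.glue.a i) * (J fun z => z.glue.b i.succ) *
        (J fun z => z.glue.a i)⁻¹) = Fin.append f (fun j : Fin k =>
          A * ((J fun z => z.1.2.a j) * (J fun z => z.1.2.b j.succ) *
            (J fun z => z.1.2.a j)⁻¹) * A⁻¹) := by
      funext i
      have hga : ∀ (z : Level m k) j, z.glue.a j = z.glueA j := fun _ _ => rfl
      have hgb : ∀ (z : Level m k) j, z.glue.b j = z.glueB j := fun _ _ => rfl
      refine Fin.addCases (fun i => ?_) (fun j => ?_) i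
      · simp only [hga, hgb, glueA, glueB, Fin.cons_succ, Fin.append_left, hf]
      · simp only [hga, hgb, glueA, glueB, Fin.cons_succ, Fin.append_right]
        exact conj_jet_mul (hap _) (ham j) _
    rw [Jet.word, h1, List.ofFn_fin_append, List.prod_append, hWm, Jet.word, ← MulAut.conj_apply,
      map_list_prod, List.map_ofFn]
    rfl
  refine (congrArg Jet.s hg).trans ?_
  have h : (List.ofFn f).prod * (A * Wm.prod * A⁻¹) = Jet.central c Wm.prod.s * Wp.prod := by
    rw [hp]
    conv_lhs => rw [hm]
    exact Jet.mul_conj_central_mul (c := c) Wm.prod.s (List.ofFn f).prod A _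
  rw [h, Jet.central_mul_s]
  exact add_comm _ _

/-- On the level set `μ_{B⁻_1}` is the inverse of `μ_{B⁺_{m+2}}`, hence the fusion term is
`(1/2) ⟨-α, α⟩ = 0`. -/
theorem pullback_incl_cutForm :
    (cutForm c m k).pullback ((model (m + k)).prod (𝓡 3)) (cutModel m k) incl =
      (form c (m + k)).pullback ((model (m + k)).prod (𝓡 3)) (model (m + k)) glue := by
  funext z
  rw [pullback_glue_form]
  have hi := (contMDiff_incl (m := m) (k := k)).mdifferentiable (by simp) z
  have h1 := pullback_pullback (I := (model (m + k)).prod (𝓡 3)) (I' := cutModel m k)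
    (I'' := model (m + 1)) (f := incl (m := m) (k := k)) (g := Prod.fst) (form c (m + 1)) (x := z)
    mdifferentiableAt_fst hi
  have h2 := pullback_pullback (I := (model (m + k)).prod (𝓡 3)) (I' := cutModel m k)
    (I'' := model k) (f := incl (m := m) (k := k)) (g := Prod.snd) (form c k) (x := z)
    mdifferentiableAt_snd hi
  refine Eq.trans ?_ (congrArg₂ (· + ·) h1 h2)
  have hg : ContMDiff ((model (m + k)).prod (𝓡 3)) (𝓡 3) ∞
      fun z : Level m k => z.1.1.b (Fin.last (m + 1)) := (contMDiff_b _).comp contMDiff_plus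
  have hL : mcLeft ((model (m + k)).prod (𝓡 3))
      (fun z : Level m k => moment z.incl.1 (Fin.last (m + 1))) z =
      -mcRight ((model (m + k)).prod (𝓡 3)) (fun z : Level m k => z.1.1.b (Fin.last (m + 1))) z :=
    mcLeft_inv (matDiffAt_of_contMDiff hg)
  have hR : mcRight ((model (m + k)).prod (𝓡 3)) (fun z : Level m k => moment z.incl.2 0) z =
      mcRight ((model (m + k)).prod (𝓡 3)) (fun z : Level m k => z.1.1.b (Fin.last (m + 1))) z := by
    have h3 : (fun z : Level m k => moment z.incl.2 0) =
        fun z : Level m k => z.1.1.b (Fin.last (m + 1)) :=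
      funext fun z => (eq_inv_of_mul_eq_one_right z.b_mul_b).symm
    rw [h3]
  have hL' := mcLeft_comp (I := (model (m + k)).prod (𝓡 3)) (I' := cutModel m k)
    (f := incl (m := m) (k := k))
    (g := fun q : CutModuli m k => moment q.1 (Fin.last (m + 1))) (x := z)
    ((contMDiff_inv_SU2 ((contMDiff_b _).comp contMDiff_fst)).mdifferentiable (by simp) _) hi
  have hR' := mcRight_comp (I := (model (m + k)).prod (𝓡 3)) (I' := cutModel m k)
    (f := incl (m := m) (k := k)) (g := fun q : CutModuli m k => moment q.2 0) (x := z)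
    ((contMDiff_inv_SU2 ((contMDiff_b _).comp contMDiff_snd)).mdifferentiable (by simp) _) hi
  have hw : wedge c ((mcLeft (cutModel m k)
        (fun q : CutModuli m k => moment q.1 (Fin.last (m + 1))) z.incl).comp
          (mfderiv ((model (m + k)).prod (𝓡 3)) (cutModel m k) incl z))
      ((mcRight (cutModel m k) (fun q : CutModuli m k => moment q.2 0) z.incl).comp
        (mfderiv ((model (m + k)).prod (𝓡 3)) (cutModel m k) incl z)) = 0 := by
    rw [← hL', ← hR', hL, hR]
    exact wedge_neg_self c _
  ext v
  have hv := DFunLike.congr_fun hw v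
  refine (add_eq_left (a := (_ : ℝ)) (b := (1 / 2 : ℝ) * _)).2 ?_
  exact mul_eq_zero_of_right _ hv

end Level

end Gluing

end

theorem mainTheorem9 (c : ℝ) (hc : c ≠ 0) (m k : ℕ) :
    -- the extended moduli space of `Σ` is a quasi-Hamiltonian `Gⁿ`-space, `n = m + k + 1`
    Gluing.IsQuasiHamiltonian c (Gluing.ExtModuli.model (m + k)) (m + k + 1)
      (Gluing.ExtModuli.form c (m + k)) Gluing.ExtModuli.moment ∧
    -- the level set is an embedded submanifold of dimension `6(m + k) + 3`
    ∃ (_ : ChartedSpace (ModelProd (Gluing.ExtModuli.Model (m + k)) (EuclideanSpace ℝ (Fin 3)))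
        (Gluing.Level m k))
      (_ : IsManifold ((Gluing.ExtModuli.model (m + k)).prod (𝓡 3)) ∞ (Gluing.Level m k)),
      Gluing.IsSmoothEmb ((Gluing.ExtModuli.model (m + k)).prod (𝓡 3)) (Gluing.cutModel m k)
        (Gluing.Level.incl (m := m) (k := k)) ∧
    -- the two-forms of the fusion product and of the glued surface agree on the level set
    (Gluing.cutForm c m k).pullback ((Gluing.ExtModuli.model (m + k)).prod (𝓡 3))
        (Gluing.cutModel m k) Gluing.Level.incl =
      (Gluing.ExtModuli.form c (m + k)).pullback ((Gluing.ExtModuli.model (m + k)).prod (𝓡 3))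
        (Gluing.ExtModuli.model (m + k)) Gluing.Level.glue ∧
    -- the quotient is a manifold and the projection to it is a submersion
    ∃ (_ : ChartedSpace (Gluing.ExtModuli.Model (m + k)) (Gluing.Reduced m k))
      (_ : IsManifold (Gluing.ExtModuli.model (m + k)) ∞ (Gluing.Reduced m k)),
      Gluing.IsSurjSubmersion ((Gluing.ExtModuli.model (m + k)).prod (𝓡 3))
        (Gluing.ExtModuli.model (m + k)) (Gluing.Reduced.mk (m := m) (k := k)) ∧
    -- the quotient is quasi-Hamiltonian with the two-form induced by the one of the fusion product
    ∃ Ω : Gluing.TwoForm (Gluing.ExtModuli.model (m + k)) (Gluing.Reduced m k),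
      Ω.pullback ((Gluing.ExtModuli.model (m + k)).prod (𝓡 3)) (Gluing.ExtModuli.model (m + k))
          Gluing.Reduced.mk =
        (Gluing.cutForm c m k).pullback ((Gluing.ExtModuli.model (m + k)).prod (𝓡 3))
          (Gluing.cutModel m k) Gluing.Level.incl ∧
      Gluing.IsQuasiHamiltonian c (Gluing.ExtModuli.model (m + k)) (m + k + 1) Ω
        Gluing.Reduced.moment ∧
    -- the gluing map descends to an isomorphism of quasi-Hamiltonian spaces
    ∃ Φ : Diffeomorph (Gluing.ExtModuli.model (m + k)) (Gluing.ExtModuli.model (m + k))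
        (Gluing.Reduced m k) (Gluing.ExtModuli (m + k)) ∞,
      (∀ z : Gluing.Level m k, Φ (Gluing.Reduced.mk z) = z.glue) ∧
      Gluing.IsQuasiHamiltonianIso (Gluing.ExtModuli.model (m + k))
        (Gluing.ExtModuli.model (m + k)) (m + k + 1) Ω Gluing.Reduced.moment
        (Gluing.ExtModuli.form c (m + k)) Gluing.ExtModuli.moment Φ := by
  let i1 := Gluing.Level.charts m k
  let i2 := Gluing.Reduced.charts m k
  have h := Gluing.Level.pullback_incl_cutForm (c := c) (m := m) (k := k)
  exact ⟨Gluing.ExtModuli.isQuasiHamiltonian hc (m + k), i1, Gluing.Level.isManifold_charts,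
    Gluing.Level.isSmoothEmb_incl, h, i2, Gluing.Reduced.isManifold_charts,
    Gluing.Reduced.isSurjSubmersion_mk, Gluing.Reduced.form c m k,
    (Gluing.Reduced.pullback_mk_form c).trans h.symm,
    Gluing.Reduced.isQuasiHamiltonian_form hc m k, Gluing.Reduced.diffeo m k,
    Gluing.Reduced.diffeo_mk, Gluing.Reduced.diffeo_smul, rfl, Gluing.Reduced.moment_diffeo⟩
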